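/- A (connected) map $\mathcal M$, possibly non-orientable or with boundary, is given by a non-empty set $\Phi$ of flags with permutations $r_0,r_1,r_2$ of $\Phi$ which satisfy $r_0^2=r_1^2=r_2^2=(r_0r_2)^2=1$ and generate a transitive group. Its edges are the orbits of $\langle r_0,r_2\rangle$, its automorphism group $\mathrm{Aut}\,\mathcal M$ is the centraliser of $\langle r_0,r_1,r_2\rangle$ in $\mathrm{Sym}(\Phi)$, and $\mathcal M$ is edge-transitive if $\mathrm{Aut}\,\mathcal M$ permutes the edges transitively. The quotient map $\mathcal M/\mathrm{Aut}\,\mathcal M$ has as flags the orbits of $\mathrm{Aut}\,\mathcal M$ on $\Phi$, with the induced permutations. The 14 Graver–Watkins classes $T$ of edge-transitive maps are $1$, $3$ and $2^\sigma$, $2^\sigma\mathrm{ex}$, $4^\sigma$, $5^\sigma$ for $\sigma\in\{\emptyset,*,P\}$. An edge-transitive map $\mathcal M$ has class $T$ if $\mathcal M/\mathrm{Aut}\,\mathcal M$ is isomorphic to the following one-edge map $\mathcal N(T)$, where $t_\sigma$ denotes $r_2$, $r_0$, $r_0r_2$ for $\sigma=\emptyset,*,P$ respectively: - $T=1$: one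 flag. - $T=2^\sigma$ and $T=2^\sigma\mathrm{ex}$: two flags, $t_\sigma$ is trivial and the other two of $r_0,r_2,r_0r_2$ transpose the flags; $r_1$ is trivial for $2^\sigma$ and transposes the flags for $2^\sigma\mathrm{ex}$. - $T=3$, $4^\sigma$, $5^\sigma$: four flags, permuted regularly by $\langle r_0,r_2\rangle\cong V_4$; $r_1$ is trivial for $3$, is the transposition of the two flags in one orbit of $t_\sigma$ for $4^\sigma$, and equals $t_\sigma$ for $5^\sigma$. Let $\mathcal G(T)$ be the class of groups isomorphic to $\mathrm{Aut}\,\mathcal M$ for some map $\mathcal M$ of class $T$. **Theorem.** Let $n\ge 5$ and let $T$ be one of the 14 classes. Then $A_n\in\mathcal G(T)$ if and only if one of the following holds: - $T=1$, and $n=5$ or $n\ge 9$; - $T=2^\sigma$, $3$ or $4^\sigma$ for some $\sigma$; - $T=2^\sigma\mathrm{ex}$ for some $\sigma$, and $n\ge 8$; - $T=5^\sigma$ for some $\sigma$, and $n\ge 7$. -/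

import Mathlib

namespace EdgeTransitive

/-- A connected map, possibly non-orientable and possibly with boundary, given by its
(non-empty) set of flags and by the three permutations of the flags which change the vertex
(`r₀`), the edge (`r₁`), the face (`r₂`) of a flag, a flag without a partner being fixed.
Equivalently, a transitive permutation representation of
`Γ = ⟨R₀, R₁, R₂ | R₀² = R₁² = R₂² = (R₀R₂)² = 1⟩`.  The group `Γ` is countable, so that
flag sets in `Type` give all such representations up to isomorphism. -/
structure FlagMap where
  Flag : Type
  nonempty : Nonempty Flag
  r₀ : Equiv.Perm Flag
  r₁ : Equiv.Perm Flag
  r₂ : Equiv.Perm Flag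
  r₀_sq : r₀ ^ 2 = 1
  r₁_sq : r₁ ^ 2 = 1
  r₂_sq : r₂ ^ 2 = 1
  r₀r₂_sq : (r₀ * r₂) ^ 2 = 1
  connected : MulAction.IsPretransitive (Subgroup.closure {r₀, r₁, r₂}) Flag

namespace FlagMap

/-- The monodromy group. -/
def mon (M : FlagMap) : Subgroup (Equiv.Perm M.Flag) :=
  Subgroup.closure {M.r₀, M.r₁, M.r₂}

/-- The automorphism group: the centraliser of the monodromy group in the symmetric group on
the flags. -/
def aut (M : FlagMap) : Subgroup (Equiv.Perm M.Flag) :=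
  Subgroup.centralizer (M.mon : Set (Equiv.Perm M.Flag))

/-- The edge of a flag, as a set of flags: its orbit under `⟨r₀, r₂⟩`. -/
def edge (M : FlagMap) (φ : M.Flag) : Set M.Flag :=
  MulAction.orbit (Subgroup.closure {M.r₀, M.r₂}) φ

/-- The automorphism group permutes the edges transitively. -/
def IsEdgeTransitive (M : FlagMap) : Prop :=
  ∀ φ ψ : M.Flag, ∃ a ∈ M.aut, a '' M.edge φ = M.edge ψ

/-- Isomorphism of maps. -/
def Isomorphic (M N : FlagMap) : Prop :=
  ∃ e : M.Flag ≃ N.Flag, (∀ φ, e (M.r₀ φ) = N.r₀ (e φ)) ∧ (∀ φ, e (M.r₁ φ) = N.r₁ (e φ)) ∧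
    (∀ φ, e (M.r₂ φ) = N.r₂ (e φ))

/-- The flags of the quotient map: the orbits of the automorphism group on flags. -/
abbrev QuotientFlag (M : FlagMap) : Type := MulAction.orbitRel.Quotient M.aut M.Flag

theorem mon_map_orbit (M : FlagMap) (g : Equiv.Perm M.Flag) (hg : g ∈ M.mon) (φ ψ : M.Flag)
    (h : MulAction.orbitRel M.aut M.Flag φ ψ) :
    MulAction.orbitRel M.aut M.Flag (g φ) (g ψ) := by
  obtain ⟨a, rfl⟩ := h
  refine ⟨a, ?_⟩
  exact (DFunLike.congr_fun (Subgroup.mem_centralizer_iff.mp a.2 g hg) ψ).symm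

/-- The action of the monodromy group on the orbits of the automorphism group. -/
def quotientPerm (M : FlagMap) : M.mon →* Equiv.Perm M.QuotientFlag where
  toFun g :=
    { toFun := Quotient.map g.1 (M.mon_map_orbit g.1 g.2)
      invFun := Quotient.map (g⁻¹).1 (M.mon_map_orbit (g⁻¹).1 (g⁻¹).2)
      left_inv := by rintro ⟨φ⟩; exact congrArg (Quotient.mk _) (g.1.symm_apply_apply φ)
      right_inv := by rintro ⟨φ⟩; exact congrArg (Quotient.mk _) (g.1.apply_symm_apply φ) }
  map_one' := by ext ⟨φ⟩; rfl
  map_mul' g h := by ext ⟨φ⟩; rfl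

theorem r₀_mem (M : FlagMap) : M.r₀ ∈ M.mon := Subgroup.subset_closure (by simp)

theorem r₁_mem (M : FlagMap) : M.r₁ ∈ M.mon := Subgroup.subset_closure (by simp)

theorem r₂_mem (M : FlagMap) : M.r₂ ∈ M.mon := Subgroup.subset_closure (by simp)

/-- The quotient map `M / Aut M`. -/
def quotient (M : FlagMap) : FlagMap where
  Flag := M.QuotientFlag
  nonempty := M.nonempty.map (Quotient.mk _)
  r₀ := M.quotientPerm ⟨M.r₀, M.r₀_mem⟩
  r₁ := M.quotientPerm ⟨M.r₁, M.r₁_mem⟩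
  r₂ := M.quotientPerm ⟨M.r₂, M.r₂_mem⟩
  r₀_sq := by
    rw [← map_pow, show (⟨M.r₀, M.r₀_mem⟩ : M.mon) ^ 2 = 1 from Subtype.ext M.r₀_sq, map_one]
  r₁_sq := by
    rw [← map_pow, show (⟨M.r₁, M.r₁_mem⟩ : M.mon) ^ 2 = 1 from Subtype.ext M.r₁_sq, map_one]
  r₂_sq := by
    rw [← map_pow, show (⟨M.r₂, M.r₂_mem⟩ : M.mon) ^ 2 = 1 from Subtype.ext M.r₂_sq, map_one]
  r₀r₂_sq := by
    rw [← map_mul, ← map_pow, show ((⟨M.r₀, M.r₀_mem⟩ : M.mon) * ⟨M.r₂, M.r₂_mem⟩) ^ 2 = 1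
      from Subtype.ext M.r₀r₂_sq, map_one]
  connected := by
    have key : ∀ g (hg : g ∈ M.mon), M.quotientPerm ⟨g, hg⟩ ∈ Subgroup.closure
        {M.quotientPerm ⟨M.r₀, M.r₀_mem⟩, M.quotientPerm ⟨M.r₁, M.r₁_mem⟩,
          M.quotientPerm ⟨M.r₂, M.r₂_mem⟩} := by
      intro g hg
      induction hg using Subgroup.closure_induction with
      | mem x hx =>
        apply Subgroup.subset_closure
        rcases hx with rfl | rfl | rfl <;> simp
      | one => exact (map_one M.quotientPerm).symm ▸ one_mem _
      | mul x y hx hy ihx ihy =>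
        exact (map_mul M.quotientPerm ⟨x, hx⟩ ⟨y, hy⟩).symm ▸ mul_mem ihx ihy
      | inv x hx ih => exact (map_inv M.quotientPerm ⟨x, hx⟩).symm ▸ inv_mem ih
    refine ⟨?_⟩
    rintro ⟨φ⟩ ⟨ψ⟩
    obtain ⟨⟨g, hg⟩, h⟩ := M.connected.exists_smul_eq φ ψ
    exact ⟨⟨_, key g hg⟩, congrArg (Quotient.mk _) h⟩

/-- A map with one edge: `r₀` and `r₂` already act transitively on the flags. -/
def ofOneEdge (F : Type) [Nonempty F] (r₀ r₁ r₂ : Equiv.Perm F) (h₀ : r₀ ^ 2 = 1)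
    (h₁ : r₁ ^ 2 = 1) (h₂ : r₂ ^ 2 = 1) (h₀₂ : (r₀ * r₂) ^ 2 = 1)
    (h : ∀ φ ψ : F, ψ = φ ∨ ψ = r₀ φ ∨ ψ = r₂ φ ∨ ψ = (r₀ * r₂) φ) : FlagMap where
  Flag := F
  nonempty := inferInstance
  r₀ := r₀
  r₁ := r₁
  r₂ := r₂
  r₀_sq := h₀
  r₁_sq := h₁
  r₂_sq := h₂
  r₀r₂_sq := h₀₂
  connected := by
    have m₀ : r₀ ∈ Subgroup.closure {r₀, r₁, r₂} := Subgroup.subset_closure (by simp)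
    have m₂ : r₂ ∈ Subgroup.closure {r₀, r₁, r₂} := Subgroup.subset_closure (by simp)
    refine ⟨fun φ ψ => ?_⟩
    rcases h φ ψ with e | e | e | e
    · exact ⟨1, e.symm⟩
    · exact ⟨⟨_, m₀⟩, e.symm⟩
    · exact ⟨⟨_, m₂⟩, e.symm⟩
    · exact ⟨⟨_, mul_mem m₀ m₂⟩, e.symm⟩

end FlagMap

/-- The superscripts `∅`, `*`, `P`. -/
inductive Superscript
  | empty
  | star
  | petrie
  deriving DecidableEq

/-- The symbols of the fourteen Graver--Watkins classes of edge-transitive maps: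
`1`, `2^σ`, `2^σ ex`, `3`, `4^σ`, `5^σ`. -/
inductive EdgeClass
  | one
  | two (σ : Superscript)
  | twoEx (σ : Superscript)
  | three
  | four (σ : Superscript)
  | five (σ : Superscript)
  deriving DecidableEq

/-- The three involutions `r₂`, `r₀`, `r₀ r₂` of an edge group, indexed by `∅`, `*`, `P`.
Duality transposes `r₀` and `r₂`, Petrie duality transposes `r₀` and `r₀ r₂`. -/
def Superscript.pick {F : Type} (r₀ r₂ : Equiv.Perm F) : Superscript → Equiv.Perm F
  | .empty => r₂
  | .star => r₀
  | .petrie => r₀ * r₂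

/-- On two flags: `r₀` for the map with one edge in which the involution indexed by `σ` acts
trivially and the other two act as the transposition. -/
def twoFlag₀ : Superscript → Equiv.Perm Bool
  | .empty => Equiv.boolNot
  | .star => 1
  | .petrie => Equiv.boolNot

/-- On two flags: `r₂` for the map with one edge in which the involution indexed by `σ` acts
trivially and the other two act as the transposition. -/
def twoFlag₂ : Superscript → Equiv.Perm Bool
  | .empty => 1
  | .star => Equiv.boolNot
  | .petrie => Equiv.boolNot

/-- On four flags, on which the edge group `⟨r₀, r₂⟩` acts regularly: `r₀`. -/
def fourFlag₀ : Equiv.Perm (Bool × Bool) := Equiv.prodCongr Equiv.boolNot (Equiv.refl Bool)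

/-- On four flags, on which the edge group `⟨r₀, r₂⟩` acts regularly: `r₂`. -/
def fourFlag₂ : Equiv.Perm (Bool × Bool) := Equiv.prodCongr (Equiv.refl Bool) Equiv.boolNot

/-- The fourteen basic maps `𝒩(T)` with one edge.
* `1`: a single flag.
* `2^σ`, `2^σ ex`: two flags, with `r₂`, `r₀`, `r₀ r₂` trivial for `σ = ∅, *, P` respectively,
  and with `r₁` trivial, respectively transposing the two flags.
* `3`, `4^σ`, `5^σ`: four flags, regularly permuted by `⟨r₀, r₂⟩`; `r₁` is trivial for `3`;
  for `5^σ` it is `r₂`, `r₀`, `r₀ r₂` for `σ = ∅, *, P` respectively, and for `4^σ` it agrees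
  with the latter on two flags, which it transposes, and fixes the other two. -/
def EdgeClass.basicMap : EdgeClass → FlagMap
  | .one => FlagMap.ofOneEdge Unit 1 1 1 (by decide) (by decide) (by decide) (by decide)
      (by decide)
  | .two σ => FlagMap.ofOneEdge Bool (twoFlag₀ σ) 1 (twoFlag₂ σ)
      (by cases σ <;> decide) (by decide) (by cases σ <;> decide) (by cases σ <;> decide)
      (by cases σ <;> decide)
  | .twoEx σ => FlagMap.ofOneEdge Bool (twoFlag₀ σ) Equiv.boolNot (twoFlag₂ σ)
      (by cases σ <;> decide) (by decide) (by cases σ <;> decide) (by cases σ <;> decide)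
      (by cases σ <;> decide)
  | .three => FlagMap.ofOneEdge (Bool × Bool) fourFlag₀ 1 fourFlag₂
      (by decide) (by decide) (by decide) (by decide) (by decide)
  | .four σ => FlagMap.ofOneEdge (Bool × Bool) fourFlag₀
      (Equiv.swap (false, false) (σ.pick fourFlag₀ fourFlag₂ (false, false))) fourFlag₂
      (by decide) (by cases σ <;> decide) (by decide) (by decide) (by decide)
  | .five σ => FlagMap.ofOneEdge (Bool × Bool) fourFlag₀ (σ.pick fourFlag₀ fourFlag₂) fourFlag₂
      (by decide) (by cases σ <;> decide) (by decide) (by decide) (by decide)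

/-- The map `M` is an edge-transitive map of class `T`: its quotient by its automorphism group
is isomorphic to the basic map `𝒩(T)`. -/
def FlagMap.InClass (M : FlagMap) (T : EdgeClass) : Prop :=
  M.IsEdgeTransitive ∧ M.quotient.Isomorphic T.basicMap

/-- Membership of `G` in `𝒢(T)`: the group `G` is isomorphic to the automorphism group of some
map of class `T`. -/
def IsRealised (T : EdgeClass) (G : Type*) [Group G] : Prop :=
  ∃ M : FlagMap, M.InClass T ∧ Nonempty (G ≃* M.aut)

end EdgeTransitive

/-! A map of class `T` with automorphism group `G` is a regular covering of the one-edge map `𝒩(T)`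
with covering group `G`, so it is encoded by voltages in `G` on the flags of `𝒩(T)`. Conversely,
voltages that generate `G` along closed walks give a connected covering on which `G` acts
(`Voltage.derived`). Its automorphism group is exactly `G` as soon as words with trivial voltage at
one flag of `𝒩(T)` tell that flag from all the others (`Voltage.isRealised_of_separated`). In the
other direction, a section of the projection to the quotient recovers voltages, and a non-trivial
automorphism of `𝒩(T)` compatible with an automorphism of `G` would lift and contradict the class
(`Section.eq_self_of_compatible`). Duality and Petrie duality permute the superscripts, so only `σ =
∅` needs work.

The question becomes one of generating sets. Class `1` asks for three generators of square `1`, two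
of them commuting. Class `2ex` asks for generators `s`, `z` with `s² = 1`, and class `5` for any two
generators, in both cases not simultaneously inverted by an automorphism. Classes `2`, `3`, `4`
impose no obstruction on alternating groups of degree at least `5`.

Existence: a primitive group containing a 3-cycle contains the alternating group. Triples and chiral
pairs are given explicitly in four consecutive degrees and are then prolonged by a path of four
points, which changes neither the words producing the 3-cycle nor the chiral relation. The few
degrees left over are handled by explicit generators.

Non-existence: for `A₅` and `A₆`, the identification of `A₆` with `PSL(2,9)` is used; matrices `A`,
`B` of determinant `1` are both inverted by conjugation with `AB - BA` when this is invertible. For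
class `1` in degrees `6`, `7`, `8` and class `2ex` in degree `7`, a finite search finds for every
candidate either a family of sets preserved by all generators but not by the alternating group, or,
in the latter case, an inverting involution. -/

namespace EdgeTransitive

/-! ### Automorphisms, quotients and the map operations -/

namespace FlagMap

theorem r₀_r₀ (M : FlagMap) (φ : M.Flag) : M.r₀ (M.r₀ φ) = φ := by
  have := DFunLike.congr_fun M.r₀_sq φ
  rwa [sq] at this

theorem r₁_r₁ (M : FlagMap) (φ : M.Flag) : M.r₁ (M.r₁ φ) = φ := by
  have := DFunLike.congr_fun M.r₁_sq φ
  rwa [sq] at this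

theorem r₂_r₂ (M : FlagMap) (φ : M.Flag) : M.r₂ (M.r₂ φ) = φ := by
  have := DFunLike.congr_fun M.r₂_sq φ
  rwa [sq] at this

theorem r₀_r₂ (M : FlagMap) (φ : M.Flag) : M.r₀ (M.r₂ φ) = M.r₂ (M.r₀ φ) := by
  have h : M.r₀ (M.r₂ (M.r₀ (M.r₂ (M.r₂ (M.r₀ φ))))) = M.r₂ (M.r₀ φ) := by
    have := DFunLike.congr_fun M.r₀r₂_sq (M.r₂ (M.r₀ φ))
    rwa [sq] at this
  rwa [M.r₂_r₂, M.r₀_r₀] at h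

theorem mem_aut_iff (M : FlagMap) (a : Equiv.Perm M.Flag) :
    a ∈ M.aut ↔ (∀ φ, a (M.r₀ φ) = M.r₀ (a φ)) ∧ (∀ φ, a (M.r₁ φ) = M.r₁ (a φ)) ∧
      (∀ φ, a (M.r₂ φ) = M.r₂ (a φ)) := by
  unfold aut mon
  rw [Subgroup.centralizer_closure, Subgroup.mem_centralizer_iff]
  constructor
  · intro h
    exact ⟨fun φ => (DFunLike.congr_fun (h M.r₀ (by simp)) φ).symm,
      fun φ => (DFunLike.congr_fun (h M.r₁ (by simp)) φ).symm,
      fun φ => (DFunLike.congr_fun (h M.r₂ (by simp)) φ).symm⟩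
  · rintro ⟨h₀, h₁, h₂⟩ r (rfl | rfl | rfl)
    · exact Equiv.ext fun φ => (h₀ φ).symm
    · exact Equiv.ext fun φ => (h₁ φ).symm
    · exact Equiv.ext fun φ => (h₂ φ).symm

/-- A property of flags which holds for one flag and is inherited by adjacent flags holds for
all flags. -/
theorem connected_induction (M : FlagMap) {P : M.Flag → Prop} (φ₀ : M.Flag) (h : P φ₀)
    (h₀ : ∀ φ, P φ → P (M.r₀ φ)) (h₁ : ∀ φ, P φ → P (M.r₁ φ)) (h₂ : ∀ φ, P φ → P (M.r₂ φ))
    (φ : M.Flag) : P φ := by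
  have key : ∀ g ∈ Subgroup.closure {M.r₀, M.r₁, M.r₂}, ∀ φ, P φ ↔ P (g φ) := by
    intro g hg
    induction hg using Subgroup.closure_induction with
    | mem x hx =>
      intro φ
      rcases hx with rfl | rfl | rfl
      · exact ⟨h₀ φ, fun h => by simpa [M.r₀_r₀] using h₀ _ h⟩
      · exact ⟨h₁ φ, fun h => by simpa [M.r₁_r₁] using h₁ _ h⟩
      · exact ⟨h₂ φ, fun h => by simpa [M.r₂_r₂] using h₂ _ h⟩
    | one => exact fun φ => Iff.rfl
    | mul x y _ _ ihx ihy => exact fun φ => (ihy φ).trans (ihx _)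
    | inv x _ ih => exact fun φ => by simpa using (ih (x⁻¹ φ)).symm
  obtain ⟨⟨g, hg⟩, rfl⟩ := M.connected.exists_smul_eq φ₀ φ
  exact (key g hg φ₀).1 h

theorem aut_mon_comm (M : FlagMap) {a g : Equiv.Perm M.Flag} (ha : a ∈ M.aut) (hg : g ∈ M.mon)
    (φ : M.Flag) : a (g φ) = g (a φ) :=
  (DFunLike.congr_fun (Subgroup.mem_centralizer_iff.mp ha g hg) φ).symm

/-- The automorphism group acts semiregularly on the flags. -/
theorem aut_ext (M : FlagMap) {a b : Equiv.Perm M.Flag} (ha : a ∈ M.aut) (hb : b ∈ M.aut)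
    {φ₀ : M.Flag} (h : a φ₀ = b φ₀) : a = b := by
  rw [mem_aut_iff] at ha hb
  ext φ
  refine M.connected_induction (P := fun φ => a φ = b φ) φ₀ h ?_ ?_ ?_ φ
  · exact fun φ h => by rw [ha.1, hb.1, h]
  · exact fun φ h => by rw [ha.2.1, hb.2.1, h]
  · exact fun φ h => by rw [ha.2.2, hb.2.2, h]

/-- The map `f` identifies `N` with the quotient of `M` by its automorphism group. -/
structure IsAutQuotient (M N : FlagMap) (f : M.Flag → N.Flag) : Prop where
  surjective : Function.Surjective f
  map_r₀ : ∀ φ, f (M.r₀ φ) = N.r₀ (f φ)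
  map_r₁ : ∀ φ, f (M.r₁ φ) = N.r₁ (f φ)
  map_r₂ : ∀ φ, f (M.r₂ φ) = N.r₂ (f φ)
  eq_iff : ∀ φ ψ, f φ = f ψ ↔ ∃ a ∈ M.aut, a φ = ψ

/-- Replaces the quotient type by a projection of flags whose fibres are the orbits of the
automorphism group; later constructions exhibit such a projection. -/
theorem quotient_isomorphic_iff (M N : FlagMap) :
    M.quotient.Isomorphic N ↔ ∃ f, IsAutQuotient M N f := by
  have mk_eq : ∀ φ ψ : M.Flag, (Quotient.mk _ φ : M.QuotientFlag) = Quotient.mk _ ψ ↔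
      ∃ a ∈ M.aut, a φ = ψ := by
    intro φ ψ
    rw [eq_comm, Quotient.eq]
    constructor
    · rintro ⟨a, h⟩
      exact ⟨a.1, a.2, h⟩
    · rintro ⟨a, ha, h⟩
      exact ⟨⟨a, ha⟩, h⟩
  constructor
  · rintro ⟨e, h₀, h₁, h₂⟩
    refine ⟨fun φ => e (Quotient.mk _ φ), e.surjective.comp Quotient.mk_surjective,
      fun φ => h₀ (Quotient.mk _ φ), fun φ => h₁ (Quotient.mk _ φ),
      fun φ => h₂ (Quotient.mk _ φ), fun φ ψ => ?_⟩
    rw [← mk_eq]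
    exact e.injective.eq_iff
  · rintro ⟨f, hf⟩
    let g : M.QuotientFlag → N.Flag := Quotient.lift f (by
      intro φ ψ h
      exact (hf.eq_iff φ ψ).2 ((mk_eq φ ψ).1 (Quotient.sound h)))
    have hg : Function.Bijective g := by
      constructor
      · rintro ⟨φ⟩ ⟨ψ⟩ h
        exact (mk_eq φ ψ).2 ((hf.eq_iff φ ψ).1 h)
      · intro y
        obtain ⟨φ, rfl⟩ := hf.surjective y
        exact ⟨Quotient.mk _ φ, rfl⟩
    refine ⟨Equiv.ofBijective g hg, ?_, ?_, ?_⟩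
    · rintro ⟨φ⟩; exact hf.map_r₀ φ
    · rintro ⟨φ⟩; exact hf.map_r₁ φ
    · rintro ⟨φ⟩; exact hf.map_r₂ φ

/-- The map has only one edge. -/
def OneEdge (N : FlagMap) : Prop :=
  ∀ x y : N.Flag, y = x ∨ y = N.r₀ x ∨ y = N.r₂ x ∨ y = N.r₀ (N.r₂ x)

/-- Since `N` has one edge, some element of the edge group moves `φ` into the fibre of `ψ`, and an
automorphism finishes the job; it commutes with `r₀` and `r₂`, hence carries edges to edges. So the
quotient alone decides the class. -/
theorem IsAutQuotient.isEdgeTransitive {M N : FlagMap} {f : M.Flag → N.Flag}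
    (hf : IsAutQuotient M N f) (hN : N.OneEdge) : M.IsEdgeTransitive := by
  intro φ ψ
  have hsub : Subgroup.closure {M.r₀, M.r₂} ≤ M.mon :=
    Subgroup.closure_mono (by intro x hx; rcases hx with rfl | rfl <;> simp)
  have m₀ : M.r₀ ∈ Subgroup.closure {M.r₀, M.r₂} := Subgroup.subset_closure (by simp)
  have m₂ : M.r₂ ∈ Subgroup.closure {M.r₀, M.r₂} := Subgroup.subset_closure (by simp)
  obtain ⟨g, hg, hgφ⟩ : ∃ g ∈ Subgroup.closure {M.r₀, M.r₂}, f (g φ) = f ψ := by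
    rcases hN (f φ) (f ψ) with h | h | h | h
    · exact ⟨1, one_mem _, h.symm⟩
    · exact ⟨_, m₀, by rw [hf.map_r₀, h]⟩
    · exact ⟨_, m₂, by rw [hf.map_r₂, h]⟩
    · exact ⟨_, mul_mem m₀ m₂, by rw [Equiv.Perm.mul_apply, hf.map_r₀, hf.map_r₂, h]⟩
  obtain ⟨a, ha, rfl⟩ := (hf.eq_iff _ _).1 hgφ
  refine ⟨a, ha, ?_⟩
  ext χ
  constructor
  · rintro ⟨_, ⟨⟨k, hk⟩, rfl⟩, rfl⟩
    refine ⟨⟨k * g⁻¹, mul_mem hk (inv_mem hg)⟩, ?_⟩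
    change (k * g⁻¹) (a (g φ)) = a (k φ)
    rw [M.aut_mon_comm ha (hsub hk), M.aut_mon_comm ha (hsub hg)]
    simp
  · rintro ⟨⟨k, hk⟩, rfl⟩
    refine ⟨(k * g) φ, ⟨⟨k * g, mul_mem hk hg⟩, rfl⟩, ?_⟩
    exact M.aut_mon_comm ha (hsub hk) (g φ)

theorem OneEdge.isAutQuotient_iff {M N : FlagMap} (hN : N.OneEdge) :
    M.IsEdgeTransitive ∧ M.quotient.Isomorphic N ↔ ∃ f, IsAutQuotient M N f := by
  rw [quotient_isomorphic_iff]
  exact ⟨fun h => h.2, fun ⟨f, hf⟩ => ⟨hf.isEdgeTransitive hN, f, hf⟩⟩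

/-- The operations on maps which permute the involutions `r₂`, `r₀`, `r₀ r₂`: the identity,
duality, and Petrie duality (conjugated so as to fix `r₀`). -/
def twist (σ : Superscript) (M : FlagMap) : FlagMap where
  Flag := M.Flag
  nonempty := M.nonempty
  r₀ := match σ with
    | .empty => M.r₀
    | .star => M.r₂
    | .petrie => M.r₀
  r₁ := M.r₁
  r₂ := match σ with
    | .empty => M.r₂
    | .star => M.r₀
    | .petrie => M.r₀ * M.r₂
  r₀_sq := by cases σ <;> simp [M.r₀_sq, M.r₂_sq]
  r₁_sq := M.r₁_sq
  r₂_sq := by cases σ <;> simp [M.r₀_sq, M.r₂_sq, M.r₀r₂_sq]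
  r₀r₂_sq := by
    cases σ
    · exact M.r₀r₂_sq
    · ext φ; simp [sq, M.r₀_r₂, M.r₀_r₀, M.r₂_r₂]
    · ext φ; simp [sq, M.r₀_r₀, M.r₂_r₂]
  connected := by
    refine ⟨fun φ ψ => ?_⟩
    obtain ⟨g, h⟩ := M.connected.exists_smul_eq φ ψ
    refine ⟨⟨g.1, ?_⟩, h⟩
    refine (Subgroup.closure_le _).2 ?_ g.2
    have mem : ∀ {a b c x : Equiv.Perm M.Flag}, x = a ∨ x = b ∨ x = c →
        x ∈ Subgroup.closure {a, b, c} := fun h => Subgroup.subset_closure h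
    rintro x (rfl | rfl | rfl) <;> cases σ
    · exact mem (Or.inl rfl)
    · exact mem (Or.inr (Or.inr rfl))
    · exact mem (Or.inl rfl)
    · exact mem (Or.inr (Or.inl rfl))
    · exact mem (Or.inr (Or.inl rfl))
    · exact mem (Or.inr (Or.inl rfl))
    · exact mem (Or.inr (Or.inr rfl))
    · exact mem (Or.inl rfl)
    · have := mul_mem (mem (x := M.r₀) (a := M.r₀) (b := M.r₁) (c := M.r₀ * M.r₂) (Or.inl rfl))
        (mem (x := M.r₀ * M.r₂) (Or.inr (Or.inr rfl)))
      rwa [← mul_assoc, ← sq, M.r₀_sq, one_mul] at this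

/-- The twisted involutions generate the same monodromy group, hence have the same centraliser. -/
theorem aut_twist (σ : Superscript) (M : FlagMap) : (M.twist σ).aut = M.aut := by
  ext a
  refine (mem_aut_iff (M.twist σ) a).trans (Iff.trans ?_ (mem_aut_iff M a).symm)
  cases σ
  · exact Iff.rfl
  · exact ⟨fun h => ⟨h.2.2, h.2.1, h.1⟩, fun h => ⟨h.2.2, h.2.1, h.1⟩⟩
  · constructor
    · rintro ⟨h₀, h₁, h₂⟩
      refine ⟨h₀, h₁, fun φ => ?_⟩
      have := (h₀ _).symm.trans (h₂ φ)
      exact M.r₀.injective this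
    · rintro ⟨h₀, h₁, h₂⟩
      exact ⟨h₀, h₁, fun φ => (h₀ _).trans (congrArg M.r₀ (h₂ φ))⟩

theorem IsAutQuotient.twist (σ : Superscript) {M N : FlagMap} {f : M.Flag → N.Flag}
    (hf : IsAutQuotient M N f) : IsAutQuotient (M.twist σ) (N.twist σ) f where
  surjective := hf.surjective
  map_r₀ := by cases σ <;> [exact hf.map_r₀; exact hf.map_r₂; exact hf.map_r₀]
  map_r₁ := hf.map_r₁
  map_r₂ := by
    cases σ
    · exact hf.map_r₂
    · exact hf.map_r₀
    · exact fun φ => (hf.map_r₀ _).trans (congrArg N.r₀ (hf.map_r₂ φ))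
  eq_iff := by rw [aut_twist]; exact hf.eq_iff

theorem IsAutQuotient.comp_iso {M N N' : FlagMap} {f : M.Flag → N.Flag}
    (hf : IsAutQuotient M N f) (h : N.Isomorphic N') : ∃ f', IsAutQuotient M N' f' := by
  obtain ⟨e, h₀, h₁, h₂⟩ := h
  exact ⟨e ∘ f, e.surjective.comp hf.surjective,
    fun φ => by simp [hf.map_r₀, h₀], fun φ => by simp [hf.map_r₁, h₁],
    fun φ => by simp [hf.map_r₂, h₂], fun φ ψ => by simp [hf.eq_iff]⟩

end FlagMap

theorem FlagMap.oneEdge_ofOneEdge {F : Type} [Nonempty F] {r₀ r₁ r₂ : Equiv.Perm F}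
    {h₀ : r₀ ^ 2 = 1} {h₁ : r₁ ^ 2 = 1} {h₂ : r₂ ^ 2 = 1} {h₀₂ : (r₀ * r₂) ^ 2 = 1}
    {h : ∀ φ ψ : F, ψ = φ ∨ ψ = r₀ φ ∨ ψ = r₂ φ ∨ ψ = (r₀ * r₂) φ} :
    (FlagMap.ofOneEdge F r₀ r₁ r₂ h₀ h₁ h₂ h₀₂ h).OneEdge :=
  h

theorem EdgeClass.oneEdge_basicMap (T : EdgeClass) : T.basicMap.OneEdge := by
  cases T with
  | one => exact FlagMap.oneEdge_ofOneEdge (h := by decide)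
  | two σ => exact FlagMap.oneEdge_ofOneEdge (h := by cases σ <;> decide)
  | twoEx σ => exact FlagMap.oneEdge_ofOneEdge (h := by cases σ <;> decide)
  | three => exact FlagMap.oneEdge_ofOneEdge (h := by decide)
  | four σ => exact FlagMap.oneEdge_ofOneEdge (h := by decide)
  | five σ => exact FlagMap.oneEdge_ofOneEdge (h := by decide)

theorem FlagMap.inClass_iff (M : FlagMap) (T : EdgeClass) :
    M.InClass T ↔ ∃ f, FlagMap.IsAutQuotient M T.basicMap f :=
  T.oneEdge_basicMap.isAutQuotient_iff

/-- If twisting interchanges two basic maps then the two classes realise the same groups. -/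
theorem IsRealised.of_twist {T T' : EdgeClass} (σ : Superscript)
    (h : (T.basicMap.twist σ).Isomorphic T'.basicMap) {G : Type*} [Group G]
    (hG : IsRealised T G) : IsRealised T' G := by
  obtain ⟨M, hM, ⟨e⟩⟩ := hG
  obtain ⟨f, hf⟩ := (M.inClass_iff T).1 hM
  refine ⟨M.twist σ, ((M.twist σ).inClass_iff T').2 ((hf.twist σ).comp_iso h), ⟨e.trans ?_⟩⟩
  exact MulEquiv.subgroupCongr (FlagMap.aut_twist σ M).symm

theorem isRealised_two_iff (σ : Superscript) {G : Type*} [Group G] :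
    IsRealised (.two σ) G ↔ IsRealised (.two .empty) G := by
  constructor
  · refine IsRealised.of_twist (T := .two σ) (T' := .two .empty) σ ⟨Equiv.refl Bool, ?_, ?_, ?_⟩ <;>
      cases σ <;> rintro (_ | _) <;> rfl
  · refine IsRealised.of_twist (T := .two .empty) (T' := .two σ) σ ⟨Equiv.refl Bool, ?_, ?_, ?_⟩ <;>
      cases σ <;> rintro (_ | _) <;> rfl

theorem isRealised_twoEx_iff (σ : Superscript) {G : Type*} [Group G] :
    IsRealised (.twoEx σ) G ↔ IsRealised (.twoEx .empty) G := by
  constructor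
  · refine IsRealised.of_twist (T := .twoEx σ) (T' := .twoEx .empty) σ ⟨Equiv.refl Bool, ?_, ?_, ?_⟩ <;>
      cases σ <;> rintro (_ | _) <;> rfl
  · refine IsRealised.of_twist (T := .twoEx .empty) (T' := .twoEx σ) σ ⟨Equiv.refl Bool, ?_, ?_, ?_⟩ <;>
      cases σ <;> rintro (_ | _) <;> rfl

/-- An involution on the four flags which conjugates `fourFlag₂` to the involution indexed
by `σ`. -/
def fourFlagIso : Superscript → Equiv.Perm (Bool × Bool)
  | .empty => 1
  | .star => Equiv.prodComm Bool Bool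
  | .petrie => Equiv.swap (true, true) (false, true)

theorem isRealised_four_iff (σ : Superscript) {G : Type*} [Group G] :
    IsRealised (.four σ) G ↔ IsRealised (.four .empty) G := by
  constructor
  · refine IsRealised.of_twist (T := .four σ) (T' := .four .empty) σ ⟨fourFlagIso σ, ?_, ?_, ?_⟩ <;>
      cases σ <;> rintro ⟨_ | _, _ | _⟩ <;> rfl
  · refine IsRealised.of_twist (T := .four .empty) (T' := .four σ) σ ⟨fourFlagIso σ, ?_, ?_, ?_⟩ <;>
      cases σ <;> rintro ⟨_ | _, _ | _⟩ <;> rfl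

theorem isRealised_five_iff (σ : Superscript) {G : Type*} [Group G] :
    IsRealised (.five σ) G ↔ IsRealised (.five .empty) G := by
  constructor
  · refine IsRealised.of_twist (T := .five σ) (T' := .five .empty) σ ⟨fourFlagIso σ, ?_, ?_, ?_⟩ <;>
      cases σ <;> rintro ⟨_ | _, _ | _⟩ <;> rfl
  · refine IsRealised.of_twist (T := .five .empty) (T' := .five σ) σ ⟨fourFlagIso σ, ?_, ?_, ?_⟩ <;>
      cases σ <;> rintro ⟨_ | _, _ | _⟩ <;> rfl

end EdgeTransitive

/-! ### Regular coverings constructed from voltages -/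

namespace EdgeTransitive

/-- A voltage assignment on the map `N` with values in the group `G`. -/
structure Voltage (N : FlagMap) (G : Type) [Group G] where
  v₀ : N.Flag → G
  v₁ : N.Flag → G
  v₂ : N.Flag → G
  v₀_inv : ∀ x, v₀ (N.r₀ x) * v₀ x = 1
  v₁_inv : ∀ x, v₁ (N.r₁ x) * v₁ x = 1
  v₂_inv : ∀ x, v₂ (N.r₂ x) * v₂ x = 1
  comm : ∀ x, v₀ (N.r₂ x) * v₂ x = v₂ (N.r₀ x) * v₀ x

namespace Voltage

variable {N : FlagMap} {G : Type} [Group G] (W : Voltage N G)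

/-- The lift of an involution of the flags. -/
def lift (r : Equiv.Perm N.Flag) (v : N.Flag → G) (hr : ∀ x, r (r x) = x)
    (hv : ∀ x, v (r x) * v x = 1) : Equiv.Perm (N.Flag × G) where
  toFun p := (r p.1, v p.1 * p.2)
  invFun p := (r p.1, v p.1 * p.2)
  left_inv p := by ext <;> simp [hr, ← mul_assoc, hv]
  right_inv p := by ext <;> simp [hr, ← mul_assoc, hv]

def R₀ : Equiv.Perm (N.Flag × G) := lift N.r₀ W.v₀ N.r₀_r₀ W.v₀_inv

def R₁ : Equiv.Perm (N.Flag × G) := lift N.r₁ W.v₁ N.r₁_r₁ W.v₁_inv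

def R₂ : Equiv.Perm (N.Flag × G) := lift N.r₂ W.v₂ N.r₂_r₂ W.v₂_inv

theorem R₀_apply (p : N.Flag × G) : W.R₀ p = (N.r₀ p.1, W.v₀ p.1 * p.2) := rfl

theorem R₁_apply (p : N.Flag × G) : W.R₁ p = (N.r₁ p.1, W.v₁ p.1 * p.2) := rfl

theorem R₂_apply (p : N.Flag × G) : W.R₂ p = (N.r₂ p.1, W.v₂ p.1 * p.2) := rfl

/-- The group generated by the lifted involutions. -/
def mon : Subgroup (Equiv.Perm (N.Flag × G)) := Subgroup.closure {W.R₀, W.R₁, W.R₂}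

theorem R₀_mem : W.R₀ ∈ W.mon := Subgroup.subset_closure (by simp)

theorem R₁_mem : W.R₁ ∈ W.mon := Subgroup.subset_closure (by simp)

theorem R₂_mem : W.R₂ ∈ W.mon := Subgroup.subset_closure (by simp)

theorem R₀_R₀ (p) : W.R₀ (W.R₀ p) = p := W.R₀.left_inv p

theorem R₁_R₁ (p) : W.R₁ (W.R₁ p) = p := W.R₁.left_inv p

theorem R₂_R₂ (p) : W.R₂ (W.R₂ p) = p := W.R₂.left_inv p

/-- The lifted map, if it is connected. -/
def derived (h : MulAction.IsPretransitive W.mon (N.Flag × G)) : FlagMap where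
  Flag := N.Flag × G
  nonempty := ⟨(N.nonempty.some, 1)⟩
  r₀ := W.R₀
  r₁ := W.R₁
  r₂ := W.R₂
  r₀_sq := Equiv.ext fun p => W.R₀_R₀ p
  r₁_sq := Equiv.ext fun p => W.R₁_R₁ p
  r₂_sq := Equiv.ext fun p => W.R₂_R₂ p
  r₀r₂_sq := by
    have hc : W.R₀ * W.R₂ = W.R₂ * W.R₀ := by
      ext p
      · exact N.r₀_r₂ _
      · simp only [Equiv.Perm.mul_apply, R₀_apply, R₂_apply, ← mul_assoc, W.comm]
    rw [sq, mul_assoc, ← mul_assoc W.R₂, ← hc, mul_assoc, ← mul_assoc W.R₀]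
    ext p : 1
    simp [Equiv.Perm.mul_apply, R₀_R₀, R₂_R₂]
  connected := h

/-- Monodromy acts between fibres by left translations. In particular a word which fixes one flag of
a fibre fixes the whole fibre pointwise. -/
theorem mon_apply_fst {w : Equiv.Perm (N.Flag × G)} (hw : w ∈ W.mon) (x : N.Flag) :
    ∃ (y : N.Flag) (k : G), ∀ g, w (x, g) = (y, k * g) := by
  induction hw using Subgroup.closure_induction generalizing x with
  | mem w hw =>
    rcases hw with rfl | rfl | rfl
    exacts [⟨N.r₀ x, W.v₀ x, fun g => W.R₀_apply (x, g)⟩,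
      ⟨N.r₁ x, W.v₁ x, fun g => W.R₁_apply (x, g)⟩, ⟨N.r₂ x, W.v₂ x, fun g => W.R₂_apply (x, g)⟩]
  | one => exact ⟨x, 1, by simp⟩
  | mul a b _ _ iha ihb =>
    obtain ⟨y, k, h⟩ := ihb x
    obtain ⟨z, l, h'⟩ := iha y
    exact ⟨z, l * k, fun g => by simp [h, h', mul_assoc]⟩
  | inv a ha ih =>
    obtain ⟨⟨y, k⟩, hy⟩ : ∃ p, a p = (x, 1) := a.surjective _
    obtain ⟨x', l, h⟩ := ih y
    have e := (h k).symm.trans hy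
    rw [Prod.mk.injEq] at e
    refine ⟨y, l⁻¹, fun g => ?_⟩
    rw [Equiv.Perm.inv_eq_iff_eq, h, e.1]
    simp

/-- The lifted map is connected as soon as closed walks at one flag have voltages which
generate `G`. -/
theorem connected_of_closure (x₀ : N.Flag) (S : Set G) (hS : Subgroup.closure S = ⊤)
    (hloop : ∀ k ∈ S, ∃ w ∈ W.mon, ∀ g, w (x₀, g) = (x₀, k * g)) :
    MulAction.IsPretransitive W.mon (N.Flag × G) := by
  have hloop' : ∀ k : G, ∃ w ∈ W.mon, ∀ g, w (x₀, g) = (x₀, k * g) := by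
    intro k
    have hk : k ∈ Subgroup.closure S := hS ▸ Subgroup.mem_top k
    induction hk using Subgroup.closure_induction with
    | mem k hk => exact hloop k hk
    | one => exact ⟨1, one_mem _, by simp⟩
    | mul a b _ _ iha ihb =>
      obtain ⟨w, hw, h⟩ := iha
      obtain ⟨w', hw', h'⟩ := ihb
      exact ⟨w * w', mul_mem hw hw', fun g => by simp [h, h', mul_assoc]⟩
    | inv a _ ih =>
      obtain ⟨w, hw, h⟩ := ih
      exact ⟨w⁻¹, inv_mem hw, fun g => by rw [Equiv.Perm.inv_eq_iff_eq, h]; simp⟩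
  -- Loops fill the fibre over `x₀`; the others are reached along walks in `N`, aiming at the
  -- inverse voltage times `g` so that the last step lands on `g`.
  have key : ∀ x : N.Flag, ∀ g, ∃ w ∈ W.mon, w (x₀, 1) = (x, g) := by
    intro x
    refine N.connected_induction (P := fun x => ∀ g, ∃ w ∈ W.mon, w (x₀, 1) = (x, g)) x₀
      ?_ ?_ ?_ ?_ x
    · intro g
      obtain ⟨w, hw, h⟩ := hloop' g
      exact ⟨w, hw, by simp [h]⟩
    · intro x h g
      obtain ⟨w, hw, h⟩ := h ((W.v₀ x)⁻¹ * g)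
      exact ⟨W.R₀ * w, mul_mem W.R₀_mem hw, by simp [h, R₀_apply]⟩
    · intro x h g
      obtain ⟨w, hw, h⟩ := h ((W.v₁ x)⁻¹ * g)
      exact ⟨W.R₁ * w, mul_mem W.R₁_mem hw, by simp [h, R₁_apply]⟩
    · intro x h g
      obtain ⟨w, hw, h⟩ := h ((W.v₂ x)⁻¹ * g)
      exact ⟨W.R₂ * w, mul_mem W.R₂_mem hw, by simp [h, R₂_apply]⟩
  refine ⟨fun p q => ?_⟩
  obtain ⟨w, hw, h⟩ := key p.1 p.2
  obtain ⟨w', hw', h'⟩ := key q.1 q.2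
  refine ⟨⟨w' * w⁻¹, mul_mem hw' (inv_mem hw)⟩, ?_⟩
  change (w' * w⁻¹) p = q
  rw [Equiv.Perm.mul_apply, show w⁻¹ p = (x₀, 1) from by
    rw [Equiv.Perm.inv_eq_iff_eq, h], h']

/-- The group `G` as a group of automorphisms of the lifted map. -/
def deck (h : MulAction.IsPretransitive W.mon (N.Flag × G)) : G →* (W.derived h).aut where
  -- Voltages multiply from the left, so multiplication from the right commutes with them; the
  -- inverse makes this a homomorphism.
  toFun k := ⟨(Equiv.prodCongr (Equiv.refl N.Flag) (Equiv.mulRight k⁻¹) :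
    Equiv.Perm (N.Flag × G)), by
      refine ((W.derived h).mem_aut_iff _).2 ⟨fun p => ?_, fun p => ?_, fun p => ?_⟩
      · exact Prod.ext rfl (mul_assoc _ _ _)
      · exact Prod.ext rfl (mul_assoc _ _ _)
      · exact Prod.ext rfl (mul_assoc _ _ _)⟩
  map_one' := by
    refine Subtype.ext (Equiv.ext fun p => Prod.ext rfl ?_)
    exact (congrArg _ inv_one).trans (mul_one _)
  map_mul' a b := by
    refine Subtype.ext (Equiv.ext fun p => Prod.ext rfl ?_)
    exact (congrArg _ (mul_inv_rev a b)).trans (mul_assoc _ _ _).symm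

theorem deck_apply (h : MulAction.IsPretransitive W.mon (N.Flag × G)) (k : G) (x : N.Flag)
    (g : G) : (W.deck h k).1 (x, g) = (x, g * k⁻¹) := rfl

/-- If some flag `x₀` of `N` is distinguished from all others by closed walks with trivial
voltage, then the automorphisms of the lifted map preserve the fibres. -/
theorem apply_fst_of_separated (h : MulAction.IsPretransitive W.mon (N.Flag × G)) (x₀ : N.Flag)
    (hsep : ∀ y, y ≠ x₀ → ∃ w ∈ W.mon, w (x₀, 1) = (x₀, 1) ∧ w (y, 1) ≠ (y, 1))
    (a : Equiv.Perm (N.Flag × G)) (ha : ∀ w ∈ W.mon, ∀ p, a (w p) = w (a p)) (p : N.Flag × G) :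
    (a p).1 = p.1 := by
  -- The separating word fixes the fibre over `x₀` pointwise, so it fixes the image `(y, k)`, hence
  -- by translation also `(y, 1)`.
  have base : ∀ g y k, a (x₀, g) = (y, k) → y = x₀ := by
    intro g y k e
    by_contra hy
    obtain ⟨w, hw, h1, h2⟩ := hsep y hy
    obtain ⟨y', l, hl⟩ := W.mon_apply_fst hw y
    obtain ⟨x', m, hm⟩ := W.mon_apply_fst hw x₀
    have e1 : x' = x₀ ∧ m = 1 := by simpa [hm] using h1
    have e2 := ha w hw (x₀, g)
    rw [e, hl, hm, e1.1, e1.2, one_mul, e, Prod.mk.injEq] at e2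
    apply h2
    rw [hl, ← e2.1]
    simpa using e2.2
  -- Any flag is brought to the fibre over `x₀` by a monodromy element, and `a` commutes with it.
  obtain ⟨⟨w, hw⟩, hwp⟩ := h.exists_smul_eq p (x₀, 1)
  change w p = (x₀, 1) at hwp
  obtain ⟨z, m, hm⟩ := W.mon_apply_fst hw (a p).1
  have e := ha w hw p
  rw [hwp, show w (a p) = (z, m * (a p).2) from hm _] at e
  have hz := base 1 _ _ e
  obtain ⟨x', n, hn⟩ := W.mon_apply_fst (inv_mem hw) x₀
  have e3 : w⁻¹ (w p) = p := by simp
  have e4 : w⁻¹ (w (a p)) = a p := by simp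
  rw [hwp, hn] at e3
  rw [show w (a p) = (z, m * (a p).2) from hm _, hz, hn] at e4
  have e5 : x' = p.1 := congrArg Prod.fst e3
  have e6 : x' = (a p).1 := congrArg Prod.fst e4
  exact e6.symm.trans e5

/-- Once automorphisms preserve fibres, the orbits are the fibres, because `deck` is already
transitive on each of them. Semiregularity then leaves no automorphism outside `deck`. -/
theorem isRealised_of_separated {T : EdgeClass} (W : Voltage T.basicMap G)
    (h : MulAction.IsPretransitive W.mon (T.basicMap.Flag × G)) (x₀ : T.basicMap.Flag)
    (hsep : ∀ y, y ≠ x₀ → ∃ w ∈ W.mon, w (x₀, 1) = (x₀, 1) ∧ w (y, 1) ≠ (y, 1)) :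
    IsRealised T G := by
  have fib : ∀ a ∈ (W.derived h).aut, ∀ p, (a p).1 = p.1 := fun a ha =>
    W.apply_fst_of_separated h x₀ hsep a fun w hw p => (W.derived h).aut_mon_comm ha hw p
  have hq : FlagMap.IsAutQuotient (W.derived h) T.basicMap Prod.fst :=
    { surjective := fun x => ⟨(x, 1), rfl⟩
      map_r₀ := fun _ => rfl
      map_r₁ := fun _ => rfl
      map_r₂ := fun _ => rfl
      eq_iff := by
        rintro ⟨x, g⟩ ⟨y, k⟩
        constructor
        · rintro (rfl : x = y)
          refine ⟨_, (W.deck h (k⁻¹ * g)).2, (W.deck_apply h _ x g).trans ?_⟩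
          rw [mul_inv_rev, inv_inv, mul_inv_cancel_left]
        · rintro ⟨a, ha, e⟩
          exact (fib a ha (x, g)).symm.trans (congrArg Prod.fst e) }
  refine ⟨W.derived h, ((W.derived h).inClass_iff T).2 ⟨_, hq⟩,
    ⟨MulEquiv.ofBijective (W.deck h) ⟨?_, ?_⟩⟩⟩
  · intro k l e
    have e' : (x₀, 1 * k⁻¹) = (x₀, 1 * l⁻¹) := by
      rw [← W.deck_apply h k, ← W.deck_apply h l, e]
    simpa using (Prod.mk.inj e').2
  · rintro ⟨a, ha⟩
    have e : a (x₀, 1) = (x₀, (a (x₀, 1)).2) := Prod.ext (fib a ha _) rfl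
    refine ⟨(a (x₀, 1)).2⁻¹, Subtype.ext ?_⟩
    refine (W.derived h).aut_ext (W.deck h _).2 ha (φ₀ := (x₀, 1)) ?_
    refine (W.deck_apply h _ x₀ 1).trans (Eq.trans ?_ e.symm)
    rw [inv_inv, one_mul]

/-- A word in closed walks at `x`. -/
theorem freeGroup_lift_apply {ι : Type*} (w : ι → Equiv.Perm (N.Flag × G)) (c : ι → G)
    (x : N.Flag) (hw : ∀ i g, w i (x, g) = (x, c i * g)) (D : FreeGroup ι) (g : G) :
    FreeGroup.lift w D (x, g) = (x, FreeGroup.lift c D * g) := by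
  induction D using FreeGroup.induction_on generalizing g with
  | C1 => simp
  | of i => simp [hw]
  | inv_of i _ =>
    simp only [map_inv, FreeGroup.lift_apply_of]
    rw [Equiv.Perm.inv_eq_iff_eq, hw]
    simp
  | mul a b iha ihb => simp [iha, ihb, mul_assoc]

theorem freeGroup_lift_mem {ι : Type*} {w : ι → Equiv.Perm (N.Flag × G)}
    (hw : ∀ i, w i ∈ W.mon) (D : FreeGroup ι) : FreeGroup.lift w D ∈ W.mon := by
  have : Set.range (FreeGroup.lift w) ⊆ W.mon := by
    rw [← MonoidHom.coe_range, FreeGroup.range_lift_eq_closure]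
    exact (Subgroup.closure_le _).2 (by rintro _ ⟨i, rfl⟩; exact hw i)
  exact this ⟨D, rfl⟩

end Voltage

/-! ### Voltages recovered from a given map -/

/-- The section `s` of the projection to the quotient gives rise to voltages. -/
structure Section (M N : FlagMap) (f : M.Flag → N.Flag) where
  s : N.Flag → M.Flag
  f_s : ∀ x, f (s x) = x
  v₀ : N.Flag → M.aut
  v₁ : N.Flag → M.aut
  v₂ : N.Flag → M.aut
  r₀_s : ∀ x, M.r₀ (s x) = (v₀ x).1 (s (N.r₀ x))
  r₁_s : ∀ x, M.r₁ (s x) = (v₁ x).1 (s (N.r₁ x))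
  r₂_s : ∀ x, M.r₂ (s x) = (v₂ x).1 (s (N.r₂ x))

namespace Section

variable {M N : FlagMap} {f : M.Flag → N.Flag}

/-- With `exists_eq`, this makes pairs (automorphism, flag of `N`) coordinates on the flags of `M`;
relations in `M` can then be read off on the voltages. -/
theorem eq_of_apply_eq (hf : FlagMap.IsAutQuotient M N f) (S : Section M N f) {a b : M.aut}
    {x y : N.Flag} (h : a.1 (S.s x) = b.1 (S.s y)) : x = y ∧ a = b := by
  have h1 : x = y := by
    rw [← S.f_s x, ← S.f_s y, hf.eq_iff]
    exact ⟨b.1⁻¹ * a.1, mul_mem (inv_mem b.2) a.2, by simp [h]⟩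
  subst h1
  exact ⟨rfl, Subtype.ext (M.aut_ext a.2 b.2 h)⟩

theorem exists_eq (hf : FlagMap.IsAutQuotient M N f) (S : Section M N f) (φ : M.Flag) :
    ∃ (a : M.aut) (x : N.Flag), φ = a.1 (S.s x) := by
  obtain ⟨a, ha, h⟩ := (hf.eq_iff (S.s (f φ)) φ).1 (S.f_s _)
  exact ⟨⟨a, ha⟩, f φ, h.symm⟩

theorem r₀_apply (S : Section M N f) (a : M.aut) (x : N.Flag) :
    M.r₀ (a.1 (S.s x)) = (a * S.v₀ x).1 (S.s (N.r₀ x)) := by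
  rw [← ((M.mem_aut_iff a.1).1 a.2).1, S.r₀_s]; rfl

theorem r₁_apply (S : Section M N f) (a : M.aut) (x : N.Flag) :
    M.r₁ (a.1 (S.s x)) = (a * S.v₁ x).1 (S.s (N.r₁ x)) := by
  rw [← ((M.mem_aut_iff a.1).1 a.2).2.1, S.r₁_s]; rfl

theorem r₂_apply (S : Section M N f) (a : M.aut) (x : N.Flag) :
    M.r₂ (a.1 (S.s x)) = (a * S.v₂ x).1 (S.s (N.r₂ x)) := by
  rw [← ((M.mem_aut_iff a.1).1 a.2).2.2, S.r₂_s]; rfl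

theorem v₀_mul (hf : FlagMap.IsAutQuotient M N f) (S : Section M N f) (x : N.Flag) :
    S.v₀ x * S.v₀ (N.r₀ x) = 1 := by
  have h := S.r₀_apply (S.v₀ x) (N.r₀ x)
  rw [← S.r₀_s, M.r₀_r₀, N.r₀_r₀] at h
  exact (S.eq_of_apply_eq hf (a := 1) h).2.symm

theorem v₁_mul (hf : FlagMap.IsAutQuotient M N f) (S : Section M N f) (x : N.Flag) :
    S.v₁ x * S.v₁ (N.r₁ x) = 1 := by
  have h := S.r₁_apply (S.v₁ x) (N.r₁ x)
  rw [← S.r₁_s, M.r₁_r₁, N.r₁_r₁] at h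
  exact (S.eq_of_apply_eq hf (a := 1) h).2.symm

theorem v₂_mul (hf : FlagMap.IsAutQuotient M N f) (S : Section M N f) (x : N.Flag) :
    S.v₂ x * S.v₂ (N.r₂ x) = 1 := by
  have h := S.r₂_apply (S.v₂ x) (N.r₂ x)
  rw [← S.r₂_s, M.r₂_r₂, N.r₂_r₂] at h
  exact (S.eq_of_apply_eq hf (a := 1) h).2.symm

theorem v_comm (hf : FlagMap.IsAutQuotient M N f) (S : Section M N f) (x : N.Flag) :
    S.v₀ x * S.v₂ (N.r₀ x) = S.v₂ x * S.v₀ (N.r₂ x) := by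
  have h1 := S.r₂_apply (S.v₀ x) (N.r₀ x)
  have h2 := S.r₀_apply (S.v₂ x) (N.r₂ x)
  rw [← S.r₀_s, ← M.r₀_r₂, S.r₂_s, h2] at h1
  exact (S.eq_of_apply_eq hf h1.symm).2

/-- The voltages generate the automorphism group. -/
theorem closure_eq_top (hf : FlagMap.IsAutQuotient M N f) (S : Section M N f) (H : Subgroup M.aut)
    (h₀ : ∀ x, S.v₀ x ∈ H) (h₁ : ∀ x, S.v₁ x ∈ H) (h₂ : ∀ x, S.v₂ x ∈ H) : H = ⊤ := by
  rw [eq_top_iff]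
  rintro b -
  obtain ⟨x₀⟩ := N.nonempty
  have key := M.connected_induction
    (P := fun φ => ∀ (a : M.aut) (x : N.Flag), φ = a.1 (S.s x) → a ∈ H)
    (S.s x₀) ?_ ?_ ?_ ?_ (b.1 (S.s x₀))
  · exact key b x₀ rfl
  · intro a x h
    have h' : (1 : M.aut).1 (S.s x₀) = a.1 (S.s x) := h
    rw [← (S.eq_of_apply_eq hf h').2]
    exact one_mem _
  · intro φ hφ a x h
    obtain ⟨c, y, rfl⟩ := S.exists_eq hf φ
    rw [r₀_apply] at h
    rw [← (S.eq_of_apply_eq hf h).2]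
    exact mul_mem (hφ c y rfl) (h₀ y)
  · intro φ hφ a x h
    obtain ⟨c, y, rfl⟩ := S.exists_eq hf φ
    rw [r₁_apply] at h
    rw [← (S.eq_of_apply_eq hf h).2]
    exact mul_mem (hφ c y rfl) (h₁ y)
  · intro φ hφ a x h
    obtain ⟨c, y, rfl⟩ := S.exists_eq hf φ
    rw [r₂_apply] at h
    rw [← (S.eq_of_apply_eq hf h).2]
    exact mul_mem (hφ c y rfl) (h₂ y)

/-- An automorphism of the group together with a compatible automorphism of the quotient lifts
to an automorphism of the map; hence the latter is trivial. -/
theorem eq_self_of_compatible (hf : FlagMap.IsAutQuotient M N f) (S : Section M N f)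
    (α : M.aut ≃* M.aut) (τ : Equiv.Perm N.Flag)
    (t₀ : ∀ x, τ (N.r₀ x) = N.r₀ (τ x)) (t₁ : ∀ x, τ (N.r₁ x) = N.r₁ (τ x))
    (t₂ : ∀ x, τ (N.r₂ x) = N.r₂ (τ x)) (h₀ : ∀ x, α (S.v₀ x) = S.v₀ (τ x))
    (h₁ : ∀ x, α (S.v₁ x) = S.v₁ (τ x)) (h₂ : ∀ x, α (S.v₂ x) = S.v₂ (τ x)) (x : N.Flag) :
    τ x = x := by
  choose c y hcy using S.exists_eq hf
  have c_eq : ∀ (a : M.aut) x, c (a.1 (S.s x)) = a := fun a x =>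
    ((S.eq_of_apply_eq hf (hcy (a.1 (S.s x)))).2).symm
  have y_eq : ∀ (a : M.aut) x, y (a.1 (S.s x)) = x := fun a x =>
    ((S.eq_of_apply_eq hf (hcy (a.1 (S.s x)))).1).symm
  -- The lift sends the flag with coordinates `(a, x)` to the one with coordinates `(α a, τ x)`; as
  -- an automorphism it must stay in the fibres.
  let b : Equiv.Perm M.Flag :=
    { toFun := fun φ => (α (c φ)).1 (S.s (τ (y φ)))
      invFun := fun φ => (α.symm (c φ)).1 (S.s (τ.symm (y φ)))
      left_inv := fun φ => by
        simp only [c_eq, y_eq, MulEquiv.symm_apply_apply, Equiv.symm_apply_apply]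
        exact (hcy φ).symm
      right_inv := fun φ => by
        simp only [c_eq, y_eq, MulEquiv.apply_symm_apply, Equiv.apply_symm_apply]
        exact (hcy φ).symm }
  have hb : ∀ (a : M.aut) x, b (a.1 (S.s x)) = (α a).1 (S.s (τ x)) := fun a x => by
    change (α (c _)).1 (S.s (τ (y _))) = _
    rw [c_eq, y_eq]
  have hb_mem : b ∈ M.aut := by
    rw [M.mem_aut_iff]
    refine ⟨fun φ => ?_, fun φ => ?_, fun φ => ?_⟩ <;> obtain ⟨a, x, rfl⟩ := S.exists_eq hf φ
    · rw [r₀_apply, hb, hb, r₀_apply, map_mul, h₀, t₀]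
    · rw [r₁_apply, hb, hb, r₁_apply, map_mul, h₁, t₁]
    · rw [r₂_apply, hb, hb, r₂_apply, map_mul, h₂, t₂]
  have e : S.s (τ x) = b (S.s x) := by
    simpa using (hb 1 x).symm
  have := (hf.eq_iff (S.s x) (S.s (τ x))).2 ⟨b, hb_mem, e.symm⟩
  rw [S.f_s, S.f_s] at this
  exact this.symm

end Section

end EdgeTransitive

namespace EdgeTransitive

/-! ### Sufficient conditions on generators, class by class -/

section Realise

theorem perm_mul_apply_eq {X : Type*} {A B : Equiv.Perm X} {p q r : X} (hB : B p = q)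
    (hA : A q = r) : (A * B) p = r := by
  rw [Equiv.Perm.mul_apply, hB, hA]

variable {G : Type} [Group G]

theorem isRealised_one (a₀ a₁ a₂ : G) (h₀ : a₀ * a₀ = 1) (h₁ : a₁ * a₁ = 1) (h₂ : a₂ * a₂ = 1)
    (h₀₂ : a₀ * a₂ = a₂ * a₀) (hgen : Subgroup.closure {a₀, a₁, a₂} = ⊤) :
    IsRealised .one G := by
  let W : Voltage (EdgeClass.one).basicMap G :=
    { v₀ := fun _ => a₀
      v₁ := fun _ => a₁
      v₂ := fun _ => a₂
      v₀_inv := fun _ => h₀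
      v₁_inv := fun _ => h₁
      v₂_inv := fun _ => h₂
      comm := fun _ => h₀₂ }
  refine W.isRealised_of_separated (W.connected_of_closure () _ hgen ?_) () ?_
  · rintro k (rfl | rfl | rfl)
    exacts [⟨_, W.R₀_mem, fun g => rfl⟩, ⟨_, W.R₁_mem, fun g => rfl⟩, ⟨_, W.R₂_mem, fun g => rfl⟩]
  · exact fun y hy => (hy rfl).elim

/-- Voltages: `a` for `r₂` at both flags, `b` and `c` for `r₁` at the two flags, `1` for `r₀`. The
same word in `r₂`, `r₁` reads `D(a, b)` at one flag and `D(a, c)` at the other, which separates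
them. -/
theorem isRealised_two (a b c : G) (ha : a * a = 1) (hb : b * b = 1) (hc : c * c = 1)
    (hgen : Subgroup.closure {a, b, c} = ⊤) (D : FreeGroup (Fin 2))
    (hD : FreeGroup.lift ![a, b] D = 1) (hD' : FreeGroup.lift ![a, c] D ≠ 1) (σ : Superscript) :
    IsRealised (.two σ) G := by
  rw [isRealised_two_iff]
  let W : Voltage (EdgeClass.two .empty).basicMap G :=
    { v₀ := fun _ => 1
      v₁ := fun x : Bool => cond x c b
      v₂ := fun _ => a
      v₀_inv := fun _ => mul_one 1
      v₁_inv := by rintro (_ | _) <;> assumption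
      v₂_inv := fun _ => ha
      comm := fun _ => (one_mul a).trans (mul_one a).symm }
  have w₁ : ∀ (x : Bool) g, W.R₁ (x, g) = (x, cond x c b * g) := fun x g => rfl
  have w₂ : ∀ (x : Bool) g, W.R₂ (x, g) = (x, a * g) := by rintro (_ | _) g <;> rfl
  have w₀ : ∀ (x : Bool) g, W.R₀ (x, g) = (!x, g) := by
    rintro (_ | _) g <;> exact Prod.ext rfl (one_mul g)
  have word : ∀ (x : Bool) g, FreeGroup.lift ![W.R₂, W.R₁] D (x, g) =
      (x, FreeGroup.lift ![a, cond x c b] D * g) := by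
    intro x g
    refine Voltage.freeGroup_lift_apply (N := (EdgeClass.two .empty).basicMap) _ _ x
      (fun i g => ?_) D g
    fin_cases i
    exacts [w₂ x g, w₁ x g]
  refine W.isRealised_of_separated (W.connected_of_closure false _ hgen ?_) false ?_
  · rintro k (rfl | rfl | rfl)
    · exact ⟨_, W.R₂_mem, w₂ false⟩
    · exact ⟨_, W.R₁_mem, w₁ false⟩
    · exact ⟨_, mul_mem W.R₀_mem (mul_mem W.R₁_mem W.R₀_mem), fun g =>
        perm_mul_apply_eq (perm_mul_apply_eq (w₀ false g) (w₁ true g)) (w₀ true _)⟩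
  · rintro (_ | _) hy
    · exact (hy rfl).elim
    · refine ⟨FreeGroup.lift ![W.R₂, W.R₁] D, W.freeGroup_lift_mem (fun i => ?_) D, ?_, fun h => ?_⟩
      · fin_cases i
        exacts [W.R₂_mem, W.R₁_mem]
      · refine (word _ _).trans (Prod.ext rfl ?_)
        rw [mul_one]; exact hD
      · have h' := (Prod.mk.inj ((word _ _).symm.trans h)).2
        rw [mul_one] at h'
        exact hD' h'

/-- Here `r₀ r₁` is closed at both flags, with voltages `z` and `z⁻¹`, so that `D` separates the
flags. -/
theorem isRealised_twoEx (s z : G) (hs : s * s = 1)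
    (hgen : Subgroup.closure {s, z} = ⊤) (D : FreeGroup (Fin 2))
    (hD : FreeGroup.lift ![s, z] D = 1) (hD' : FreeGroup.lift ![s, z⁻¹] D ≠ 1)
    (σ : Superscript) : IsRealised (.twoEx σ) G := by
  rw [isRealised_twoEx_iff]
  let W : Voltage (EdgeClass.twoEx .empty).basicMap G :=
    { v₀ := fun _ => 1
      v₁ := fun x : Bool => cond x z⁻¹ z
      v₂ := fun _ => s
      v₀_inv := fun _ => mul_one 1
      v₁_inv := by
        rintro (_ | _)
        exacts [inv_mul_cancel z, mul_inv_cancel z]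
      v₂_inv := fun _ => hs
      comm := fun _ => (one_mul s).trans (mul_one s).symm }
  have w₁ : ∀ (x : Bool) g, W.R₁ (x, g) = (!x, cond x z⁻¹ z * g) := fun x g => rfl
  have w₂ : ∀ (x : Bool) g, W.R₂ (x, g) = (x, s * g) := by rintro (_ | _) g <;> rfl
  have w₀ : ∀ (x : Bool) g, W.R₀ (x, g) = (!x, g) := by
    rintro (_ | _) g <;> exact Prod.ext rfl (one_mul g)
  have w₀₁ : ∀ (x : Bool) g, (W.R₀ * W.R₁) (x, g) = (x, cond x z⁻¹ z * g) := by
    rintro (_ | _) g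
    exacts [perm_mul_apply_eq (w₁ _ _) (w₀ _ _), perm_mul_apply_eq (w₁ _ _) (w₀ _ _)]
  have word : ∀ (x : Bool) g, FreeGroup.lift ![W.R₂, W.R₀ * W.R₁] D (x, g) =
      (x, FreeGroup.lift ![s, cond x z⁻¹ z] D * g) := by
    intro x g
    refine Voltage.freeGroup_lift_apply (N := (EdgeClass.twoEx .empty).basicMap) _ _ x
      (fun i g => ?_) D g
    fin_cases i
    exacts [w₂ x g, w₀₁ x g]
  refine W.isRealised_of_separated (W.connected_of_closure false _ hgen ?_) false ?_
  · rintro k (rfl | rfl)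
    · exact ⟨_, W.R₂_mem, w₂ false⟩
    · exact ⟨_, mul_mem W.R₀_mem W.R₁_mem, w₀₁ false⟩
  · rintro (_ | _) hy
    · exact (hy rfl).elim
    · refine ⟨_, W.freeGroup_lift_mem (w := ![W.R₂, W.R₀ * W.R₁]) (fun i => ?_) D, ?_, fun h => ?_⟩
      · fin_cases i
        exacts [W.R₂_mem, mul_mem W.R₀_mem W.R₁_mem]
      · refine (word _ _).trans (Prod.ext rfl ?_)
        rw [mul_one]; exact hD
      · have h' := (Prod.mk.inj ((word _ _).symm.trans h)).2
        rw [mul_one] at h'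
        exact hD' h'

/-- The four flags carry the `r₁`-voltages `1`, `a`, `b`, `c`, so `r₁` alone singles out the flag
with voltage `1`. -/
theorem isRealised_three (a b c : G) (ha : a * a = 1) (hb : b * b = 1) (hc : c * c = 1)
    (ha1 : a ≠ 1) (hb1 : b ≠ 1) (hc1 : c ≠ 1)
    (hgen : Subgroup.closure {a, b, c} = ⊤) : IsRealised .three G := by
  let v : Bool × Bool → G
    | (false, false) => 1
    | (false, true) => a
    | (true, false) => b
    | (true, true) => c
  let W : Voltage (EdgeClass.three).basicMap G :=
    { v₀ := fun _ => 1
      v₁ := v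
      v₂ := fun _ => 1
      v₀_inv := fun _ => mul_one 1
      v₁_inv := by
        rintro ⟨_ | _, _ | _⟩
        exacts [mul_one 1, ha, hb, hc]
      v₂_inv := fun _ => mul_one 1
      comm := fun _ => rfl }
  have w₀ : ∀ (x y : Bool) g, W.R₀ ((x, y), g) = ((!x, y), g) := fun x y g =>
    Prod.ext rfl (one_mul g)
  have w₂ : ∀ (x y : Bool) g, W.R₂ ((x, y), g) = ((x, !y), g) := fun x y g =>
    Prod.ext rfl (one_mul g)
  have w₁ : ∀ (x y : Bool) g, W.R₁ ((x, y), g) = ((x, y), v (x, y) * g) := fun x y g => rfl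
  refine W.isRealised_of_separated (W.connected_of_closure (false, false) _ hgen ?_)
    (false, false) ?_
  · rintro k (rfl | rfl | rfl)
    · exact ⟨_, mul_mem W.R₂_mem (mul_mem W.R₁_mem W.R₂_mem), fun g =>
        perm_mul_apply_eq (perm_mul_apply_eq (w₂ false false g) (w₁ _ _ g)) (w₂ false true _)⟩
    · exact ⟨_, mul_mem W.R₀_mem (mul_mem W.R₁_mem W.R₀_mem), fun g =>
        perm_mul_apply_eq (perm_mul_apply_eq (w₀ false false g) (w₁ _ _ g)) (w₀ true false _)⟩
    · exact ⟨_, mul_mem W.R₀_mem (mul_mem W.R₂_mem (mul_mem W.R₁_mem (mul_mem W.R₂_mem W.R₀_mem))),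
        fun g => perm_mul_apply_eq (perm_mul_apply_eq (perm_mul_apply_eq (perm_mul_apply_eq
          (w₀ false false g) (w₂ true false g)) (w₁ true true g)) (w₂ true true _))
          (w₀ true false _)⟩
  · intro y hy
    refine ⟨_, W.R₁_mem, ?_, fun h => ?_⟩
    · exact Prod.ext rfl (mul_one 1)
    · have h' : v y * 1 = 1 := (Prod.mk.inj h).2
      rw [mul_one] at h'
      revert h' hy
      rcases y with ⟨_ | _, _ | _⟩
      exacts [fun hy _ => hy rfl, fun _ h => ha1 h, fun _ h => hb1 h, fun _ h => hc1 h]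

/-- On the two flags fixed by `r₁` in the basic map the voltages are `b` and `1`; `r₁` fixes only
the fibre of the latter. Hence separation takes place at `(true, true)`, generation at `(false,
false)`, and no relation between `b` and `z` is needed. -/
theorem isRealised_four (b z : G) (hb : b * b = 1) (hb1 : b ≠ 1)
    (hgen : Subgroup.closure {b, z} = ⊤) (σ : Superscript) : IsRealised (.four σ) G := by
  rw [isRealised_four_iff]
  let v : Bool × Bool → G
    | (false, false) => z
    | (false, true) => z⁻¹
    | (true, false) => b
    | (true, true) => 1
  let r : Bool × Bool → Bool × Bool
    | (false, false) => (false, true)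
    | (false, true) => (false, false)
    | (true, false) => (true, false)
    | (true, true) => (true, true)
  let W : Voltage (EdgeClass.four .empty).basicMap G :=
    { v₀ := fun _ => 1
      v₁ := v
      v₂ := fun _ => 1
      v₀_inv := fun _ => mul_one 1
      v₁_inv := by
        rintro ⟨_ | _, _ | _⟩
        exacts [inv_mul_cancel z, mul_inv_cancel z, hb, mul_one 1]
      v₂_inv := fun _ => mul_one 1
      comm := fun _ => rfl }
  have w₀ : ∀ (x y : Bool) g, W.R₀ ((x, y), g) = ((!x, y), g) := fun x y g =>
    Prod.ext rfl (one_mul g)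
  have w₂ : ∀ (x y : Bool) g, W.R₂ ((x, y), g) = ((x, !y), g) := fun x y g =>
    Prod.ext rfl (one_mul g)
  have w₁ : ∀ (x : Bool × Bool) g, W.R₁ (x, g) = (r x, v x * g) := by
    rintro ⟨_ | _, _ | _⟩ g <;> rfl
  refine W.isRealised_of_separated (W.connected_of_closure (false, false) _ hgen ?_)
    (true, true) ?_
  · rintro k (rfl | rfl)
    · exact ⟨_, mul_mem W.R₀_mem (mul_mem W.R₁_mem W.R₀_mem), fun g =>
        perm_mul_apply_eq (perm_mul_apply_eq (w₀ false false g) (w₁ (true, false) g))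
          (w₀ true false _)⟩
    · exact ⟨_, mul_mem W.R₂_mem W.R₁_mem, fun g =>
        perm_mul_apply_eq (w₁ (false, false) g) (w₂ false true _)⟩
  · intro y hy
    refine ⟨_, W.R₁_mem, Prod.ext rfl (mul_one 1), fun h => ?_⟩
    have h' : r y = y ∧ v y * 1 = 1 := Prod.mk.inj ((w₁ y 1).symm.trans h)
    rw [mul_one] at h'
    revert h' hy
    rcases y with ⟨_ | _, _ | _⟩
    · exact fun _ h => absurd h.1 (by decide : ((false, true) : Bool × Bool) ≠ (false, false))
    · exact fun _ h => absurd h.1 (by decide : ((false, false) : Bool × Bool) ≠ (false, true))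
    · exact fun _ h => hb1 h.2
    · exact fun hy _ => hy rfl

/-- The closed walks `p` and `q` below read `(a, b)`, `(a⁻¹, b⁻¹)`, `(b, a)`, `(b⁻¹, a⁻¹)` at the
four flags. The word `D` excludes the second pair, the power `pᵏ` the last two. -/
theorem isRealised_five (a b : G) (hgen : Subgroup.closure {a, b} = ⊤) (D : FreeGroup (Fin 2))
    (hD : FreeGroup.lift ![a, b] D = 1) (hD' : FreeGroup.lift ![a⁻¹, b⁻¹] D ≠ 1) (k : ℕ)
    (hk : a ^ k = 1) (hk' : b ^ k ≠ 1) (σ : Superscript) : IsRealised (.five σ) G := by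
  rw [isRealised_five_iff]
  let v : Bool × Bool → G
    | (false, false) => a
    | (false, true) => a⁻¹
    | (true, false) => b
    | (true, true) => b⁻¹
  let W : Voltage (EdgeClass.five .empty).basicMap G :=
    { v₀ := fun _ => 1
      v₁ := v
      v₂ := fun _ => 1
      v₀_inv := fun _ => mul_one 1
      v₁_inv := by
        rintro ⟨_ | _, _ | _⟩
        exacts [inv_mul_cancel a, mul_inv_cancel a, inv_mul_cancel b, mul_inv_cancel b]
      v₂_inv := fun _ => mul_one 1
      comm := fun _ => rfl }
  have w₀ : ∀ (x y : Bool) g, W.R₀ ((x, y), g) = ((!x, y), g) := fun x y g =>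
    Prod.ext rfl (one_mul g)
  have w₂ : ∀ (x y : Bool) g, W.R₂ ((x, y), g) = ((x, !y), g) := fun x y g =>
    Prod.ext rfl (one_mul g)
  have w₁ : ∀ (x y : Bool) g, W.R₁ ((x, y), g) = ((x, !y), v (x, y) * g) := fun x y g => rfl
  let p := W.R₂ * W.R₁
  let q := W.R₀ * (p * W.R₀)
  have hp : ∀ (x y : Bool) g, p ((x, y), g) = ((x, y), v (x, y) * g) := by
    rintro x (_ | _) g <;> exact perm_mul_apply_eq (w₁ _ _ _) (w₂ _ _ _)
  have hq : ∀ (x y : Bool) g, q ((x, y), g) = ((x, y), v (!x, y) * g) := by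
    rintro (_ | _) y g <;>
      exact perm_mul_apply_eq (perm_mul_apply_eq (w₀ _ _ _) (hp _ _ _)) (w₀ _ _ _)
  have p_mem : p ∈ W.mon := mul_mem W.R₂_mem W.R₁_mem
  have q_mem : q ∈ W.mon := mul_mem W.R₀_mem (mul_mem p_mem W.R₀_mem)
  have word : ∀ (E : FreeGroup (Fin 2)) (x y : Bool) g, FreeGroup.lift ![p, q] E ((x, y), g) =
      ((x, y), FreeGroup.lift ![v (x, y), v (!x, y)] E * g) := by
    intro E x y g
    refine Voltage.freeGroup_lift_apply (N := (EdgeClass.five .empty).basicMap) _ _ (x, y)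
      (fun i g => ?_) E g
    fin_cases i
    exacts [hp x y g, hq x y g]
  have word_mem : ∀ E, FreeGroup.lift ![p, q] E ∈ W.mon := fun E =>
    W.freeGroup_lift_mem (fun i => by fin_cases i; exacts [p_mem, q_mem]) E
  refine W.isRealised_of_separated (W.connected_of_closure (false, false) _ hgen ?_)
    (false, false) ?_
  · rintro c (rfl | rfl)
    · exact ⟨p, p_mem, hp _ _⟩
    · exact ⟨q, q_mem, hq _ _⟩
  · rintro ⟨_ | _, y⟩ hy
    · obtain rfl : y = true := by
        cases y
        exacts [(hy rfl).elim, rfl]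
      refine ⟨_, word_mem D, (word D _ _ _).trans (Prod.ext rfl ?_), fun h => hD' ?_⟩
      · rw [mul_one]; exact hD
      · have h' := (Prod.mk.inj ((word D _ _ _).symm.trans h)).2
        rwa [mul_one] at h'
    · have hE : ∀ c d : G, FreeGroup.lift ![c, d] (FreeGroup.of 0 ^ k) = c ^ k := by simp
      refine ⟨_, word_mem (FreeGroup.of 0 ^ k), (word _ _ _ _).trans (Prod.ext rfl ?_),
        fun h => hk' ?_⟩
      · rw [mul_one, hE]; exact hk
      · have h' := (Prod.mk.inj ((word _ _ _ _).symm.trans h)).2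
        rw [mul_one, hE] at h'
        cases y
        · exact h'
        · have h'' : b⁻¹ ^ k = 1 := h'
          rwa [inv_pow, inv_eq_one] at h''

end Realise

/-! ### Necessary conditions on generators -/

section Obstruct

variable {G : Type*} [Group G]

theorem IsRealised.one_generators (h : IsRealised .one G) :
    ∃ a₀ a₁ a₂ : G, a₀ * a₀ = 1 ∧ a₁ * a₁ = 1 ∧ a₂ * a₂ = 1 ∧ a₀ * a₂ = a₂ * a₀ ∧
      Subgroup.closure {a₀, a₁, a₂} = ⊤ := by
  obtain ⟨M, hM, ⟨e⟩⟩ := h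
  obtain ⟨f, hf⟩ := (M.inClass_iff _).1 hM
  obtain ⟨φ⟩ := M.nonempty
  have key : ∀ ψ, ∃ a : M.aut, ψ = a.1 φ := fun ψ => by
    obtain ⟨a, ha, h⟩ := (hf.eq_iff φ ψ).1 rfl
    exact ⟨⟨a, ha⟩, h.symm⟩
  choose c hc using key
  let S : Section M (EdgeClass.one).basicMap f :=
    { s := fun _ => φ
      f_s := fun _ => rfl
      v₀ := fun _ => c (M.r₀ φ)
      v₁ := fun _ => c (M.r₁ φ)
      v₂ := fun _ => c (M.r₂ φ)
      r₀_s := fun _ => hc _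
      r₁_s := fun _ => hc _
      r₂_s := fun _ => hc _ }
  have hgen := S.closure_eq_top hf (Subgroup.closure {S.v₀ (), S.v₁ (), S.v₂ ()})
    (fun _ => Subgroup.subset_closure (by simp; exact Or.inl rfl))
    (fun _ => Subgroup.subset_closure (by simp; exact Or.inr (Or.inl rfl)))
    (fun _ => Subgroup.subset_closure (by simp; exact Or.inr (Or.inr rfl)))
  refine ⟨e.symm (S.v₀ ()), e.symm (S.v₁ ()), e.symm (S.v₂ ()), ?_, ?_, ?_, ?_, ?_⟩
  · rw [← map_mul, show S.v₀ () * S.v₀ () = 1 from S.v₀_mul hf (), map_one]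
  · rw [← map_mul, show S.v₁ () * S.v₁ () = 1 from S.v₁_mul hf (), map_one]
  · rw [← map_mul, show S.v₂ () * S.v₂ () = 1 from S.v₂_mul hf (), map_one]
  · rw [← map_mul, ← map_mul, show S.v₀ () * S.v₂ () = S.v₂ () * S.v₀ () from S.v_comm hf ()]
  · have := congrArg (Subgroup.map e.symm.toMonoidHom) hgen
    rw [MonoidHom.map_closure, Subgroup.map_top_of_surjective _ e.symm.surjective] at this
    simpa [Set.image_insert_eq] using this

/-- If the group of a map of class `2ex` has generators `s`, `z` as below, they are not inverted
by an automorphism. -/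
theorem IsRealised.twoEx_generators {σ : Superscript} (h : IsRealised (.twoEx σ) G) :
    ∃ s z : G, s * s = 1 ∧ Subgroup.closure {s, z} = ⊤ ∧
      ¬ ∃ α : G ≃* G, α s = s⁻¹ ∧ α z = z⁻¹ := by
  obtain ⟨M, hM, ⟨e⟩⟩ := (isRealised_twoEx_iff σ).1 h
  obtain ⟨f, hf⟩ := (M.inClass_iff _).1 hM
  have key : ∀ φ ψ, f φ = f ψ → ∃ a : M.aut, ψ = a.1 φ := fun φ ψ h => by
    obtain ⟨a, ha, h⟩ := (hf.eq_iff φ ψ).1 h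
    exact ⟨⟨a, ha⟩, h.symm⟩
  obtain ⟨φ, hφ⟩ := hf.surjective false
  have hφ₀ : f (M.r₀ φ) = true := by rw [hf.map_r₀, hφ]; rfl
  obtain ⟨s, hs⟩ := key φ (M.r₂ φ) (by rw [hf.map_r₂, hφ]; rfl)
  obtain ⟨z, hz⟩ := key (M.r₀ φ) (M.r₁ φ) (by rw [hφ₀, hf.map_r₁, hφ]; rfl)
  have hs' : M.r₂ (M.r₀ φ) = s.1 (M.r₀ φ) := by
    rw [← M.r₀_r₂, hs, ((M.mem_aut_iff s.1).1 s.2).1]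
  have hz' : M.r₁ (M.r₀ φ) = z⁻¹.1 φ := by
    have h1 : M.r₁ (z.1 (M.r₀ φ)) = φ := by rw [← hz, M.r₁_r₁]
    rw [← ((M.mem_aut_iff z.1).1 z.2).2.1] at h1
    exact (Equiv.Perm.inv_eq_iff_eq.2 h1.symm).symm
  -- Taking `r₀ φ` over the second flag makes all `r₀`-voltages trivial.
  let S : Section M (EdgeClass.twoEx .empty).basicMap f :=
    { s := fun x : Bool => cond x (M.r₀ φ) φ
      f_s := by rintro (_ | _) <;> assumption
      v₀ := fun _ => 1
      v₁ := fun x : Bool => cond x z⁻¹ z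
      v₂ := fun _ => s
      r₀_s := by
        rintro (_ | _)
        exacts [rfl, M.r₀_r₀ φ]
      r₁_s := by rintro (_ | _) <;> assumption
      r₂_s := by rintro (_ | _) <;> assumption }
  have s_mem : s ∈ Subgroup.closure {s, z} := Subgroup.subset_closure (by simp)
  have z_mem : z ∈ Subgroup.closure {s, z} := Subgroup.subset_closure (by simp)
  have hgen := S.closure_eq_top hf (Subgroup.closure {s, z}) (fun _ => one_mem _)
    (by
      rintro (_ | _)
      exacts [z_mem, inv_mem z_mem]) (fun _ => s_mem)
  have hss : s * s = 1 := S.v₂_mul hf false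
  refine ⟨e.symm s, e.symm z, ?_, ?_, ?_⟩
  · rw [← map_mul, hss, map_one]
  · have := congrArg (Subgroup.map e.symm.toMonoidHom) hgen
    rw [MonoidHom.map_closure, Subgroup.map_top_of_surjective _ e.symm.surjective] at this
    simpa [Set.image_insert_eq] using this
  · rintro ⟨α, hα, hα'⟩
    let β : M.aut ≃* M.aut := (e.symm.trans α).trans e
    have βs : β s = s := by
      change e (α (e.symm s)) = s
      rw [hα, map_inv, MulEquiv.apply_symm_apply, inv_eq_of_mul_eq_one_right hss]
    have βz : β z = z⁻¹ := by
      change e (α (e.symm z)) = z⁻¹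
      rw [hα', map_inv, MulEquiv.apply_symm_apply]
    -- The `r₁`-voltages are `z` and `z⁻¹`, so inverting `z` while fixing `s` matches the exchange
    -- of the two flags.
    have := S.eq_self_of_compatible hf β Equiv.boolNot (by rintro (_ | _) <;> rfl)
      (by rintro (_ | _) <;> rfl) (by rintro (_ | _) <;> rfl) (fun _ => map_one β)
      (by
        rintro (_ | _)
        · exact βz
        · exact (map_inv β z).trans (by rw [βz, inv_inv]; rfl))
      (fun _ => βs) false
    exact Bool.noConfusion this

/-- A section consisting of one orbit of the edge group has trivial `r₀`- and `r₂`-voltages; the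
`r₁`-voltages are `x`, `y` and their inverses, interchanged by the automorphism `fourFlag₂` of the
basic map. -/
theorem IsRealised.five_generators {σ : Superscript} (h : IsRealised (.five σ) G) :
    ∃ x y : G, Subgroup.closure {x, y} = ⊤ ∧ ¬ ∃ α : G ≃* G, α x = x⁻¹ ∧ α y = y⁻¹ := by
  obtain ⟨M, hM, ⟨e⟩⟩ := (isRealised_five_iff σ).1 h
  obtain ⟨f, hf⟩ := (M.inClass_iff _).1 hM
  have key : ∀ φ ψ, f φ = f ψ → ∃ a : M.aut, ψ = a.1 φ := fun φ ψ h => by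
    obtain ⟨a, ha, h⟩ := (hf.eq_iff φ ψ).1 h
    exact ⟨⟨a, ha⟩, h.symm⟩
  obtain ⟨φ, hφ⟩ := hf.surjective (false, false)
  have hφ₀ : f (M.r₀ φ) = (true, false) := by rw [hf.map_r₀, hφ]; rfl
  have hφ₂ : f (M.r₂ φ) = (false, true) := by rw [hf.map_r₂, hφ]; rfl
  have hφ₀₂ : f (M.r₂ (M.r₀ φ)) = (true, true) := by rw [hf.map_r₂, hφ₀]; rfl
  have swap_r₁ : ∀ (x : M.aut) (χ ψ : M.Flag), M.r₁ χ = x.1 ψ → M.r₁ ψ = x⁻¹.1 χ := by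
    intro x χ ψ h
    have h1 : M.r₁ (x.1 ψ) = χ := by rw [← h, M.r₁_r₁]
    rw [← ((M.mem_aut_iff x.1).1 x.2).2.1] at h1
    exact (Equiv.Perm.inv_eq_iff_eq.2 h1.symm).symm
  obtain ⟨x, hx⟩ := key (M.r₂ φ) (M.r₁ φ) (by rw [hφ₂, hf.map_r₁, hφ]; rfl)
  obtain ⟨y, hy⟩ := key (M.r₂ (M.r₀ φ)) (M.r₁ (M.r₀ φ)) (by rw [hφ₀₂, hf.map_r₁, hφ₀]; rfl)
  have hx' := swap_r₁ x _ _ hx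
  have hy' := swap_r₁ y _ _ hy
  let v : Bool × Bool → M.aut
    | (false, false) => x
    | (false, true) => x⁻¹
    | (true, false) => y
    | (true, true) => y⁻¹
  let t : Bool × Bool → M.Flag
    | (false, false) => φ
    | (false, true) => M.r₂ φ
    | (true, false) => M.r₀ φ
    | (true, true) => M.r₂ (M.r₀ φ)
  let S : Section M (EdgeClass.five .empty).basicMap f :=
    { s := t
      f_s := by rintro ⟨_ | _, _ | _⟩ <;> assumption
      v₀ := fun _ => 1
      v₁ := v
      v₂ := fun _ => 1
      r₀_s := by
        rintro ⟨_ | _, _ | _⟩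
        exacts [rfl, M.r₀_r₂ φ, M.r₀_r₀ φ,
          (M.r₀_r₂ _).trans (congrArg M.r₂ (M.r₀_r₀ φ))]
      r₁_s := by rintro ⟨_ | _, _ | _⟩ <;> assumption
      r₂_s := by
        rintro ⟨_ | _, _ | _⟩
        exacts [rfl, M.r₂_r₂ φ, rfl, M.r₂_r₂ _] }
  have x_mem : x ∈ Subgroup.closure {x, y} := Subgroup.subset_closure (by simp)
  have y_mem : y ∈ Subgroup.closure {x, y} := Subgroup.subset_closure (by simp)
  have hgen := S.closure_eq_top hf (Subgroup.closure {x, y}) (fun _ => one_mem _)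
    (by
      rintro ⟨_ | _, _ | _⟩
      exacts [x_mem, inv_mem x_mem, y_mem, inv_mem y_mem]) (fun _ => one_mem _)
  refine ⟨e.symm x, e.symm y, ?_, ?_⟩
  · have := congrArg (Subgroup.map e.symm.toMonoidHom) hgen
    rw [MonoidHom.map_closure, Subgroup.map_top_of_surjective _ e.symm.surjective] at this
    simpa [Set.image_insert_eq] using this
  · rintro ⟨α, hα, hα'⟩
    let β : M.aut ≃* M.aut := (e.symm.trans α).trans e
    have βx : β x = x⁻¹ := by
      change e (α (e.symm x)) = x⁻¹
      rw [hα, map_inv, MulEquiv.apply_symm_apply]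
    have βy : β y = y⁻¹ := by
      change e (α (e.symm y)) = y⁻¹
      rw [hα', map_inv, MulEquiv.apply_symm_apply]
    have βx' : β x⁻¹ = x := by rw [map_inv, βx, inv_inv]
    have βy' : β y⁻¹ = y := by rw [map_inv, βy, inv_inv]
    have := S.eq_self_of_compatible hf β fourFlag₂ (by rintro ⟨_ | _, _ | _⟩ <;> rfl)
      (by rintro ⟨_ | _, _ | _⟩ <;> rfl) (by rintro ⟨_ | _, _ | _⟩ <;> rfl)
      (fun _ => map_one β) (by rintro ⟨_ | _, _ | _⟩ <;> assumption) (fun _ => map_one β)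
      (false, false)
    exact absurd this (by decide : fourFlag₂ (false, false) ≠ (false, false))

end Obstruct

end EdgeTransitive

namespace EdgeTransitive

open Equiv Equiv.Perm
open scoped Pointwise

/-! ### Primitive groups containing a 3-cycle -/

section Generation

variable {α : Type*}

/-- Every point is reached from `p` by means of the permutations in `R`. -/
def Reaches (R : Set (Perm α)) (p : α) : Prop :=
  ∀ P : α → Prop, P p → (∀ r ∈ R, ∀ x, P x → P (r x)) → ∀ x, P x

theorem Reaches.exists_mem_closure {R : Set (Perm α)} {p : α} (h : Reaches R p) (x : α) :
    ∃ g ∈ Subgroup.closure R, g p = x := by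
  refine h (fun x => ∃ g ∈ Subgroup.closure R, g p = x) ⟨1, one_mem _, rfl⟩ ?_ x
  rintro r hr _ ⟨g, hg, rfl⟩
  exact ⟨r * g, mul_mem (Subgroup.subset_closure hr) hg, rfl⟩

/-- Stepping back along a generator lowers `rk` until `p` is met, so a table of ranks certifies
transitivity by a finite check. -/
theorem reaches_of_rank {R : Set (Perm α)} {p : α} (rk : α → ℕ)
    (h : ∀ x, x = p ∨ ∃ r ∈ R, rk (r⁻¹ x) < rk x) : Reaches R p := by
  intro P hp hR x
  induction hk : rk x using Nat.strong_induction_on generalizing x with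
  | _ k ih =>
    rcases h x with rfl | ⟨r, hr, hlt⟩
    · exact hp
    · have := hR r hr _ (ih _ (hk ▸ hlt) _ rfl)
      simpa using this

/-- The permutation `r` maps some element of `{a, b, c}` into `{a, b, c}`. -/
def Meets (a b c : α) (r : Perm α) : Prop :=
  ∃ x, (x = a ∨ x = b ∨ x = c) ∧ (r x = a ∨ r x = b ∨ r x = c)

/-- A transitive group is primitive if it contains a 3-cycle whose support is not moved off itself
by any of the generators. -/
theorem isPreprimitive_closure [DecidableEq α] {R : Set (Perm α)} {p : α} (hR : Reaches R p)
    {a b c : α} (hab : a ≠ b) (hbc : b ≠ c) (hac : a ≠ c)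
    (hmem : swap a b * swap b c ∈ Subgroup.closure R) (hmeet : ∀ r ∈ R, Meets a b c r) :
    MulAction.IsPreprimitive (Subgroup.closure R) α := by
  have : MulAction.IsPretransitive (Subgroup.closure R) α := by
    refine ⟨fun x y => ?_⟩
    obtain ⟨g, hg, rfl⟩ := hR.exists_mem_closure x
    obtain ⟨k, hk, rfl⟩ := hR.exists_mem_closure y
    exact ⟨⟨k * g⁻¹, mul_mem hk (inv_mem hg)⟩, by simp [Subgroup.smul_def]⟩
  have Ta : (swap a b * swap b c) a = b := by
    rw [Perm.mul_apply, swap_apply_of_ne_of_ne hab hac, swap_apply_left]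
  have Tb : (swap a b * swap b c) b = c := by
    rw [Perm.mul_apply, swap_apply_left, swap_apply_of_ne_of_ne hac.symm hbc.symm]
  have Tc : (swap a b * swap b c) c = a := by
    rw [Perm.mul_apply, swap_apply_right, swap_apply_right]
  have Tx : ∀ x, x ≠ a → x ≠ b → x ≠ c → (swap a b * swap b c) x = x := fun x ha hb hc => by
    rw [Perm.mul_apply, swap_apply_of_ne_of_ne hb hc, swap_apply_of_ne_of_ne ha hb]
  generalize hT : swap a b * swap b c = T at *
  refine MulAction.IsPreprimitive.of_isTrivialBlock_base a fun {B} haB hB => ?_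
  rw [MulAction.IsTrivialBlock, or_iff_not_imp_left]
  intro hnt
  rw [Set.not_subsingleton_iff] at hnt
  have stab : ∀ (g : Perm α), g ∈ Subgroup.closure R → ∀ x ∈ B, g x ∈ B → ∀ y, y ∈ B → g y ∈ B := by
    intro g hg x hx hgx y hy
    have e : (⟨g, hg⟩ : Subgroup.closure R) • B = B :=
      MulAction.IsBlock.smul_eq_of_mem hB hx hgx
    rw [← e]
    exact ⟨y, hy, rfl⟩
  -- If the second point `d` of the block lies off the 3-cycle, the 3-cycle fixes `d` and so
  -- preserves `B`; otherwise it, too, maps a point of `B` into `B`.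
  have hTB : b ∈ B ∧ c ∈ B := by
    obtain ⟨d, hd, hda⟩ := hnt.exists_ne a
    by_cases hdb : d = b
    · subst hdb
      have := stab T hmem a haB (Ta ▸ hd) _ hd
      exact ⟨hd, Tb ▸ this⟩
    by_cases hdc : d = c
    · subst hdc
      have := stab T hmem d hd (Tc.symm ▸ haB) _ haB
      exact ⟨Ta ▸ this, hd⟩
    have hT' := stab T hmem d hd (by rwa [Tx d hda hdb hdc])
    have hb : b ∈ B := Ta ▸ hT' a haB
    exact ⟨hb, Tb ▸ hT' b hb⟩
  -- `Meets` provides a point of the 3-cycle, hence of `B`, which `r` sends into `B`; a block is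
  -- then preserved.
  have hclosed : ∀ r ∈ R, ∀ y, y ∈ B → r y ∈ B := by
    intro r hr
    obtain ⟨x, hx, hrx⟩ := hmeet r hr
    refine stab r (Subgroup.subset_closure hr) x ?_ ?_
    · rcases hx with rfl | rfl | rfl
      exacts [haB, hTB.1, hTB.2]
    · rcases hrx with h | h | h <;> rw [h]
      exacts [haB, hTB.1, hTB.2]
  have hB_all : ∀ (g : Perm α), g ∈ Subgroup.closure R → ∀ y, y ∈ B → g y ∈ B := by
    intro g hg
    have hstab : Subgroup.closure R ≤ MulAction.stabilizer (Perm α) B := by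
      rw [Subgroup.closure_le]
      intro r hr
      have hr' := Subgroup.subset_closure hr
      have e : (⟨r, hr'⟩ : Subgroup.closure R) • B = B :=
        MulAction.IsBlock.smul_eq_of_mem hB haB (hclosed r hr a haB)
      exact e
    intro y hy
    have e : g • B = B := hstab hg
    rw [← e]
    exact ⟨y, hy, rfl⟩
  rw [Set.eq_univ_iff_forall]
  intro x
  obtain ⟨g, hg, hga⟩ := hR.exists_mem_closure a
  obtain ⟨k, hk, rfl⟩ := hR.exists_mem_closure x
  have := hB_all (k * g⁻¹) (mul_mem hk (inv_mem hg)) a haB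
  simpa [← hga] using this

theorem alternatingGroup_le_closure [Fintype α] [DecidableEq α] {R : Set (Perm α)} {p : α}
    (hR : Reaches R p) {a b c : α} (hab : a ≠ b) (hbc : b ≠ c) (hac : a ≠ c)
    (hmem : swap a b * swap b c ∈ Subgroup.closure R) (hmeet : ∀ r ∈ R, Meets a b c r) :
    alternatingGroup α ≤ Subgroup.closure R := by
  refine alternatingGroup_le_of_isPreprimitive_of_isThreeCycle_mem
    (isPreprimitive_closure hR hab hbc hac hmem hmeet) ?_ hmem
  rw [swap_comm a b]
  exact isThreeCycle_swap_mul_swap_same hab.symm hbc hac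

variable [Fintype α] [DecidableEq α]

theorem closure_alternating_eq_top {ι : Type*} (x : ι → alternatingGroup α)
    (h : alternatingGroup α ≤ Subgroup.closure (Set.range fun i => (x i : Perm α))) :
    Subgroup.closure (Set.range x) = ⊤ := by
  apply Subgroup.map_injective (alternatingGroup α).subtype_injective
  rw [MonoidHom.map_closure, ← Set.range_comp, ← MonoidHom.range_eq_map, Subgroup.range_subtype]
  refine le_antisymm ?_ h
  rw [Subgroup.closure_le]
  rintro _ ⟨i, rfl⟩
  exact (x i).2

end Generation

/-! ### Attaching a path of four points -/

section Tail

variable {α : Type*}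

/-- A permutation extended by the identity on four more points. -/
def extendFour : Perm α →* Perm (α ⊕ Fin 4) :=
  (sumCongrHom α (Fin 4)).comp (MonoidHom.inl _ _)

theorem extendFour_inl (f : Perm α) (x : α) : extendFour f (Sum.inl x) = Sum.inl (f x) := rfl

theorem extendFour_inr (f : Perm α) (i : Fin 4) : extendFour f (Sum.inr i) = Sum.inr i := rfl

theorem extendFour_injective : Function.Injective (extendFour (α := α)) := fun _ _ h =>
  Equiv.ext fun x => Sum.inl_injective (DFunLike.congr_fun h (Sum.inl x))

theorem Meets.extend {a b c : α} {f : Perm α} (h : Meets a b c f) :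
    Meets (Sum.inl a) (Sum.inl b) (Sum.inl c) (extendFour f) := by
  obtain ⟨x, hx, hfx⟩ := h
  refine ⟨Sum.inl x, by simpa using hx, ?_⟩
  rw [extendFour_inl]
  simpa using hfx

variable [DecidableEq α]

theorem extendFour_swap (x y : α) : extendFour (swap x y) = swap (Sum.inl x) (Sum.inl y) :=
  sumCongr_swap_one x y

theorem sign_extendFour [Fintype α] (f : Perm α) : sign (extendFour f) = sign f := by
  refine (sign_sumCongr f 1).trans ?_
  rw [map_one, mul_one]

/-- The edges of one colour on the path `p, 0, 1, 2, 3`. -/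
def pathEven (p : α) : Perm (α ⊕ Fin 4) :=
  swap (Sum.inl p) (Sum.inr 0) * swap (Sum.inr 1) (Sum.inr 2)

/-- The edges of the other colour on the path `p, 0, 1, 2, 3`. -/
def pathOdd : Perm (α ⊕ Fin 4) :=
  swap (Sum.inr 0) (Sum.inr 1) * swap (Sum.inr 2) (Sum.inr 3)

theorem pathEven_mul_self (p : α) : pathEven p * pathEven p = 1 := by
  have h : Commute (swap (Sum.inl p) (Sum.inr 0)) (swap (Sum.inr 1 : α ⊕ Fin 4) (Sum.inr 2)) :=
    (disjoint_swap_swap (by simp)).commute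
  rw [pathEven, h.symm.mul_mul_mul_comm, swap_mul_self, swap_mul_self, one_mul]

theorem pathOdd_mul_self : (pathOdd : Perm (α ⊕ Fin 4)) * pathOdd = 1 := by
  have h : Commute (swap (Sum.inr 0 : α ⊕ Fin 4) (Sum.inr 1)) (swap (Sum.inr 2) (Sum.inr 3)) :=
    (disjoint_swap_swap (by simp)).commute
  rw [pathOdd, h.symm.mul_mul_mul_comm, swap_mul_self, swap_mul_self, one_mul]

theorem sign_pathEven [Fintype α] (p : α) : sign (pathEven p) = 1 := by
  rw [pathEven, Perm.sign_mul, sign_swap (by simp), sign_swap (by simp)]; decide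

theorem sign_pathOdd [Fintype α] : sign (pathOdd : Perm (α ⊕ Fin 4)) = 1 := by
  rw [pathOdd, Perm.sign_mul, sign_swap (by simp), sign_swap (by simp)]; decide

/-- The only old point moved by `pathEven p` is `p`. -/
theorem commute_pathEven {f : Perm α} {p : α} (hf : f p = p) :
    Commute (extendFour f) (pathEven p) := by
  refine Commute.mul_right ?_ ?_ <;>
    rw [commute_iff_eq, mul_swap_eq_swap_mul] <;> simp only [extendFour_inl, extendFour_inr, hf]

theorem commute_pathOdd (f : Perm α) : Commute (extendFour f) pathOdd := by
  refine Commute.mul_right ?_ ?_ <;>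
    rw [commute_iff_eq, mul_swap_eq_swap_mul] <;> simp only [extendFour_inr]

theorem pathEven_inl {p x : α} (hx : x ≠ p) : pathEven p (Sum.inl x) = Sum.inl x := by
  simp [pathEven, swap_apply_def, hx]

theorem pathOdd_inl (x : α) : pathOdd (Sum.inl x : α ⊕ Fin 4) = Sum.inl x := by
  simp [pathOdd, swap_apply_def]

theorem pathEven_p (p : α) : pathEven p (Sum.inl p) = Sum.inr 0 := by
  simp [pathEven, swap_apply_def]

theorem pathEven_two (p : α) : pathEven p (Sum.inr 2) = Sum.inr 1 := by
  simp [pathEven, swap_apply_def]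

theorem pathEven_three (p : α) : pathEven p (Sum.inr 3) = Sum.inr 3 := by
  simp [pathEven, swap_apply_def]

theorem pathOdd_three : pathOdd (Sum.inr 3 : α ⊕ Fin 4) = Sum.inr 2 := by
  simp [pathOdd, swap_apply_def]

theorem pathOdd_one : pathOdd (Sum.inr 1 : α ⊕ Fin 4) = Sum.inr 0 := by
  simp [pathOdd, swap_apply_def]

/-- Attaching a path of four points to the point `p` preserves transitivity. -/
theorem Reaches.tail {R : Set (Perm α)} {p : α} (hR : Reaches R p) {f g : Perm α} (hf : f p = p)
    (R' : Set (Perm (α ⊕ Fin 4)))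
    (hf' : extendFour f * pathEven p ∈ R') (hg' : extendFour g * pathOdd ∈ R')
    (hR' : ∀ r ∈ R, r = f ∨ r = g ∨ extendFour r ∈ R') : Reaches R' (Sum.inr 3) := by
  intro P h3 hP
  have h2 : P (Sum.inr 2) := by
    have := hP _ hg' _ h3
    rwa [Perm.mul_apply, pathOdd_three, extendFour_inr] at this
  have h1 : P (Sum.inr 1) := by
    have := hP _ hf' _ h2
    rwa [Perm.mul_apply, pathEven_two, extendFour_inr] at this
  have h0 : P (Sum.inr 0) := by
    have := hP _ hg' _ h1
    rwa [Perm.mul_apply, pathOdd_one, extendFour_inr] at this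
  have hp : P (Sum.inl p) := by
    have := hP _ hf' _ h0
    have e : pathEven p (Sum.inr 0) = Sum.inl p := by
      rw [← pathEven_p p, ← Perm.mul_apply, pathEven_mul_self, Perm.one_apply]
    rwa [Perm.mul_apply, e, extendFour_inl, hf] at this
  have hα : ∀ x, P (Sum.inl x) := by
    refine hR (fun x => P (Sum.inl x)) hp fun r hr x hx => ?_
    rcases hR' r hr with rfl | rfl | h
    · by_cases hxp : x = p
      · rw [hxp, hf]; exact hp
      · have := hP _ hf' _ hx
        rwa [Perm.mul_apply, pathEven_inl hxp, extendFour_inl] at this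
    · have := hP _ hg' _ hx
      rwa [Perm.mul_apply, pathOdd_inl, extendFour_inl] at this
    · exact hP _ h _ hx
  rintro (x | i)
  · exact hα x
  · fin_cases i <;> assumption

theorem Meets.tail_even {a b c p : α} (ha : a ≠ p) (hb : b ≠ p) (hc : c ≠ p) {f : Perm α}
    (h : Meets a b c f) :
    Meets (Sum.inl a) (Sum.inl b) (Sum.inl c) (extendFour f * pathEven p) := by
  obtain ⟨x, hx, hfx⟩ := h
  have hxp : x ≠ p := by rcases hx with rfl | rfl | rfl <;> assumption
  refine ⟨Sum.inl x, by simpa using hx, ?_⟩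
  rw [Perm.mul_apply, pathEven_inl hxp, extendFour_inl]
  simpa using hfx

theorem Meets.tail_odd {a b c : α} {f : Perm α} (h : Meets a b c f) :
    Meets (Sum.inl a) (Sum.inl b) (Sum.inl c) (extendFour f * pathOdd) := by
  obtain ⟨x, hx, hfx⟩ := h
  refine ⟨Sum.inl x, by simpa using hx, ?_⟩
  rw [Perm.mul_apply, pathOdd_inl, extendFour_inl]
  simpa using hfx

end Tail

/-! ### Infinite families of generators -/

section Families

/-- Applied with `e` a path involution: the tail cancels in conjugates, so words in them do not
notice the prolongation. -/
theorem conj_mul_of_commute {G : Type*} [Group G] {a b e : G} (ha : Commute a e)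
    (hb : Commute b e) (he : e * e = 1) : a * e * b * (a * e) = a * b * a := by
  rw [mul_assoc a e b, ← hb.eq, mul_assoc, mul_assoc, ← mul_assoc e a e, ← ha.eq, mul_assoc a e e,
    he, mul_one, mul_assoc]

variable {α : Type*} [Fintype α] [DecidableEq α]

/-- Three even involutions, two of them commuting, which generate the alternating group, and which
remain so when a path is attached to the point `p`. -/
def HasTriple (α : Type*) [Fintype α] [DecidableEq α] (p : α) : Prop :=
  ∃ r₀ r₁ r₂ : Perm α, sign r₀ = 1 ∧ sign r₁ = 1 ∧ sign r₂ = 1 ∧ r₀ * r₀ = 1 ∧ r₁ * r₁ = 1 ∧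
    r₂ * r₂ = 1 ∧ r₀ * r₂ = r₂ * r₀ ∧ r₂ ≠ 1 ∧ r₁ p = p ∧ r₂ p = p ∧ r₁ (r₀ p) ≠ r₀ p ∧
    Reaches {r₀, r₁, r₂} p ∧
    ∃ a b c, a ≠ b ∧ b ≠ c ∧ a ≠ c ∧ a ≠ p ∧ b ≠ p ∧ c ≠ p ∧
      swap a b * swap b c ∈ Subgroup.closure {r₂, r₁ * r₂ * r₁} ∧
      Meets a b c r₀ ∧ Meets a b c r₁ ∧ Meets a b c r₂

/-- `r₁` acquires the even edges of the path, `r₀` the odd ones, `r₂` nothing. Each colour has two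
edges, so parities persist, and `r₂` still commutes with `r₀`. As `r₁` and `r₂` fix `p`, the
elements `r₂` and `r₁ r₂ r₁` keep their old action, and with them the 3-cycle. The far end of the
path inherits the role of `p`. -/
theorem HasTriple.extend {p : α} (h : HasTriple α p) :
    HasTriple (α ⊕ Fin 4) (Sum.inr 3) := by
  obtain ⟨r₀, r₁, r₂, s₀, s₁, s₂, q₀, q₁, q₂, h₀₂, hr₂, hp₁, hp₂, -, hR, a, b, c, hab, hbc, hac, ha, hb,
    hc, hT, m₀, m₁, m₂⟩ := h
  have c₁ := commute_pathEven hp₁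
  have c₂ := commute_pathEven hp₂
  have c₀ := commute_pathOdd r₀
  have e₁ := conj_mul_of_commute c₁ c₂ (pathEven_mul_self p)
  rw [← map_mul, ← map_mul] at e₁
  refine ⟨extendFour r₀ * pathOdd, extendFour r₁ * pathEven p, extendFour r₂, ?_, ?_, ?_, ?_, ?_,
    ?_, ?_, fun h => hr₂ (extendFour_injective (h.trans (map_one _).symm)), ?_, ?_, ?_, ?_,
    Sum.inl a, Sum.inl b, Sum.inl c, ?_, ?_, ?_, ?_, ?_, ?_, ?_, ?_, ?_, ?_⟩
  · rw [Perm.sign_mul, sign_extendFour, s₀, sign_pathOdd, one_mul]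
  · rw [Perm.sign_mul, sign_extendFour, s₁, sign_pathEven, one_mul]
  · rw [sign_extendFour, s₂]
  · rw [c₀.symm.mul_mul_mul_comm, ← map_mul, q₀, map_one, pathOdd_mul_self, one_mul]
  · rw [c₁.symm.mul_mul_mul_comm, ← map_mul, q₁, map_one, pathEven_mul_self, one_mul]
  · rw [← map_mul, q₂, map_one]
  · rw [mul_assoc, ← (commute_pathOdd r₂).eq, ← mul_assoc, ← map_mul, h₀₂, map_mul, mul_assoc]
  · rw [Perm.mul_apply, pathEven_three, extendFour_inr]
  · rw [extendFour_inr]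
  · rw [Perm.mul_apply, Perm.mul_apply, pathOdd_three, extendFour_inr, pathEven_two,
      extendFour_inr]
    simp
  · refine hR.tail hp₁ (g := r₀) _ (by simp) (by simp) ?_
    rintro r (rfl | rfl | rfl) <;> simp
  · simpa using hab
  · simpa using hbc
  · simpa using hac
  · simp
  · simp
  · simp
  · have := Subgroup.mem_map_of_mem extendFour hT
    rw [MonoidHom.map_closure, Set.image_pair, map_mul extendFour (swap a b), extendFour_swap,
      extendFour_swap] at this
    rwa [e₁]
  · exact m₀.tail_odd
  · exact m₁.tail_even ha hb hc
  · exact m₂.extend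

/-- An even involution `s` and an even permutation `z` which generate the alternating group and are
not simultaneously inverted by an automorphism, and which remain so when a path is attached to the
point `p`. -/
def HasChiralPair (α : Type*) [Fintype α] [DecidableEq α] (p : α) : Prop :=
  ∃ s z : Perm α, sign s = 1 ∧ sign z = 1 ∧ s * s = 1 ∧ z p = p ∧ s p ≠ p ∧ Reaches {s, z} p ∧
    (∃ a b c, a ≠ b ∧ b ≠ c ∧ a ≠ c ∧ a ≠ p ∧ b ≠ p ∧ c ≠ p ∧
      swap a b * swap b c ∈ Subgroup.closure {z * z, s * (z * z) * s} ∧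
      Meets a b c s ∧ Meets a b c z) ∧
    ∃ D : FreeGroup (Fin 2), FreeGroup.lift ![z * z, s * (z * z) * s] D = 1 ∧
      FreeGroup.lift ![(z * z)⁻¹, (s * (z * z) * s)⁻¹] D ≠ 1

theorem map_freeGroup_lift_pair {G H : Type*} [Group G] [Group H] (f : G →* H) (x y : G)
    (D : FreeGroup (Fin 2)) : f (FreeGroup.lift ![x, y] D) = FreeGroup.lift ![f x, f y] D := by
  have : f.comp (FreeGroup.lift ![x, y]) = FreeGroup.lift ![f x, f y] := by
    ext i
    fin_cases i <;> simp
  exact DFunLike.congr_fun this D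

/-- `z` acquires the even edges of the path and `s` the odd ones. Since `z` fixes `p`, squaring
kills the new factor; so `z²` and `s z² s` act as before and retain both the 3-cycle and the
relation that distinguishes them from their inverses. -/
theorem HasChiralPair.extend {p : α} (h : HasChiralPair α p) :
    HasChiralPair (α ⊕ Fin 4) (Sum.inr 3) := by
  obtain ⟨s, z, ss, sz, qs, hz, -, hR, ⟨a, b, c, hab, hbc, hac, ha, hb, hc, hT, ms, mz⟩, D, hD,
    hD'⟩ := h
  have cz := commute_pathEven hz
  have cs := commute_pathOdd s
  have eu : extendFour z * pathEven p * (extendFour z * pathEven p) = extendFour (z * z) := by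
    rw [cz.symm.mul_mul_mul_comm, ← map_mul, pathEven_mul_self, mul_one]
  have ev := conj_mul_of_commute cs (commute_pathOdd (z * z)) pathOdd_mul_self
  rw [← map_mul, ← map_mul] at ev
  refine ⟨extendFour s * pathOdd, extendFour z * pathEven p, ?_, ?_, ?_, ?_, ?_, ?_,
    ⟨Sum.inl a, Sum.inl b, Sum.inl c, ?_, ?_, ?_, ?_, ?_, ?_, ?_, ?_, ?_⟩, D, ?_, ?_⟩
  · rw [Perm.sign_mul, sign_extendFour, ss, sign_pathOdd, one_mul]
  · rw [Perm.sign_mul, sign_extendFour, sz, sign_pathEven, one_mul]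
  · rw [cs.symm.mul_mul_mul_comm, ← map_mul, qs, map_one, pathOdd_mul_self, one_mul]
  · rw [Perm.mul_apply, pathEven_three, extendFour_inr]
  · rw [Perm.mul_apply, pathOdd_three, extendFour_inr]
    simp
  · refine hR.tail hz (g := s) _ (by simp) (by simp) ?_
    rintro r (rfl | rfl) <;> simp
  · simpa using hab
  · simpa using hbc
  · simpa using hac
  · simp
  · simp
  · simp
  · have := Subgroup.mem_map_of_mem extendFour hT
    rw [MonoidHom.map_closure, Set.image_pair, map_mul extendFour (swap a b), extendFour_swap,
      extendFour_swap] at this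
    rwa [eu, ev]
  · exact ms.tail_odd
  · exact mz.tail_even ha hb hc
  · rw [eu, ev, ← map_freeGroup_lift_pair, hD, map_one]
  · rw [eu, ev, ← map_inv, ← map_inv, ← map_freeGroup_lift_pair]
    exact fun h => hD' (extendFour_injective (h.trans (map_one _).symm))

end Families

end EdgeTransitive

namespace EdgeTransitive

open Equiv Equiv.Perm

/-! ### Finite certificates for generation and chirality -/

section Certificates

theorem range_vec_pair {α : Type*} (a b : α) : Set.range ![a, b] = {a, b} := by
  simpa using Set.pair_comm b a

theorem range_vec_triple {α : Type*} (a b c : α) : Set.range ![a, b, c] = {a, b, c} := by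
  ext x
  simp only [Matrix.range_cons, Matrix.range_empty, Set.mem_union, Set.mem_singleton_iff,
    Set.mem_insert_iff, Set.mem_empty_iff_false]
  tauto

theorem freeGroup_lift_mem_closure {ι G : Type*} [Group G] (x : ι → G) (D : FreeGroup ι) :
    FreeGroup.lift x D ∈ Subgroup.closure (Set.range x) := by
  rw [← FreeGroup.range_lift_eq_closure]
  exact ⟨D, rfl⟩

theorem reaches_range_of_rank {α : Type*} {k : ℕ} (x : Fin k → Perm α) (p : α) (rk : α → ℕ)
    (h : ∀ y, y = p ∨ ∃ i, rk ((x i)⁻¹ y) < rk y) : Reaches (Set.range x) p := by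
  refine reaches_of_rank rk fun y => (h y).imp_right ?_
  rintro ⟨i, hi⟩
  exact ⟨x i, ⟨i, rfl⟩, hi⟩

variable {α : Type*} [Fintype α] [DecidableEq α]

instance (a b c : α) (r : Perm α) : Decidable (Meets a b c r) :=
  inferInstanceAs (Decidable (∃ x, (x = a ∨ x = b ∨ x = c) ∧ (r x = a ∨ r x = b ∨ r x = c)))

/-- The certificate consists of ranks for transitivity and a word `w` whose `m`-th power is a
3-cycle not moved off itself by any generator. -/
theorem alternatingGroup_le_closure_of_word {k : ℕ} (x : Fin k → Perm α) (p : α) (rk : α → ℕ)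
    (a b c : α) (w : List (Fin k × Bool)) (m : ℕ)
    (h : (∀ y, y = p ∨ ∃ i, rk ((x i)⁻¹ y) < rk y) ∧ a ≠ b ∧ b ≠ c ∧ a ≠ c ∧
      FreeGroup.lift x (FreeGroup.mk w) ^ m = swap a b * swap b c ∧ ∀ i, Meets a b c (x i)) :
    alternatingGroup α ≤ Subgroup.closure (Set.range x) := by
  obtain ⟨hrk, hab, hbc, hac, hw, hm⟩ := h
  refine alternatingGroup_le_closure (reaches_range_of_rank x p rk hrk) hab hbc hac
    (hw ▸ pow_mem (freeGroup_lift_mem_closure x _) m) ?_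
  rintro _ ⟨i, rfl⟩
  exact hm i

theorem closure_pair_eq_top (s z : alternatingGroup α)
    (h : alternatingGroup α ≤ Subgroup.closure {(s : Perm α), (z : Perm α)}) :
    Subgroup.closure {s, z} = ⊤ := by
  have := closure_alternating_eq_top ![s, z] (by
    have e : (fun i => ((![s, z] i : alternatingGroup α) : Perm α)) = ![(s : Perm α), z] := by
      ext i : 1
      fin_cases i <;> rfl
    rwa [e, range_vec_pair])
  rwa [range_vec_pair] at this

theorem closure_triple_eq_top (a b c : alternatingGroup α)
    (h : alternatingGroup α ≤ Subgroup.closure {(a : Perm α), (b : Perm α), (c : Perm α)}) :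
    Subgroup.closure {a, b, c} = ⊤ := by
  have := closure_alternating_eq_top ![a, b, c] (by
    have e : (fun i => ((![a, b, c] i : alternatingGroup α) : Perm α)) =
        ![(a : Perm α), b, c] := by
      ext i : 1
      fin_cases i <;> rfl
    rwa [e, range_vec_triple])
  rwa [range_vec_triple] at this

theorem hasTriple_of_rank {p : α} (r₀ r₁ r₂ : Perm α) (rk : α → ℕ) (a b c : α) (k : ℕ)
    (hs : sign r₀ = 1 ∧ sign r₁ = 1 ∧ sign r₂ = 1)
    (h : r₀ * r₀ = 1 ∧ r₁ * r₁ = 1 ∧ r₂ * r₂ = 1 ∧ r₀ * r₂ = r₂ * r₀ ∧ r₂ ≠ 1 ∧ r₁ p = p ∧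
      r₂ p = p ∧ r₁ (r₀ p) ≠ r₀ p ∧
      (∀ y, y = p ∨ ∃ i, rk ((![r₀, r₁, r₂] i)⁻¹ y) < rk y) ∧
      (a ≠ b ∧ b ≠ c ∧ a ≠ c ∧ a ≠ p ∧ b ≠ p ∧ c ≠ p) ∧
      (r₂ * (r₁ * r₂ * r₁)) ^ k = swap a b * swap b c ∧
      Meets a b c r₀ ∧ Meets a b c r₁ ∧ Meets a b c r₂) : HasTriple α p := by
  obtain ⟨q₀, q₁, q₂, h₀₂, h2, hp₁, hp₂, hp₀, hrk, ⟨hab, hbc, hac, ha, hb, hc⟩, hk, hm⟩ := h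
  refine ⟨r₀, r₁, r₂, hs.1, hs.2.1, hs.2.2, q₀, q₁, q₂, h₀₂, h2, hp₁, hp₂, hp₀, ?_, a, b, c, hab,
    hbc, hac, ha, hb, hc, ?_, hm⟩
  · have := reaches_range_of_rank _ p rk hrk
    rwa [range_vec_triple] at this
  · rw [← hk]
    exact pow_mem (mul_mem (Subgroup.subset_closure (by simp))
      (Subgroup.subset_closure (by simp))) k

/-- With `u = z²` and `v = s z² s`, chirality is witnessed by the word `u² v u v⁻¹`: its `k`-th
power is trivial, but not after `u`, `v` are replaced by their inverses. -/
theorem hasChiralPair_of_rank {p : α} (s z : Perm α) (rk : α → ℕ) (a b c : α)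
    (w : List (Fin 2 × Bool)) (m k : ℕ) (hs : sign s = 1 ∧ sign z = 1)
    (h : s * s = 1 ∧ z p = p ∧ s p ≠ p ∧ (∀ y, y = p ∨ ∃ i, rk ((![s, z] i)⁻¹ y) < rk y) ∧
      (a ≠ b ∧ b ≠ c ∧ a ≠ c ∧ a ≠ p ∧ b ≠ p ∧ c ≠ p) ∧
      FreeGroup.lift ![z * z, s * (z * z) * s] (FreeGroup.mk w) ^ m = swap a b * swap b c ∧
      Meets a b c s ∧ Meets a b c z ∧
      FreeGroup.lift ![z * z, s * (z * z) * s]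
        (FreeGroup.mk [(0, true), (0, true), (1, true), (0, true), (1, false)]) ^ k = 1 ∧
      FreeGroup.lift ![(z * z)⁻¹, (s * (z * z) * s)⁻¹]
        (FreeGroup.mk [(0, true), (0, true), (1, true), (0, true), (1, false)]) ^ k ≠ 1) :
    HasChiralPair α p := by
  obtain ⟨qs, hz, hsp, hrk, ⟨hab, hbc, hac, ha, hb, hc⟩, hw, ms, mz, hD, hD'⟩ := h
  refine ⟨s, z, hs.1, hs.2, qs, hz, hsp, ?_, ⟨a, b, c, hab, hbc, hac, ha, hb, hc, ?_, ms, mz⟩,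
    FreeGroup.mk [(0, true), (0, true), (1, true), (0, true), (1, false)] ^ k, ?_, ?_⟩
  · have := reaches_range_of_rank _ p rk hrk
    rwa [range_vec_pair] at this
  · rw [← hw]
    have := freeGroup_lift_mem_closure ![z * z, s * (z * z) * s] (FreeGroup.mk w)
    rw [range_vec_pair] at this
    exact pow_mem this m
  · rw [map_pow, hD]
  · rwa [map_pow]

end Certificates

/-! ### Starting configurations in four consecutive degrees -/

section Bases

theorem hasTriple_fin_ten : HasTriple (Fin 10) 9 :=
  hasTriple_of_rank (swap 0 6 * swap 1 4 * swap 5 9 * swap 7 8)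
    (swap 1 5 * swap 2 4 * swap 3 7 * swap 6 8) (swap 0 6 * swap 2 3)
    ![9, 2, 4, 5, 3, 1, 8, 6, 7, 0] 0 6 8 2
    (by simp [Perm.sign_mul, sign_swap']) (by decide +kernel)

theorem hasTriple_fin_eleven : HasTriple (Fin 11) 10 :=
  hasTriple_of_rank (swap 1 5 * swap 2 10 * swap 6 7 * swap 8 9)
    (swap 0 8 * swap 1 3 * swap 2 9 * swap 4 6) (swap 0 4 * swap 1 7 * swap 5 6 * swap 8 9)
    ![4, 8, 1, 9, 5, 7, 6, 7, 3, 2, 0] 1 7 3 7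
    (by simp [Perm.sign_mul, sign_swap']) (by decide +kernel)

theorem hasTriple_fin_twelve : HasTriple (Fin 12) 11 :=
  hasTriple_of_rank (swap 1 8 * swap 2 10 * swap 4 11 * swap 6 9)
    (swap 0 6 * swap 1 3 * swap 4 10 * swap 8 9) (swap 0 5 * swap 1 2 * swap 3 7 * swap 8 10)
    ![6, 4, 3, 5, 1, 7, 5, 6, 3, 4, 2, 0] 0 6 5 2
    (by simp [Perm.sign_mul, sign_swap']) (by decide +kernel)

theorem hasTriple_fin_thirteen : HasTriple (Fin 13) 12 :=
  hasTriple_of_rank (swap 0 9 * swap 1 10 * swap 2 5 * swap 3 4 * swap 6 8 * swap 7 12)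
    (swap 0 3 * swap 2 4 * swap 7 8 * swap 9 11) (swap 0 1 * swap 3 6 * swap 4 8 * swap 9 10)
    ![5, 6, 4, 4, 3, 5, 3, 1, 2, 6, 7, 7, 0] 9 11 10 2
    (by simp [Perm.sign_mul, sign_swap']) (by decide +kernel)

theorem hasChiralPair_fin_eight : HasChiralPair (Fin 8) 7 :=
  hasChiralPair_of_rank (swap 0 6 * swap 5 7)
    (swap 0 6 * swap 6 2 * swap 2 1 * swap 1 4 * swap 4 3 * swap 3 5)
    ![2, 5, 4, 7, 6, 1, 3, 0] 1 5 4
    [(0, true), (0, true), (1, false)] 5 5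
    (by simp [Perm.sign_mul, sign_swap']) (by decide +kernel)

theorem hasChiralPair_fin_nine : HasChiralPair (Fin 9) 8 :=
  hasChiralPair_of_rank (swap 0 1 * swap 2 3 * swap 5 6 * swap 7 8)
    (swap 0 2 * swap 2 7 * swap 7 5 * swap 5 4 * swap 1 6 * swap 6 3)
    ![4, 5, 5, 4, 3, 2, 3, 1, 0] 2 4 5
    [(0, false), (1, true), (1, true), (1, true), (1, true), (1, true), (0, true)] 1 4
    (by simp [Perm.sign_mul, sign_swap']) (by decide +kernel)

theorem hasChiralPair_fin_ten : HasChiralPair (Fin 10) 9 :=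
  hasChiralPair_of_rank (swap 0 1 * swap 2 4 * swap 3 6 * swap 7 9)
    (swap 0 8 * swap 8 2 * swap 2 3 * swap 3 4 * swap 1 5 * swap 6 7)
    ![5, 6, 5, 3, 4, 7, 2, 1, 6, 0] 2 3 6
    [(0, true), (0, true), (1, true), (1, true)] 2 2
    (by simp [Perm.sign_mul, sign_swap']) (by decide +kernel)

theorem hasChiralPair_fin_eleven : HasChiralPair (Fin 11) 10 :=
  hasChiralPair_of_rank (swap 0 4 * swap 2 3 * swap 5 10 * swap 6 8)
    (swap 0 6 * swap 6 7 * swap 1 2 * swap 2 4 * swap 4 5 * swap 8 9)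
    ![5, 2, 3, 4, 4, 1, 6, 7, 7, 8, 0] 0 6 7
    [(0, true)] 2 4
    (by simp [Perm.sign_mul, sign_swap']) (by decide +kernel)

end Bases

/-! ### Alternating groups which are realised -/

section Realisation

/-- Generation by three involutions, two of which commute, without further such relations. -/
def IsTripleGenerated (G : Type*) [Group G] : Prop :=
  ∃ r₀ r₁ r₂ : G, r₀ * r₀ = 1 ∧ r₁ * r₁ = 1 ∧ r₂ * r₂ = 1 ∧ r₀ * r₂ = r₂ * r₀ ∧ r₂ ≠ 1 ∧
    (r₀ * r₁) ^ 2 ≠ 1 ∧ Subgroup.closure {r₀, r₁, r₂} = ⊤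

/-- Generation by an involution `s` and an element `z` satisfying a relation which `s` and `z⁻¹`
do not satisfy. -/
def IsChirallyGenerated (G : Type*) [Group G] : Prop :=
  ∃ s z : G, s * s = 1 ∧ s ≠ 1 ∧ Subgroup.closure {s, z} = ⊤ ∧
    ∃ D : FreeGroup (Fin 2), FreeGroup.lift ![s, z] D = 1 ∧ FreeGroup.lift ![s, z⁻¹] D ≠ 1

theorem IsRealised.of_mulEquiv {T : EdgeClass} {G H : Type*} [Group G] [Group H] (e : G ≃* H)
    (h : IsRealised T G) : IsRealised T H := by
  obtain ⟨M, hM, ⟨f⟩⟩ := h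
  exact ⟨M, hM, ⟨e.symm.trans f⟩⟩

section

variable {G : Type} [Group G]

theorem IsTripleGenerated.isRealised_one (h : IsTripleGenerated G) : IsRealised .one G := by
  obtain ⟨r₀, r₁, r₂, h₀, h₁, h₂, h₀₂, -, -, hgen⟩ := h
  exact EdgeTransitive.isRealised_one r₀ r₁ r₂ h₀ h₁ h₂ h₀₂ hgen

/-- The word is `(XY)²`: it vanishes on the commuting involutions `r₀`, `r₂` but not on `r₀`, `r₁`.
-/
theorem IsTripleGenerated.isRealised_two (h : IsTripleGenerated G) (σ : Superscript) :
    IsRealised (.two σ) G := by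
  obtain ⟨r₀, r₁, r₂, h₀, h₁, h₂, h₀₂, -, h₀₁, hgen⟩ := h
  refine EdgeTransitive.isRealised_two r₀ r₂ r₁ h₀ h₂ h₁ ?_
    ((FreeGroup.of 0 * FreeGroup.of 1) ^ 2) ?_ ?_ σ
  · rwa [Set.pair_comm r₂ r₁]
  · simp only [map_pow, map_mul, FreeGroup.lift_apply_of, Matrix.cons_val_zero, Matrix.cons_val_one]
    rw [sq, mul_assoc, ← mul_assoc r₂, ← h₀₂, mul_assoc r₀ r₂, h₂, mul_one, h₀]
  · simpa using h₀₁

theorem IsTripleGenerated.isRealised_three (h : IsTripleGenerated G) : IsRealised .three G := by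
  obtain ⟨r₀, r₁, r₂, h₀, h₁, h₂, h₀₂, hr₂, h₀₁, hgen⟩ := h
  refine EdgeTransitive.isRealised_three r₀ r₁ r₂ h₀ h₁ h₂ ?_ ?_ hr₂ hgen
  · rintro rfl
    exact h₀₁ (by rw [one_mul, sq, h₁])
  · rintro rfl
    exact h₀₁ (by rw [mul_one, sq, h₀])

theorem IsChirallyGenerated.isRealised_twoEx (h : IsChirallyGenerated G) (σ : Superscript) :
    IsRealised (.twoEx σ) G := by
  obtain ⟨s, z, hs, -, hgen, D, hD, hD'⟩ := h
  exact EdgeTransitive.isRealised_twoEx s z hs hgen D hD hD' σ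

theorem IsChirallyGenerated.isRealised_four (h : IsChirallyGenerated G) (σ : Superscript) :
    IsRealised (.four σ) G := by
  obtain ⟨s, z, hs, hs1, hgen, -⟩ := h
  exact EdgeTransitive.isRealised_four s z hs hs1 hgen σ

/-- As `s⁻¹ = s`, the chiral relation serves as it is. The exponent `2` kills `s` but not `z`, for
`z² = 1` would give `z⁻¹ = z` and contradict chirality. -/
theorem IsChirallyGenerated.isRealised_five (h : IsChirallyGenerated G) (σ : Superscript) :
    IsRealised (.five σ) G := by
  obtain ⟨s, z, hs, hs1, hgen, D, hD, hD'⟩ := h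
  refine EdgeTransitive.isRealised_five s z hgen D hD ?_ 2 ?_ ?_ σ
  · rwa [inv_eq_of_mul_eq_one_left hs]
  · rw [sq, hs]
  · intro hz
    rw [sq] at hz
    rw [inv_eq_of_mul_eq_one_left hz] at hD'
    exact hD' hD

end

section

variable {α : Type} [Fintype α] [DecidableEq α] {p : α}

theorem HasTriple.isTripleGenerated (h : HasTriple α p) :
    IsTripleGenerated (alternatingGroup α) := by
  obtain ⟨r₀, r₁, r₂, s₀, s₁, s₂, q₀, q₁, q₂, h₀₂, hr₂, hp₁, -, hp₀, hR, a, b, c, hab, hbc, hac, -,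
    -, -, hT, m₀, m₁, m₂⟩ := h
  refine ⟨⟨r₀, s₀⟩, ⟨r₁, s₁⟩, ⟨r₂, s₂⟩, Subtype.ext q₀, Subtype.ext q₁, Subtype.ext q₂,
    Subtype.ext h₀₂, fun h => hr₂ (congrArg Subtype.val h), fun h => hp₀ ?_,
    closure_triple_eq_top _ _ _ (alternatingGroup_le_closure hR hab hbc hac ?_ ?_)⟩
  · have h' : (r₀ * r₁) ^ 2 = 1 := congrArg Subtype.val h
    have e : r₀ (r₁ (r₀ p)) = p := by
      have := DFunLike.congr_fun h' p
      simpa [sq, hp₁] using this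
    have := congrArg r₀ e
    rwa [← Perm.mul_apply, q₀] at this
  · refine (Subgroup.closure_le _).2 ?_ hT
    have m₁ : r₁ ∈ Subgroup.closure {r₀, r₁, r₂} := Subgroup.subset_closure (by simp)
    have m₂ : r₂ ∈ Subgroup.closure {r₀, r₁, r₂} := Subgroup.subset_closure (by simp)
    rintro x (rfl | rfl)
    exacts [m₂, mul_mem (mul_mem m₁ m₂) m₁]
  · rintro r (rfl | rfl | rfl) <;> assumption

theorem HasChiralPair.isChirallyGenerated (h : HasChiralPair α p) :
    IsChirallyGenerated (alternatingGroup α) := by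
  obtain ⟨s, z, ss, sz, qs, -, hsp, hR, ⟨a, b, c, hab, hbc, hac, -, -, -, hT, ms, mz⟩, D, hD,
    hD'⟩ := h
  -- Substitution turning a word in `z²`, `s z² s` into a word in `s`, `z`.
  let φ : FreeGroup (Fin 2) →* FreeGroup (Fin 2) :=
    FreeGroup.lift ![FreeGroup.of 1 * FreeGroup.of 1,
      FreeGroup.of 0 * (FreeGroup.of 1 * FreeGroup.of 1) * FreeGroup.of 0]
  have hφ : ∀ x y : Perm α, FreeGroup.lift ![x, y] (φ D) =
      FreeGroup.lift ![y * y, x * (y * y) * x] D := fun x y => by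
    rw [map_freeGroup_lift_pair]
    simp
  have hcoe : ∀ x y : alternatingGroup α, ((FreeGroup.lift ![x, y] (φ D) : alternatingGroup α) :
      Perm α) = FreeGroup.lift ![(x : Perm α), (y : Perm α)] (φ D) := fun x y =>
    map_freeGroup_lift_pair (alternatingGroup α).subtype x y _
  refine ⟨⟨s, ss⟩, ⟨z, sz⟩, Subtype.ext qs, ?_, closure_pair_eq_top _ _
    (alternatingGroup_le_closure hR hab hbc hac ?_ ?_), φ D, Subtype.ext ?_, fun h => hD' ?_⟩
  · intro h
    have : s = 1 := congrArg Subtype.val h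
    exact hsp (by rw [this, Perm.one_apply])
  · refine (Subgroup.closure_le _).2 ?_ hT
    have m₁ : s ∈ Subgroup.closure {s, z} := Subgroup.subset_closure (by simp)
    have m₂ : z ∈ Subgroup.closure {s, z} := Subgroup.subset_closure (by simp)
    rintro x (rfl | rfl)
    exacts [mul_mem m₂ m₂, mul_mem (mul_mem m₁ (mul_mem m₂ m₂)) m₁]
  · rintro r (rfl | rfl) <;> assumption
  · rw [hcoe, hφ]
    exact hD
  · have h' := (hcoe _ _).symm.trans (congrArg Subtype.val h)
    rw [hφ] at h'
    refine Eq.trans ?_ h'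
    rw [mul_inv_rev, mul_inv_rev, mul_inv_rev, inv_eq_of_mul_eq_one_left qs]
    simp [mul_assoc]

end

/-- An alternating group of every degree at least `m` has a property which is inherited by the
sets with four more points, if this is so for the four smallest degrees. -/
theorem exists_of_extend {P : ∀ (α : Type) [Fintype α] [DecidableEq α], α → Prop} {m : ℕ}
    (hP : ∀ (α : Type) [Fintype α] [DecidableEq α] (p : α), P α p →
      P (α ⊕ Fin 4) (Sum.inr 3))
    (h : ∀ n, m ≤ n → n < m + 4 → ∃ p, P (Fin n) p) (n : ℕ) (hn : m ≤ n) :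
    ∃ (α : Type) (_ : Fintype α) (_ : DecidableEq α) (p : α), Fintype.card α = n ∧ P α p := by
  induction n using Nat.strong_induction_on with
  | _ n ih =>
    by_cases hlt : n < m + 4
    · obtain ⟨p, hp⟩ := h n hn hlt
      exact ⟨Fin n, inferInstance, inferInstance, p, Fintype.card_fin n, hp⟩
    · obtain ⟨α, _, _, p, hc, hp⟩ := ih (n - 4) (by omega) (by omega)
      refine ⟨α ⊕ Fin 4, inferInstance, inferInstance, _, ?_, hP α p hp⟩
      rw [Fintype.card_sum, hc, Fintype.card_fin]
      omega

theorem IsRealised.alternatingGroup_fin {T : EdgeClass} {α : Type} [Fintype α] [DecidableEq α]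
    {n : ℕ} (hn : Fintype.card α = n) (h : IsRealised T (alternatingGroup α)) :
    IsRealised T (alternatingGroup (Fin n)) :=
  h.of_mulEquiv (Fintype.equivFinOfCardEq hn).altCongrHom

theorem exists_coe_eq_of_sign_eq_one {α : Type*} [Fintype α] [DecidableEq α] {x : Perm α}
    (h : sign x = 1) : ∃ y : alternatingGroup α, (y : Perm α) = x :=
  ⟨⟨x, h⟩, rfl⟩

theorem isTripleGenerated_of_word {n : ℕ} (r₀ r₁ r₂ : Perm (Fin n)) (p : Fin n)
    (rk : Fin n → ℕ) (a b c : Fin n) (w : List (Fin 3 × Bool)) (m : ℕ)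
    (hs : sign r₀ = 1 ∧ sign r₁ = 1 ∧ sign r₂ = 1)
    (h : r₀ * r₀ = 1 ∧ r₁ * r₁ = 1 ∧ r₂ * r₂ = 1 ∧ r₀ * r₂ = r₂ * r₀ ∧ r₂ ≠ 1 ∧ (r₀ * r₁) ^ 2 ≠ 1)
    (hw : (∀ y, y = p ∨ ∃ i, rk ((![r₀, r₁, r₂] i)⁻¹ y) < rk y) ∧ a ≠ b ∧ b ≠ c ∧ a ≠ c ∧
      FreeGroup.lift ![r₀, r₁, r₂] (FreeGroup.mk w) ^ m = swap a b * swap b c ∧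
      ∀ i, Meets a b c (![r₀, r₁, r₂] i)) :
    IsTripleGenerated (alternatingGroup (Fin n)) := by
  obtain ⟨h₀, h₁, h₂, h₀₂, hr₂, h₀₁⟩ := h
  have := alternatingGroup_le_closure_of_word _ p rk a b c w m hw
  rw [range_vec_triple] at this
  exact ⟨⟨r₀, hs.1⟩, ⟨r₁, hs.2.1⟩, ⟨r₂, hs.2.2⟩, Subtype.ext h₀, Subtype.ext h₁, Subtype.ext h₂,
    Subtype.ext h₀₂, fun h => hr₂ (congrArg Subtype.val h),
    fun h => h₀₁ (congrArg Subtype.val h), closure_triple_eq_top _ _ _ this⟩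

theorem isTripleGenerated_five : IsTripleGenerated (alternatingGroup (Fin 5)) :=
  isTripleGenerated_of_word (swap 0 1 * swap 2 4) (swap 0 3 * swap 1 4) (swap 0 2 * swap 1 4)
    0 ![0, 1, 1, 1, 2] 0 3 2 [(2, true), (1, true)] 1 (by simp [Perm.sign_mul, sign_swap'])
    (by decide +kernel) (by decide +kernel)

theorem isTripleGenerated_nine : IsTripleGenerated (alternatingGroup (Fin 9)) :=
  isTripleGenerated_of_word (swap 2 3 * swap 6 7) (swap 1 2 * swap 3 4 * swap 5 6 * swap 7 8)
    (swap 0 1 * swap 4 5) 0 ![0, 1, 2, 3, 4, 5, 6, 7, 8] 0 1 2 [(2, true), (1, true)] 4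
    (by simp [Perm.sign_mul, sign_swap']) (by decide +kernel) (by decide +kernel)

theorem isRealised_two_of_word {n : ℕ} (x y z : Perm (Fin n)) (p : Fin n) (rk : Fin n → ℕ)
    (a b c : Fin n) (w : List (Fin 3 × Bool)) (m k : ℕ)
    (hs : sign x = 1 ∧ sign y = 1 ∧ sign z = 1)
    (h : x * x = 1 ∧ y * y = 1 ∧ z * z = 1 ∧ (x * y) ^ k = 1 ∧ (x * z) ^ k ≠ 1)
    (hw : (∀ q, q = p ∨ ∃ i, rk ((![x, y, z] i)⁻¹ q) < rk q) ∧ a ≠ b ∧ b ≠ c ∧ a ≠ c ∧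
      FreeGroup.lift ![x, y, z] (FreeGroup.mk w) ^ m = swap a b * swap b c ∧
      ∀ i, Meets a b c (![x, y, z] i)) (σ : Superscript) :
    IsRealised (.two σ) (alternatingGroup (Fin n)) := by
  obtain ⟨hx, hy, hz, hxy, hxz⟩ := h
  have := alternatingGroup_le_closure_of_word _ p rk a b c w m hw
  rw [range_vec_triple] at this
  obtain ⟨x, rfl⟩ := exists_coe_eq_of_sign_eq_one hs.1
  obtain ⟨y, rfl⟩ := exists_coe_eq_of_sign_eq_one hs.2.1
  obtain ⟨z, rfl⟩ := exists_coe_eq_of_sign_eq_one hs.2.2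
  refine isRealised_two x y z (Subtype.ext hx) (Subtype.ext hy)
    (Subtype.ext hz) (closure_triple_eq_top _ _ _ this)
    ((FreeGroup.of 0 * FreeGroup.of 1) ^ k) ?_ ?_ σ
  · simpa using Subtype.ext hxy
  · simpa using fun h => hxz (congrArg Subtype.val h)

theorem isRealised_two_six (σ : Superscript) :
    IsRealised (.two σ) (alternatingGroup (Fin 6)) :=
  isRealised_two_of_word (swap 0 3 * swap 1 4) (swap 0 1 * swap 2 4) (swap 0 5 * swap 2 4)
    0 ![0, 1, 3, 1, 2, 1] 0 5 1 [(1, true), (2, true)] 1 5 (by simp [Perm.sign_mul, sign_swap'])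
    (by decide +kernel) (by decide +kernel) σ

theorem isRealised_two_seven (σ : Superscript) :
    IsRealised (.two σ) (alternatingGroup (Fin 7)) :=
  isRealised_two_of_word (swap 0 5 * swap 1 6) (swap 2 6 * swap 3 4) (swap 2 3 * swap 5 6)
    0 ![0, 3, 3, 4, 5, 1, 2] 1 2 6 [(0, true), (1, true)] 2 6 (by simp [Perm.sign_mul, sign_swap'])
    (by decide +kernel) (by decide +kernel) σ

theorem isRealised_two_eight (σ : Superscript) :
    IsRealised (.two σ) (alternatingGroup (Fin 8)) :=
  isRealised_two_of_word (swap 3 7 * swap 5 6) (swap 0 3 * swap 1 7 * swap 2 4 * swap 5 6)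
    (swap 0 5 * swap 1 4) 0 ![0, 3, 5, 1, 4, 1, 2, 2] 0 5 6 [(0, true), (2, true)] 2 4
    (by simp [Perm.sign_mul, sign_swap']) (by decide +kernel) (by decide +kernel) σ

theorem isRealised_three_of_word {n : ℕ} (x y z : Perm (Fin n)) (p : Fin n) (rk : Fin n → ℕ)
    (a b c : Fin n) (w : List (Fin 3 × Bool)) (m : ℕ)
    (hs : sign x = 1 ∧ sign y = 1 ∧ sign z = 1)
    (h : x * x = 1 ∧ y * y = 1 ∧ z * z = 1 ∧ x ≠ 1 ∧ y ≠ 1 ∧ z ≠ 1)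
    (hw : (∀ q, q = p ∨ ∃ i, rk ((![x, y, z] i)⁻¹ q) < rk q) ∧ a ≠ b ∧ b ≠ c ∧ a ≠ c ∧
      FreeGroup.lift ![x, y, z] (FreeGroup.mk w) ^ m = swap a b * swap b c ∧
      ∀ i, Meets a b c (![x, y, z] i)) :
    IsRealised .three (alternatingGroup (Fin n)) := by
  obtain ⟨hx, hy, hz, hx1, hy1, hz1⟩ := h
  have := alternatingGroup_le_closure_of_word _ p rk a b c w m hw
  rw [range_vec_triple] at this
  exact isRealised_three ⟨x, hs.1⟩ ⟨y, hs.2.1⟩ ⟨z, hs.2.2⟩ (Subtype.ext hx) (Subtype.ext hy)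
    (Subtype.ext hz) (fun h => hx1 (congrArg Subtype.val h))
    (fun h => hy1 (congrArg Subtype.val h)) (fun h => hz1 (congrArg Subtype.val h))
    (closure_triple_eq_top _ _ _ this)

theorem isRealised_three_six : IsRealised .three (alternatingGroup (Fin 6)) :=
  isRealised_three_of_word (swap 0 3 * swap 1 4) (swap 0 1 * swap 2 4) (swap 0 5 * swap 2 4)
    0 ![0, 1, 3, 1, 2, 1] 0 5 1 [(1, true), (2, true)] 1 (by simp [Perm.sign_mul, sign_swap'])
    (by decide +kernel) (by decide +kernel)

theorem isRealised_three_seven : IsRealised .three (alternatingGroup (Fin 7)) :=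
  isRealised_three_of_word (swap 0 5 * swap 1 6) (swap 2 6 * swap 3 4) (swap 2 3 * swap 5 6)
    0 ![0, 3, 3, 4, 5, 1, 2] 1 2 6 [(0, true), (1, true)] 2 (by simp [Perm.sign_mul, sign_swap'])
    (by decide +kernel) (by decide +kernel)

theorem isRealised_three_eight : IsRealised .three (alternatingGroup (Fin 8)) :=
  isRealised_three_of_word (swap 3 7 * swap 5 6) (swap 0 3 * swap 1 7 * swap 2 4 * swap 5 6)
    (swap 0 5 * swap 1 4) 0 ![0, 3, 5, 1, 4, 1, 2, 2] 0 5 6 [(0, true), (2, true)] 2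
    (by simp [Perm.sign_mul, sign_swap']) (by decide +kernel) (by decide +kernel)

theorem isRealised_four_of_word {n : ℕ} (x z : Perm (Fin n)) (p : Fin n) (rk : Fin n → ℕ)
    (a b c : Fin n) (w : List (Fin 2 × Bool)) (m : ℕ)
    (hs : sign x = 1 ∧ sign z = 1) (h : x * x = 1 ∧ x ≠ 1)
    (hw : (∀ q, q = p ∨ ∃ i, rk ((![x, z] i)⁻¹ q) < rk q) ∧ a ≠ b ∧ b ≠ c ∧ a ≠ c ∧
      FreeGroup.lift ![x, z] (FreeGroup.mk w) ^ m = swap a b * swap b c ∧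
      ∀ i, Meets a b c (![x, z] i)) (σ : Superscript) :
    IsRealised (.four σ) (alternatingGroup (Fin n)) := by
  have := alternatingGroup_le_closure_of_word _ p rk a b c w m hw
  rw [range_vec_pair] at this
  obtain ⟨x, rfl⟩ := exists_coe_eq_of_sign_eq_one hs.1
  obtain ⟨z, rfl⟩ := exists_coe_eq_of_sign_eq_one hs.2
  exact isRealised_four x z (Subtype.ext h.1)
    (fun h' => h.2 (congrArg Subtype.val h')) (closure_pair_eq_top _ _ this) σ

theorem isRealised_four_five (σ : Superscript) :
    IsRealised (.four σ) (alternatingGroup (Fin 5)) :=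
  isRealised_four_of_word (swap 0 2 * swap 3 4) (swap 0 1 * swap 1 3) 0 ![0, 1, 1, 2, 3] 0 1 3
    [(1, true)] 1 (by simp [Perm.sign_mul, sign_swap']) (by decide +kernel) (by decide +kernel) σ

theorem isRealised_four_six (σ : Superscript) :
    IsRealised (.four σ) (alternatingGroup (Fin 6)) :=
  isRealised_four_of_word (swap 0 2 * swap 1 3) (swap 0 5 * swap 5 2 * swap 2 3 * swap 3 4) 0
    ![0, 3, 1, 2, 3, 1] 0 4 5 [(0, true), (1, true), (0, true), (1, true), (1, true), (0, true),
      (1, true), (1, true), (1, true)] 1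
    (by simp [Perm.sign_mul, sign_swap']) (by decide +kernel) (by decide +kernel) σ

theorem isRealised_four_seven (σ : Superscript) :
    IsRealised (.four σ) (alternatingGroup (Fin 7)) :=
  isRealised_four_of_word (swap 0 3 * swap 1 2) (swap 0 2 * swap 2 6 * swap 1 5 * swap 3 4) 0
    ![0, 2, 1, 1, 2, 3, 2] 0 6 2 [(1, true)] 2
    (by simp [Perm.sign_mul, sign_swap']) (by decide +kernel) (by decide +kernel) σ

theorem isRealised_five_of_word {n : ℕ} (x y : Perm (Fin n)) (p : Fin n) (rk : Fin n → ℕ)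
    (a b c : Fin n) (w : List (Fin 2 × Bool)) (m : ℕ) (hs : sign x = 1 ∧ sign y = 1)
    (hw : (∀ q, q = p ∨ ∃ i, rk ((![x, y] i)⁻¹ q) < rk q) ∧ a ≠ b ∧ b ≠ c ∧ a ≠ c ∧
      FreeGroup.lift ![x, y] (FreeGroup.mk w) ^ m = swap a b * swap b c ∧
      ∀ i, Meets a b c (![x, y] i)) (D : FreeGroup (Fin 2)) (k : ℕ)
    (h : FreeGroup.lift ![x, y] D = 1 ∧ FreeGroup.lift ![x⁻¹, y⁻¹] D ≠ 1 ∧ x ^ k = 1 ∧ y ^ k ≠ 1)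
    (σ : Superscript) : IsRealised (.five σ) (alternatingGroup (Fin n)) := by
  have := alternatingGroup_le_closure_of_word _ p rk a b c w m hw
  rw [range_vec_pair] at this
  obtain ⟨x, rfl⟩ := exists_coe_eq_of_sign_eq_one hs.1
  obtain ⟨y, rfl⟩ := exists_coe_eq_of_sign_eq_one hs.2
  obtain ⟨hD, hD', hx, hy⟩ := h
  have hcoe := map_freeGroup_lift_pair (alternatingGroup (Fin n)).subtype
  refine isRealised_five x y (closure_pair_eq_top _ _ this) D ?_ ?_ k (Subtype.ext hx)
    (fun h' => hy (congrArg Subtype.val h')) σ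
  · exact Subtype.ext ((hcoe x y D).trans hD)
  · exact fun h' => hD' ((hcoe x⁻¹ y⁻¹ D).symm.trans (congrArg Subtype.val h'))

theorem isRealised_five_seven (σ : Superscript) :
    IsRealised (.five σ) (alternatingGroup (Fin 7)) :=
  isRealised_five_of_word (swap 0 4 * swap 4 2 * swap 3 6 * swap 6 5)
    (swap 0 6 * swap 6 2 * swap 2 5 * swap 5 1 * swap 1 4 * swap 4 3) 0 ![0, 3, 2, 2, 1, 2, 1]
    1 4 2 [(0, true), (1, true), (0, true), (1, false)] 1
    (by simp [Perm.sign_mul, sign_swap']) (by decide +kernel)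
    -- The relation is `(x y x⁻¹ y²)² = 1`; the exponent `3` is the order of `x`, a product of two
    -- disjoint 3-cycles, while `y` is a 7-cycle.
    (FreeGroup.mk [(0, true), (1, true), (0, false), (1, true), (1, true),
      (0, true), (1, true), (0, false), (1, true), (1, true)]) 3 (by decide +kernel) σ

theorem isRealised_of_isTripleGenerated {T : EdgeClass} {n : ℕ} (hn : n = 5 ∨ 9 ≤ n)
    (h : ∀ (G : Type) [Group G], IsTripleGenerated G → IsRealised T G) :
    IsRealised T (alternatingGroup (Fin n)) := by
  rcases hn with rfl | hn
  · exact h _ isTripleGenerated_five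
  rcases hn.eq_or_lt with rfl | hn
  · exact h _ isTripleGenerated_nine
  -- Degrees `10` to `13` represent all residues modulo `4`; degrees `5` and `9` stand apart.
  obtain ⟨α, _, _, p, hc, hp⟩ := exists_of_extend (P := HasTriple) (m := 10)
    (fun α _ _ p h => h.extend) (fun n h₁ h₂ => by
      interval_cases n
      exacts [⟨_, hasTriple_fin_ten⟩, ⟨_, hasTriple_fin_eleven⟩, ⟨_, hasTriple_fin_twelve⟩,
        ⟨_, hasTriple_fin_thirteen⟩]) n hn
  exact (h _ hp.isTripleGenerated).alternatingGroup_fin hc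

theorem isRealised_of_isChirallyGenerated {T : EdgeClass} {n : ℕ} (hn : 8 ≤ n)
    (h : ∀ (G : Type) [Group G], IsChirallyGenerated G → IsRealised T G) :
    IsRealised T (alternatingGroup (Fin n)) := by
  obtain ⟨α, _, _, p, hc, hp⟩ := exists_of_extend (P := HasChiralPair) (m := 8)
    (fun α _ _ p h => h.extend) (fun n h₁ h₂ => by
      interval_cases n
      exacts [⟨_, hasChiralPair_fin_eight⟩, ⟨_, hasChiralPair_fin_nine⟩,
        ⟨_, hasChiralPair_fin_ten⟩, ⟨_, hasChiralPair_fin_eleven⟩]) n hn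
  exact (h _ hp.isChirallyGenerated).alternatingGroup_fin hc

theorem isRealised_alternatingGroup {n : ℕ} (hn : 5 ≤ n) {T : EdgeClass}
    (h : (T = .one ∧ (n = 5 ∨ 9 ≤ n)) ∨
      ((∃ σ, T = .two σ) ∨ T = .three ∨ (∃ σ, T = .four σ)) ∨
      ((∃ σ, T = .twoEx σ) ∧ 8 ≤ n) ∨ ((∃ σ, T = .five σ) ∧ 7 ≤ n)) :
    IsRealised T (alternatingGroup (Fin n)) := by
  rcases h with ⟨rfl, hn⟩ | (⟨σ, rfl⟩ | rfl | ⟨σ, rfl⟩) | ⟨⟨σ, rfl⟩, hn⟩ | ⟨⟨σ, rfl⟩, hn⟩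
  · exact isRealised_of_isTripleGenerated hn fun G _ h => h.isRealised_one
  · by_cases hn' : n = 5 ∨ 9 ≤ n
    · exact isRealised_of_isTripleGenerated hn' fun G _ h => h.isRealised_two σ
    · have : n < 9 := by omega
      have : 5 < n := by omega
      interval_cases n
      exacts [isRealised_two_six σ, isRealised_two_seven σ, isRealised_two_eight σ]
  · by_cases hn' : n = 5 ∨ 9 ≤ n
    · exact isRealised_of_isTripleGenerated hn' fun G _ h => h.isRealised_three
    · have : n < 9 := by omega
      have : 5 < n := by omega
      interval_cases n
      exacts [isRealised_three_six, isRealised_three_seven, isRealised_three_eight]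
  · by_cases hn' : 8 ≤ n
    · exact isRealised_of_isChirallyGenerated hn' fun G _ h => h.isRealised_four σ
    · interval_cases n
      exacts [isRealised_four_five σ, isRealised_four_six σ, isRealised_four_seven σ]
  · exact isRealised_of_isChirallyGenerated hn fun G _ h => h.isRealised_twoEx σ
  · rcases hn.eq_or_lt with rfl | hn
    · exact isRealised_five_seven σ
    · exact isRealised_of_isChirallyGenerated hn fun G _ h => h.isRealised_five σ

end Realisation

end EdgeTransitive

namespace EdgeTransitive

open Equiv Equiv.Perm
open scoped Pointwise

/-! ### Automorphisms from subgroups of a direct square -/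

section Inverted

/-- Generators which correspond to their inverses under a subgroup of `G × G` which is the graph of
a partial injection are inverted by an automorphism. -/
theorem exists_mulEquiv_of_subgroup_prod {G : Type*} [Group G] {x y x' y' : G}
    (h : Subgroup.closure {x, y} = ⊤) (h' : Subgroup.closure {x', y'} = ⊤)
    (H : Subgroup (G × G)) (hx : (x, x') ∈ H) (hy : (y, y') ∈ H)
    (h₁ : ∀ u, (u, 1) ∈ H → u = 1) (h₂ : ∀ u, (1, u) ∈ H → u = 1) :
    ∃ α : G ≃* G, α x = x' ∧ α y = y' := by
  have s₁ : ∀ u, ∃ v, (u, v) ∈ H := by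
    have : Subgroup.closure {x, y} ≤ H.map (MonoidHom.fst G G) := by
      rw [Subgroup.closure_le]
      rintro _ (rfl | rfl)
      exacts [⟨_, hx, rfl⟩, ⟨_, hy, rfl⟩]
    intro u
    obtain ⟨⟨a, v⟩, hv, rfl⟩ := this (h ▸ Subgroup.mem_top u)
    exact ⟨v, hv⟩
  have s₂ : ∀ u, ∃ v, (v, u) ∈ H := by
    have : Subgroup.closure {x', y'} ≤ H.map (MonoidHom.snd G G) := by
      rw [Subgroup.closure_le]
      rintro _ (rfl | rfl)
      exacts [⟨_, hx, rfl⟩, ⟨_, hy, rfl⟩]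
    intro u
    obtain ⟨⟨v, b⟩, hv, rfl⟩ := this (h' ▸ Subgroup.mem_top u)
    exact ⟨v, hv⟩
  obtain ⟨e, he⟩ := Subgroup.exists_mulEquiv_eq_graph (G := H)
    ⟨by
      rintro ⟨⟨a, b⟩, hab⟩ ⟨⟨c, d⟩, hcd⟩ (rfl : a = c)
      have := h₂ (b / d) (by simpa using div_mem hab hcd)
      exact Subtype.ext (Prod.ext rfl (div_eq_one.1 this)), fun u => (s₁ u).elim fun v hv => ⟨⟨_, hv⟩, rfl⟩⟩
    ⟨by
      rintro ⟨⟨a, b⟩, hab⟩ ⟨⟨c, d⟩, hcd⟩ (rfl : b = d)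
      have := h₁ (a / c) (by simpa using div_mem hab hcd)
      exact Subtype.ext (Prod.ext (div_eq_one.1 this) rfl), fun u => (s₂ u).elim fun v hv => ⟨⟨_, hv⟩, rfl⟩⟩
  rw [he] at hx hy
  exact ⟨e, hx, hy⟩

theorem closure_inv_pair {G : Type*} [Group G] {x y : G} (h : Subgroup.closure {x, y} = ⊤) :
    Subgroup.closure {x⁻¹, y⁻¹} = ⊤ := by
  rw [← Subgroup.closure_inv, Set.inv_insert, Set.inv_singleton, inv_inv, inv_inv, h]

end Inverted

/-! ### Inverting generators of `A₅` and `A₆` inside `PSL(2,9)` -/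

section FieldOfNine

/-- The field with nine elements, as the field of Gaussian integers modulo `3`. -/
abbrev FieldNine : Type := QuadraticAlgebra (ZMod 3) 2 0

instance : Fact (∀ r : ZMod 3, r ^ 2 ≠ 2 + 0 * r) := ⟨by decide⟩

instance : Fintype FieldNine := Fintype.ofEquiv _ (QuadraticAlgebra.equivProd 2 0).symm

/-- A bijection between the ten bisections of a set of six elements and the projective line over
the field with nine elements: a bisection is given by either of its halves, a point of the projective
line by a vector. -/
def bisectionLabel (X : Finset (Fin 6)) : Fin 2 → FieldNine :=
  match min (∑ i ∈ X, 2 ^ i.val) (63 - ∑ i ∈ X, 2 ^ i.val) with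
  | 7 => ![1, ⟨2, 2⟩]
  | 11 => ![1, ⟨1, 1⟩]
  | 13 => ![1, ⟨2, 1⟩]
  | 14 => ![1, ⟨1, 2⟩]
  | 19 => ![1, 0]
  | 21 => ![1, ⟨0, 2⟩]
  | 22 => ![1, ⟨2, 0⟩]
  | 25 => ![1, 1]
  | 26 => ![1, ⟨0, 1⟩]
  -- The minimum picks the half without the point `5`; among halves only the code `28` is left for
  -- the default.
  | _ => ![0, 1]

/-- The halves of the bisections of a set of six elements. -/
abbrev halves : Finset (Finset (Fin 6)) := Finset.powersetCard 3 Finset.univ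

theorem smul_mem_halves (u : Perm (Fin 6)) {X : Finset (Fin 6)} (hX : X ∈ halves) :
    u • X ∈ halves := by
  rw [Finset.mem_powersetCard_univ] at hX ⊢
  rw [Finset.card_smul_finset, hX]

theorem smul_compl_half (u : Perm (Fin 6)) (X : Finset (Fin 6)) : u • Xᶜ = (u • X)ᶜ := by
  rw [Finset.compl_eq_univ_sdiff, Finset.compl_eq_univ_sdiff, Finset.smul_finset_sdiff,
    Finset.smul_finset_univ]

theorem bisectionLabel_separates : ∀ X ∈ halves, ∀ Y ∈ halves,
    bisectionLabel X 0 * bisectionLabel Y 1 = bisectionLabel X 1 * bisectionLabel Y 0 →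
    Y = X ∨ Y = Xᶜ := by
  decide +kernel

theorem exists_smul_bisectionLabel :
    ∀ v : Fin 2 → FieldNine, ∃ X ∈ halves, ∃ c : FieldNine, v = c • bisectionLabel X := by
  decide +kernel

theorem perm_six_eq_one : ∀ u : Perm (Fin 6),
    (∀ X ∈ halves, u • X = X ∨ u • X = Xᶜ) → u = 1 := by
  decide +kernel

/-- The linear map given by `A` permutes the points of the projective line as `u` permutes the
bisections. -/
def Lifts (A : Matrix (Fin 2) (Fin 2) FieldNine) (u : Perm (Fin 6)) : Prop :=
  ∀ X ∈ halves, ∃ c : FieldNine, c ≠ 0 ∧ A.mulVec (bisectionLabel X) = c • bisectionLabel (u • X)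

instance (A : Matrix (Fin 2) (Fin 2) FieldNine) (u : Perm (Fin 6)) : Decidable (Lifts A u) :=
  inferInstanceAs (Decidable (∀ X ∈ halves, ∃ c : FieldNine, c ≠ 0 ∧
    A.mulVec (bisectionLabel X) = c • bisectionLabel (u • X)))

open Matrix

theorem eq_or_eq_compl_of_smul_eq_smul {X Y : Finset (Fin 6)} (hX : X ∈ halves) (hY : Y ∈ halves)
    {c d : FieldNine} (hc : c ≠ 0) (h : c • bisectionLabel X = d • bisectionLabel Y) :
    Y = X ∨ Y = Xᶜ := by
  refine bisectionLabel_separates X hX Y hY (mul_left_cancel₀ hc ?_)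
  have h0 : c * bisectionLabel X 0 = d * bisectionLabel Y 0 := congrFun h 0
  have h1 : c * bisectionLabel X 1 = d * bisectionLabel Y 1 := congrFun h 1
  linear_combination bisectionLabel Y 1 * h0 - bisectionLabel Y 0 * h1

variable {A B : Matrix (Fin 2) (Fin 2) FieldNine} {u v : Perm (Fin 6)}

theorem Lifts.mul (hA : Lifts A u) (hB : Lifts B v) : Lifts (A * B) (u * v) := by
  intro X hX
  obtain ⟨c, hc, h⟩ := hB X hX
  obtain ⟨d, hd, h'⟩ := hA _ (smul_mem_halves v hX)
  refine ⟨c * d, mul_ne_zero hc hd, ?_⟩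
  rw [← mulVec_mulVec, h, mulVec_smul, h', smul_smul, SemigroupAction.mul_smul u]

theorem lifts_scalar {c : FieldNine} (hc : c ≠ 0) : Lifts (c • 1) 1 := fun X _ =>
  ⟨c, hc, by rw [smul_mulVec, one_mulVec, one_smul]⟩

theorem Lifts.adjugate (hdet : A.det = 1) (hA : Lifts A u) : Lifts A.adjugate u⁻¹ := by
  intro X hX
  obtain ⟨c, hc, h⟩ := hA _ (smul_mem_halves u⁻¹ hX)
  refine ⟨c⁻¹, inv_ne_zero hc, ?_⟩
  rw [smul_inv_smul] at h
  have e : A.adjugate * A = 1 := by rw [adjugate_mul, hdet, one_smul]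
  have h' := congrArg (fun v => c⁻¹ • A.adjugate.mulVec v) h
  simp only [mulVec_mulVec, e, one_mulVec, mulVec_smul, smul_smul, inv_mul_cancel₀ hc,
    one_smul] at h'
  exact h'.symm

theorem Lifts.unique (hu : Lifts A u) (hv : Lifts A v) : u = v := by
  rw [← inv_mul_eq_one]
  refine perm_six_eq_one _ fun X hX => ?_
  obtain ⟨c, hc, h⟩ := hu X hX
  obtain ⟨d, -, h'⟩ := hv X hX
  have := eq_or_eq_compl_of_smul_eq_smul (smul_mem_halves u hX) (smul_mem_halves v hX) hc
    (h.symm.trans h')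
  rw [SemigroupAction.mul_smul]
  rcases this with h | h <;> rw [h]
  · exact Or.inl (inv_smul_smul u X)
  · refine Or.inr ?_
    rw [smul_compl_half, inv_smul_smul]

/-- A linear map fixing the three points of the projective line spanned by `(1,0)`, `(0,1)` and
`(1,1)` is scalar. -/
theorem Lifts.eq_scalar (h : Lifts A 1) : ∃ c : FieldNine, c ≠ 0 ∧ A = c • 1 := by
  have l₁ : bisectionLabel {0, 1, 4} = ![1, 0] := by decide +kernel
  have l₂ : bisectionLabel {0, 1, 5} = ![0, 1] := by decide +kernel
  have l₃ : bisectionLabel {0, 3, 4} = ![1, 1] := by decide +kernel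
  obtain ⟨a, ha, h₁⟩ := h {0, 1, 4} (by decide)
  obtain ⟨b, -, h₂⟩ := h {0, 1, 5} (by decide)
  obtain ⟨c, -, h₃⟩ := h {0, 3, 4} (by decide)
  rw [one_smul, l₁] at h₁
  rw [one_smul, l₂] at h₂
  rw [one_smul, l₃] at h₃
  have e₁ := congrFun h₁ 0
  have e₂ := congrFun h₁ 1
  have e₃ := congrFun h₂ 0
  have e₄ := congrFun h₂ 1
  have e₅ := congrFun h₃ 0
  have e₆ := congrFun h₃ 1
  simp [mulVec, dotProduct, Fin.sum_univ_two] at e₁ e₂ e₃ e₄ e₅ e₆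
  refine ⟨a, ha, ?_⟩
  ext i j : 1
  fin_cases i <;> fin_cases j <;> simp_all

/-- Half of the isomorphism of `A₆` with `PSL(2,9)`: two generators are lifted explicitly, and
liftability passes to products and inverses. -/
theorem exists_lifts {u : Perm (Fin 6)} (hu : u ∈ alternatingGroup (Fin 6)) :
    ∃ A : Matrix (Fin 2) (Fin 2) FieldNine, A.det = 1 ∧ Lifts A u := by
  have h := alternatingGroup_le_closure_of_word
    ![swap 0 2 * swap 1 3, swap 0 5 * swap 5 2 * swap 2 3 * swap 3 4] 0
    ![0, 3, 1, 2, 3, 1] 0 4 5 [(0, true), (1, true), (0, true), (1, true), (1, true), (0, true),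
      (1, true), (1, true), (1, true)] 1 (by decide +kernel) hu
  rw [range_vec_pair] at h
  clear hu
  induction h using Subgroup.closure_induction with
  | mem x hx =>
    rcases hx with rfl | rfl
    · exact ⟨!![0, 1; 2, 0], by decide +kernel, by decide +kernel⟩
    · exact ⟨!![0, ⟨1, 1⟩; ⟨1, 2⟩, ⟨1, 1⟩], by decide +kernel, by decide +kernel⟩
  | one => exact ⟨1, det_one, by simpa using lifts_scalar one_ne_zero⟩
  | mul x y _ _ hx hy =>
    obtain ⟨A, hA', hA⟩ := hx
    obtain ⟨B, hB', hB⟩ := hy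
    exact ⟨A * B, by rw [det_mul, hA', hB', one_mul], hA.mul hB⟩
  | inv x _ hx =>
    obtain ⟨A, hA', hA⟩ := hx
    exact ⟨A.adjugate, by rw [det_adjugate, hA', one_pow], hA.adjugate hA'⟩

/-- By Cayley–Hamilton, `C = AB - BA` satisfies `AC + CA = A²B - BA² = tr(A) C`, and the adjugate is
`tr(A) - A`. For determinant `1`, an invertible `C` thus conjugates `A` to `A⁻¹`, and `B` to `B⁻¹`
by symmetry. -/
theorem commutator_mul_eq {R : Type*} [CommRing R] (A B : Matrix (Fin 2) (Fin 2) R) :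
    (A * B - B * A) * A = A.adjugate * (A * B - B * A) := by
  rw [adjugate_fin_two]
  ext i j : 1
  fin_cases i <;> fin_cases j <;> simp [Matrix.mul_apply, Fin.sum_univ_two] <;> ring

/-- A non-zero column of the adjugate spans a point of the kernel, and every vector is a multiple of
a label. -/
theorem exists_mulVec_bisectionLabel_eq_zero {g : Matrix (Fin 2) (Fin 2) FieldNine} (h0 : g ≠ 0)
    (hdet : g.det = 0) : ∃ X ∈ halves, g.mulVec (bisectionLabel X) = 0 := by
  have h : g * g.adjugate = 0 := by rw [mul_adjugate, hdet, zero_smul]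
  have hadj : g.adjugate ≠ 0 := by
    intro e
    apply h0
    rw [adjugate_fin_two] at e
    have e₁ := congrFun (congrFun e 0) 0
    have e₂ := congrFun (congrFun e 0) 1
    have e₃ := congrFun (congrFun e 1) 0
    have e₄ := congrFun (congrFun e 1) 1
    simp at e₁ e₂ e₃ e₄
    ext i j : 1
    fin_cases i <;> fin_cases j <;> assumption
  obtain ⟨i, j, hij⟩ : ∃ i j, g.adjugate i j ≠ 0 := by
    by_contra! hc
    exact hadj (Matrix.ext hc)
  obtain ⟨X, hX, c, hc⟩ := exists_smul_bisectionLabel (fun i => g.adjugate i j)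
  refine ⟨X, hX, ?_⟩
  have hc0 : c ≠ 0 := by
    rintro rfl
    exact hij (by simpa using congrFun hc i)
  have : c • g.mulVec (bisectionLabel X) = 0 := by
    rw [← mulVec_smul, ← hc]
    ext k : 1
    exact congrFun (congrFun h k) j
  exact (smul_eq_zero.1 this).resolve_left hc0

theorem eq_or_eq_compl_of_mulVec_eq_zero {g : Matrix (Fin 2) (Fin 2) FieldNine} (h0 : g ≠ 0)
    {X Y : Finset (Fin 6)} (hX : X ∈ halves) (hY : Y ∈ halves)
    (h : g.mulVec (bisectionLabel X) = 0) (h' : g.mulVec (bisectionLabel Y) = 0) :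
    Y = X ∨ Y = Xᶜ := by
  refine bisectionLabel_separates X hX Y hY ?_
  by_contra hne
  apply h0
  ext i j : 1
  have e₁ := congrFun h i
  have e₂ := congrFun h' i
  simp only [mulVec, dotProduct, Fin.sum_univ_two, Pi.zero_apply] at e₁ e₂
  refine (mul_eq_zero.1 (?_ : (bisectionLabel X 0 * bisectionLabel Y 1 -
    bisectionLabel X 1 * bisectionLabel Y 0) * g i j = 0)).resolve_left (sub_ne_zero.2 hne)
  revert j
  rw [Fin.forall_fin_two]
  constructor
  · linear_combination bisectionLabel Y 1 * e₁ - bisectionLabel X 1 * e₂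
  · linear_combination bisectionLabel X 0 * e₂ - bisectionLabel Y 0 * e₁

theorem smul_eq_or_eq_compl_of_mem_closure {G : Type*} [Group G] (φ : G →* Perm (Fin 6))
    {X : Finset (Fin 6)} {s : Set G} (hs : ∀ u ∈ s, φ u • X = X ∨ φ u • X = Xᶜ) {u : G}
    (hu : u ∈ Subgroup.closure s) : φ u • X = X ∨ φ u • X = Xᶜ := by
  induction hu using Subgroup.closure_induction with
  | mem u hu => exact hs u hu
  | one => exact Or.inl (by rw [map_one, one_smul])
  | mul u v _ _ hu hv =>
    rw [map_mul, SemigroupAction.mul_smul]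
    rcases hv with h | h <;> rw [h]
    · exact hu
    · rw [smul_compl_half, compl_inj_iff, compl_eq_comm, eq_comm (a := Xᶜ)]
      exact hu.symm
  | inv u _ hu =>
    rw [map_inv, inv_smul_eq_iff, inv_smul_eq_iff, smul_compl_half, eq_compl_comm,
      eq_comm (a := X)]
    exact hu

/-- Generators of a group of even permutations of six points without an invariant
bisection are inverted by an automorphism of this group. -/
theorem exists_mulEquiv_inv_of_hom {G : Type*} [Group G] (φ : G →* Perm (Fin 6))
    (hφ : Function.Injective φ) (hsign : ∀ u, φ u ∈ alternatingGroup (Fin 6)) {w : G}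
    (hw : ∀ X ∈ halves, φ w • X ≠ X ∧ φ w • X ≠ Xᶜ) (hG : ∃ u v : G, u * v ≠ v * u) {x y : G}
    (h : Subgroup.closure {x, y} = ⊤) : ∃ α : G ≃* G, α x = x⁻¹ ∧ α y = y⁻¹ := by
  obtain ⟨A, dA, hA⟩ := exists_lifts (hsign x)
  obtain ⟨B, dB, hB⟩ := exists_lifts (hsign y)
  have gA := commutator_mul_eq A B
  have gB := commutator_mul_eq B A
  rw [← neg_sub, neg_mul, mul_neg, neg_inj] at gB
  -- Otherwise the generators commute, and the group is abelian.
  have g0 : A * B - B * A ≠ 0 := by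
    intro h0
    have hxy : x * y = y * x := by
      apply hφ
      rw [map_mul, map_mul]
      refine (hA.mul hB).unique ?_
      rw [sub_eq_zero.1 h0]
      exact hB.mul hA
    obtain ⟨u, v, huv⟩ := hG
    have hle : Subgroup.closure {x, y} ≤ Subgroup.centralizer {x, y} := by
      rw [Subgroup.closure_le]
      rintro _ (rfl | rfl) _ (rfl | rfl) <;> simp [hxy]
    rw [h, top_le_iff, Subgroup.centralizer_eq_top_iff_subset] at hle
    have hle' : Subgroup.closure {x, y} ≤ Subgroup.center G := by rwa [Subgroup.closure_le]
    rw [h] at hle'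
    exact huv (Subgroup.mem_center_iff.1 (hle' (Subgroup.mem_top v)) u)
  generalize A * B - B * A = g at gA gB g0
  -- The kernel of a singular `g` would be a common eigenline of `A` and `B`, i.e. a bisection
  -- invariant under the whole group, including `w`.
  have gdet : g.det ≠ 0 := by
    intro h0
    obtain ⟨X, hX, hgX⟩ := exists_mulVec_bisectionLabel_eq_zero g0 h0
    have key : ∀ {C C' : Matrix (Fin 2) (Fin 2) FieldNine} {t : G}, Lifts C (φ t) →
        g * C = C' * g → φ t • X = X ∨ φ t • X = Xᶜ := by
      intro C C' t hC e
      obtain ⟨c, hc, hcX⟩ := hC X hX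
      refine eq_or_eq_compl_of_mulVec_eq_zero g0 hX (smul_mem_halves _ hX) hgX ?_
      have : c • g.mulVec (bisectionLabel (φ t • X)) = 0 := by
        rw [← mulVec_smul, ← hcX, mulVec_mulVec, e, ← mulVec_mulVec, hgX, mulVec_zero]
      exact (smul_eq_zero.1 this).resolve_left hc
    have := smul_eq_or_eq_compl_of_mem_closure φ (X := X) (s := {x, y})
      (by rintro _ (rfl | rfl); exacts [key hA gA, key hB gB]) (h ▸ Subgroup.mem_top w)
    exact this.elim (hw X hX).1 (hw X hX).2
  have cancel : ∀ {M N : Matrix (Fin 2) (Fin 2) FieldNine}, M * g = N * g → M = N := by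
    intro M N hMN
    have := congrArg (· * g.adjugate) hMN
    simp only [mul_assoc, mul_adjugate, Matrix.mul_smul, mul_one] at this
    exact smul_right_injective _ gdet this
  have cancel' : ∀ {M N : Matrix (Fin 2) (Fin 2) FieldNine}, g * M = g * N → M = N := by
    intro M N hMN
    have := congrArg (g.adjugate * ·) hMN
    simp only [← mul_assoc, adjugate_mul, Matrix.smul_mul, one_mul] at this
    exact smul_right_injective _ gdet this
  have lifts_one : Lifts 1 1 := by simpa using lifts_scalar one_ne_zero
  -- Conjugation by `g` need not preserve the image of `G` a priori. So the pairs in `G × G` that it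
  -- matches are collected; `(x, x⁻¹)` and `(y, y⁻¹)` make both projections onto, and cancelling `g`
  -- makes them injective. Determinant `1` lets adjugates serve as inverses.
  let H : Subgroup (G × G) :=
    { carrier := {p | ∃ A A' : Matrix (Fin 2) (Fin 2) FieldNine, A.det = 1 ∧ A'.det = 1 ∧
        Lifts A (φ p.1) ∧ Lifts A' (φ p.2) ∧ g * A = A' * g}
      one_mem' := ⟨1, 1, det_one, det_one, by simpa using lifts_one, by simpa using lifts_one,
        by simp⟩
      mul_mem' := by
        rintro ⟨u, u'⟩ ⟨v, v'⟩ ⟨A, A', dA, dA', hA, hA', e⟩ ⟨B, B', dB, dB', hB, hB', e'⟩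
        refine ⟨A * B, A' * B', by rw [det_mul, dA, dB, one_mul],
          by rw [det_mul, dA', dB', one_mul], ?_, ?_, ?_⟩
        · simpa using hA.mul hB
        · simpa using hA'.mul hB'
        · rw [← mul_assoc, e, mul_assoc, e', mul_assoc]
      inv_mem' := by
        rintro ⟨u, u'⟩ ⟨A, A', dA, dA', hA, hA', e⟩
        refine ⟨A.adjugate, A'.adjugate, by rw [det_adjugate, dA, one_pow],
          by rw [det_adjugate, dA', one_pow], ?_, ?_, ?_⟩
        · simpa using hA.adjugate dA
        · simpa using hA'.adjugate dA'
        · calc g * A.adjugate = A'.adjugate * (A' * g) * A.adjugate := by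
                rw [← mul_assoc A'.adjugate, adjugate_mul, dA', one_smul, one_mul]
            _ = A'.adjugate * g := by
                rw [← e, mul_assoc, mul_assoc, mul_adjugate, dA, one_smul, mul_one] }
  refine exists_mulEquiv_of_subgroup_prod h (closure_inv_pair h) H ?_ ?_ ?_ ?_
  · exact ⟨A, _, dA, by rw [det_adjugate, dA, one_pow], hA, by simpa using hA.adjugate dA, gA⟩
  · exact ⟨B, _, dB, by rw [det_adjugate, dB, one_pow], hB, by simpa using hB.adjugate dB, gB⟩
  · rintro u ⟨A, A', -, -, hA, hA', e⟩
    obtain ⟨c, hc, rfl⟩ := Lifts.eq_scalar (by simpa using hA')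
    rw [Matrix.smul_mul, one_mul] at e
    have hAc : A = c • 1 := cancel' (by rw [e, Matrix.mul_smul, mul_one])
    apply hφ
    rw [map_one]
    exact hA.unique (hAc ▸ lifts_scalar hc)
  · rintro u ⟨A, A', -, -, hA, hA', e⟩
    obtain ⟨c, hc, rfl⟩ := Lifts.eq_scalar (by simpa using hA)
    rw [Matrix.mul_smul, mul_one] at e
    have hAc : A' = c • 1 := cancel (by rw [← e, Matrix.smul_mul, one_mul])
    apply hφ
    rw [map_one]
    exact hA'.unique (hAc ▸ lifts_scalar hc)

/-- The element without invariant bisection is a 5-cycle: having odd order it would preserve each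
half, yet a set of three points is not a union of its cycles. -/
theorem alternatingGroup_six_exists_mulEquiv_inv {x y : alternatingGroup (Fin 6)}
    (h : Subgroup.closure {x, y} = ⊤) : ∃ α : alternatingGroup (Fin 6) ≃* alternatingGroup (Fin 6),
      α x = x⁻¹ ∧ α y = y⁻¹ := by
  refine exists_mulEquiv_inv_of_hom (alternatingGroup (Fin 6)).subtype Subtype.val_injective
    (fun u => u.2) (w := ⟨swap 0 1 * swap 1 2 * swap 2 3 * swap 3 4,
      by simp [Perm.mem_alternatingGroup, Perm.sign_mul, sign_swap']⟩) ?_ ?_ h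
  · change ∀ X ∈ halves, (swap 0 1 * swap 1 2 * swap 2 3 * swap 3 4 : Perm (Fin 6)) • X ≠ X ∧
      (swap 0 1 * swap 1 2 * swap 2 3 * swap 3 4 : Perm (Fin 6)) • X ≠ Xᶜ
    decide +kernel
  · refine ⟨⟨swap 0 1 * swap 1 2, by simp [Perm.mem_alternatingGroup, Perm.sign_mul, sign_swap']⟩,
      ⟨swap 0 1 * swap 1 3, by simp [Perm.mem_alternatingGroup, Perm.sign_mul, sign_swap']⟩,
      fun h => ?_⟩
    have : ((swap 0 1 * swap 1 2) * (swap 0 1 * swap 1 3) : Perm (Fin 6)) 0 =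
      ((swap 0 1 * swap 1 3) * (swap 0 1 * swap 1 2) : Perm (Fin 6)) 0 :=
      DFunLike.congr_fun (congrArg Subtype.val h) 0
    revert this
    decide +kernel

theorem extendDomain_smul_half_ne : ∀ X ∈ halves,
    extendDomainHom (finSuccAboveEquiv (Fin.last 5))
      (swap 0 1 * swap 1 2 * swap 2 3 * swap 3 4) • X ≠ X ∧
    extendDomainHom (finSuccAboveEquiv (Fin.last 5))
      (swap 0 1 * swap 1 2 * swap 2 3 * swap 3 4) • X ≠ Xᶜ := by
  decide +kernel

/-- `A₅` is embedded in `A₆` as the stabiliser of the last point and again contains a 5-cycle. -/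
theorem alternatingGroup_five_exists_mulEquiv_inv {x y : alternatingGroup (Fin 5)}
    (h : Subgroup.closure {x, y} = ⊤) : ∃ α : alternatingGroup (Fin 5) ≃* alternatingGroup (Fin 5),
      α x = x⁻¹ ∧ α y = y⁻¹ := by
  obtain ⟨w, hw⟩ := exists_coe_eq_of_sign_eq_one (α := Fin 5)
    (x := swap 0 1 * swap 1 2 * swap 2 3 * swap 3 4) (by simp [Perm.sign_mul, sign_swap'])
  refine exists_mulEquiv_inv_of_hom
    ((extendDomainHom (finSuccAboveEquiv (Fin.last 5))).comp (alternatingGroup (Fin 5)).subtype)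
    ((extendDomainHom_injective _).comp Subtype.val_injective) ?_ (w := w) ?_ ?_ h
  · intro u
    exact (sign_extendDomain u.1 _).trans u.2
  · simp only [MonoidHom.comp_apply, Subgroup.subtype_apply, hw]
    exact extendDomain_smul_half_ne
  · refine ⟨⟨swap 0 1 * swap 1 2, by simp [Perm.mem_alternatingGroup, Perm.sign_mul, sign_swap']⟩,
      ⟨swap 0 1 * swap 1 3, by simp [Perm.mem_alternatingGroup, Perm.sign_mul, sign_swap']⟩,
      fun h => ?_⟩
    have : ((swap 0 1 * swap 1 2) * (swap 0 1 * swap 1 3) : Perm (Fin 5)) 0 =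
      ((swap 0 1 * swap 1 3) * (swap 0 1 * swap 1 2) : Perm (Fin 5)) 0 :=
      DFunLike.congr_fun (congrArg Subtype.val h) 0
    revert this
    decide +kernel

end FieldOfNine

end EdgeTransitive

namespace EdgeTransitive

open Equiv Equiv.Perm

/-! ### Permutations as lists, for kernel evaluation -/

section Codes

/-! The functions on lists which follow are defined by means of recursors, so that the kernel
evaluates them fast. -/

/-- Universal quantification over a list. -/
def allRec {α : Type} (p : α → Bool) (l : List α) : Bool :=
  List.rec true (fun a _ ih => Bool.rec false ih (p a)) l

/-- Existential quantification over a list. -/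
def anyRec {α : Type} (p : α → Bool) (l : List α) : Bool :=
  List.rec false (fun a _ ih => Bool.rec ih true (p a)) l

/-- The lists of length `k` over `vs`, prepended to the list `l`, all of whose entries are allowed
by `ok` in view of their position and of the entries behind them. -/
def collect (vs : List ℕ) (ok : ℕ → ℕ → List ℕ → Bool) (k : ℕ) : List ℕ → List (List ℕ) :=
  Nat.rec (fun l => [l]) (fun k ih l =>
    List.rec [] (fun v _ r => Bool.rec r (ih (v :: l) ++ r) (ok k v l)) vs) k

/-- The entry of a list at a given position. -/
def nthRec (l : List ℕ) : ℕ → ℕ :=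
  List.rec (fun _ => 0) (fun b _ ih n => Nat.rec b (fun n _ => ih n) n) l

/-- The set with the bits of `T` is the image of the one with the bits of `S` under the permutation
with the values `l`. -/
def matchRec (l : List ℕ) (T : ℕ) : ℕ → Bool :=
  List.rec (fun _ => true) (fun v _ ih S => Bool.rec false (ih (Nat.shiftRight S 1))
    (Nat.beq (Nat.land 1 (Nat.shiftRight T v)) (Nat.land 1 S))) l

/-- The permutation with the values `l` preserves the family `o` of sets. -/
def preservesRec (o l : List ℕ) : Bool :=
  allRec (fun S => anyRec (fun T => matchRec l T S) o) o

/-- The number of entries smaller than `a` is even. -/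
def evenLtRec (a : ℕ) (l : List ℕ) : Bool :=
  List.rec true (fun b _ ih => Bool.rec (!ih) ih (Nat.ble a b)) l

/-- The number of inversions is even. -/
def evenRec (l : List ℕ) : Bool :=
  List.rec true (fun v l ih => Bool.rec (!ih) ih (evenLtRec v l)) l

/-- The entry `v` at position `k` is not one of those behind it. -/
def okInjective (_ v : ℕ) (l : List ℕ) : Bool := !anyRec (Nat.beq v) l

/-- The entry `v` at position `k` is compatible with those behind it in an involution. -/
def okInvolution (k v : ℕ) (l : List ℕ) : Bool :=
  Bool.rec (Nat.beq (nthRec l (Nat.sub v (Nat.succ k))) k)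
    (Bool.rec (!anyRec (Nat.beq v) l) false (anyRec (Nat.beq k) l)) (Nat.ble v k)

/-- The composite of the permutations with the values `l` and `l'`. -/
def compRec (l l' : List ℕ) : List ℕ := l'.map (nthRec l)

theorem allRec_iff {α : Type} {p : α → Bool} {l : List α} :
    allRec p l = true ↔ ∀ a ∈ l, p a = true := by
  induction l with
  | nil => simp [allRec]
  | cons a l ih =>
    rw [List.forall_mem_cons, ← ih]
    change (Bool.rec false (allRec p l) (p a) : Bool) = true ↔ _
    cases p a <;> simp

theorem anyRec_iff {α : Type} {p : α → Bool} {l : List α} :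
    anyRec p l = true ↔ ∃ a ∈ l, p a = true := by
  induction l with
  | nil => simp [anyRec]
  | cons a l ih =>
    rw [List.exists_mem_cons_iff, ← ih]
    change (Bool.rec (anyRec p l) true (p a) : Bool) = true ↔ _
    cases p a <;> simp

theorem nthRec_eq (l : List ℕ) (n : ℕ) : nthRec l n = l.getD n 0 := by
  induction l generalizing n with
  | nil => simp [nthRec]
  | cons a l ih =>
    cases n with
    | zero => rfl
    | succ n => exact (ih n).trans rfl

/-- The lists are built from the last position backwards. Only completeness of the enumeration is
needed: superfluous lists would merely make a check harder to pass. -/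
theorem mem_collect {vs : List ℕ} {ok : ℕ → ℕ → List ℕ → Bool} {L : List ℕ}
    (hvs : ∀ v ∈ L, v ∈ vs) (hok : ∀ (k : ℕ) (hk : k < L.length), ok k L[k] (L.drop (k + 1)))
    {k : ℕ} (hk : k ≤ L.length) : L ∈ collect vs ok k (L.drop k) := by
  induction k with
  | zero => exact List.mem_singleton.2 rfl
  | succ k ih =>
    have h₁ := ih (by omega)
    have h₂ := hok k hk
    rw [List.drop_eq_getElem_cons hk] at h₁
    have h₃ := hvs _ (List.getElem_mem hk)
    generalize L[k] = a at h₁ h₂ h₃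
    generalize L.drop (k + 1) = l at h₁ h₂
    change L ∈ (List.rec [] (fun v _ r => Bool.rec r (collect vs ok k (v :: l) ++ r) (ok k v l)) vs :
      List (List ℕ))
    clear hvs hok ih
    generalize collect vs ok k = F at h₁ ⊢
    induction vs with
    | nil => simp at h₃
    | cons v vs ih =>
      change L ∈ (Bool.rec _ (F (v :: l) ++ _) (ok k v l) : List (List ℕ))
      rcases List.mem_cons.1 h₃ with rfl | h₃
      · rw [h₂]
        exact List.mem_append_left _ h₁
      · have := ih h₃
        cases ok k v l
        · exact this
        · exact List.mem_append_right _ this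

theorem evenLtRec_cons (a b : ℕ) (l : List ℕ) :
    evenLtRec a (b :: l) = (Nat.ble a b == evenLtRec a l) := by
  change (Bool.rec (!evenLtRec a l) (evenLtRec a l) (Nat.ble a b) : Bool) = _
  cases Nat.ble a b <;> cases evenLtRec a l <;> rfl

theorem evenRec_cons (a : ℕ) (l : List ℕ) :
    evenRec (a :: l) = (evenLtRec a l == evenRec l) := by
  change (Bool.rec (!evenRec l) (evenRec l) (evenLtRec a l) : Bool) = _
  cases evenLtRec a l <;> cases evenRec l <;> rfl

theorem matchRec_cons (v : ℕ) (l : List ℕ) (T S : ℕ) :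
    matchRec (v :: l) T S = ((T.testBit v == S.testBit 0) && matchRec l T (S >>> 1)) := by
  change (Bool.rec false (matchRec l T (S >>> 1))
    (Nat.beq (Nat.land 1 (Nat.shiftRight T v)) (Nat.land 1 S)) : Bool) = _
  have e : Nat.beq (Nat.land 1 (Nat.shiftRight T v)) (Nat.land 1 S) =
      (T.testBit v == S.testBit 0) := by
    change Nat.beq (1 &&& (T >>> v)) (1 &&& S) = ((1 &&& (T >>> v) != 0) == (1 &&& S != 0))
    rw [Nat.one_and_eq_mod_two, Nat.one_and_eq_mod_two]
    rcases Nat.mod_two_eq_zero_or_one (T >>> v) with h | h <;>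
      rcases Nat.mod_two_eq_zero_or_one S with h' | h' <;> rw [h, h'] <;> rfl
  rw [e]
  cases T.testBit v == S.testBit 0 <;> rfl

variable {n : ℕ}

/-- The list of the values of a permutation. -/
def code (g : Perm (Fin n)) : List ℕ := List.ofFn fun i => (g i).val

theorem length_code (g : Perm (Fin n)) : (code g).length = n := List.length_ofFn

theorem getElem_code (g : Perm (Fin n)) {k : ℕ} (hk : k < (code g).length) :
    (code g)[k] = (g ⟨k, length_code g ▸ hk⟩).val := List.getElem_ofFn _

theorem nthRec_code (g : Perm (Fin n)) (i : Fin n) : nthRec (code g) i.val = (g i).val := by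
  rw [nthRec_eq, List.getD_eq_getElem _ _ (by rw [length_code]; exact i.2), getElem_code]

theorem compRec_code (g h : Perm (Fin n)) : compRec (code g) (code h) = code (g * h) := by
  rw [compRec, code, code, List.map_ofFn]
  congr 1
  ext i : 1
  exact nthRec_code g (h i)

theorem mem_drop_code {g : Perm (Fin n)} {k v : ℕ} :
    v ∈ (code g).drop k ↔ ∃ j : Fin n, k ≤ j.val ∧ (g j).val = v := by
  rw [List.mem_drop_iff_getElem]
  constructor
  · rintro ⟨j, hj, rfl⟩
    exact ⟨⟨j + k, length_code g ▸ hj⟩, Nat.le_add_left k j,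
      (getElem_code g (k := j + k) hj).symm.trans (by congr 1; exact Nat.add_comm j k)⟩
  · rintro ⟨j, hj, rfl⟩
    have hlt : j.val - k + k < (code g).length := by
      rw [length_code, Nat.sub_add_cancel hj]
      exact j.2
    refine ⟨j.val - k, hlt, ?_⟩
    rw [getElem_code]
    congr 3
    exact Nat.add_sub_cancel' hj

theorem code_mem_collect {g : Perm (Fin n)} {ok : ℕ → ℕ → List ℕ → Bool}
    (h : ∀ k : Fin n, ok k (g k) ((code g).drop (k.val + 1))) :
    code g ∈ collect (List.range n) ok n [] := by
  have := mem_collect (vs := List.range n) (ok := ok) (L := code g) ?_ ?_ (le_refl _)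
  · rwa [List.drop_length, length_code] at this
  · intro v hv
    obtain ⟨j, -, rfl⟩ := mem_drop_code.1 (List.drop_zero (l := code g) ▸ hv)
    exact List.mem_range.2 (g j).2
  · intro k hk
    rw [getElem_code]
    exact h ⟨k, length_code g ▸ hk⟩

theorem code_mem_collect_okInjective (g : Perm (Fin n)) :
    code g ∈ collect (List.range n) okInjective n [] := by
  refine code_mem_collect fun k => ?_
  rw [okInjective, Bool.not_eq_true', ← Bool.not_eq_true, anyRec_iff]
  rintro ⟨v, hv, he⟩
  obtain ⟨j, hj, rfl⟩ := mem_drop_code.1 hv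
  have := g.injective (Fin.ext (Nat.eq_of_beq_eq_true he))
  omega

theorem code_mem_collect_okInvolution {g : Perm (Fin n)} (hg : g * g = 1) :
    code g ∈ collect (List.range n) okInvolution n [] := by
  have hgg : ∀ i, g (g i) = i := fun i => DFunLike.congr_fun hg i
  refine code_mem_collect fun k => ?_
  rw [okInvolution]
  rcases hb : Nat.ble (g k).val k.val with _ | _
  · have hlt : k.val < (g k).val := by
      by_contra hle
      rw [Nat.ble_eq_true_of_le (by omega)] at hb
      exact Bool.noConfusion hb
    change Nat.beq _ _ = true
    rw [nthRec_eq]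
    -- The list behind position `k` starts at position `k + 1`, whence the shifted index.
    have hd : (Nat.sub (g k).val (Nat.succ k.val)) + (k.val + 1) = (g k).val := by
      change (g k).val - (k.val + 1) + (k.val + 1) = _
      omega
    rw [List.getD_eq_getElem?_getD, List.getElem?_drop, Nat.add_comm, hd,
      ← List.getD_eq_getElem?_getD, ← nthRec_eq, nthRec_code, hgg]
    exact Nat.beq_refl _
  · have hle : (g k).val ≤ k.val := Nat.le_of_ble_eq_true hb
    rcases ha : anyRec (Nat.beq k.val) ((code g).drop (k.val + 1)) with _ | _
    · change (!anyRec _ _) = true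
      rw [Bool.not_eq_true', ← Bool.not_eq_true, anyRec_iff]
      rintro ⟨v, hv, he⟩
      obtain ⟨j, hj, rfl⟩ := mem_drop_code.1 hv
      have := g.injective (Fin.ext (Nat.eq_of_beq_eq_true he))
      omega
    · obtain ⟨v, hv, he⟩ := anyRec_iff.1 ha
      obtain ⟨j, hj, rfl⟩ := mem_drop_code.1 hv
      have := congrArg g (Fin.ext (Nat.eq_of_beq_eq_true he) : k = g j)
      rw [hgg] at this
      omega

theorem evenLtRec_ofFn (a : ℕ) (f : Fin n → ℕ) (h : ∀ i, a ≠ f i) :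
    (if evenLtRec a (List.ofFn f) = true then 1 else -1 : ℤˣ) =
      ∏ j, if a < f j then 1 else -1 := by
  induction n with
  | zero => simp [evenLtRec]
  | succ n ih =>
    rw [Fin.prod_univ_succ, ← ih _ fun i => h i.succ, List.ofFn_succ, evenLtRec_cons]
    have hb : Nat.ble a (f 0) = decide (a < f 0) := by
      rw [Bool.eq_iff_iff, Nat.ble_eq, decide_eq_true_iff, le_iff_lt_or_eq, or_iff_left (h 0)]
    rw [hb]
    by_cases hlt : a < f 0 <;>
      cases evenLtRec a (List.ofFn fun i => f i.succ) <;> simp [hlt]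

/-- Counting inversions row by row matches the product formula for the sign. -/
theorem evenRec_ofFn (f : Fin n → ℕ) (h : Function.Injective f) :
    (if evenRec (List.ofFn f) = true then 1 else -1 : ℤˣ) =
      ∏ i, ∏ j ∈ Finset.Ioi i, if f i < f j then 1 else -1 := by
  induction n with
  | zero => simp [evenRec]
  | succ n ih =>
    have h' : Function.Injective fun i : Fin n => f i.succ := h.comp (Fin.succ_injective n)
    rw [Fin.prod_univ_succ, Fin.prod_Ioi_zero]
    simp only [Fin.prod_Ioi_succ]
    rw [← ih _ h', ← evenLtRec_ofFn _ _ fun i hi => Fin.succ_ne_zero i (h hi).symm,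
      List.ofFn_succ, evenRec_cons]
    cases evenLtRec (f 0) (List.ofFn fun i => f i.succ) <;>
      cases evenRec (List.ofFn fun i => f i.succ) <;> simp

theorem evenRec_code {g : Perm (Fin n)} (hg : sign g = 1) : evenRec (code g) = true := by
  have h := evenRec_ofFn (fun i => (g i).val) (Fin.val_injective.comp g.injective)
  have h' := sign_eq_prod_prod_Ioi g
  simp only [Fin.lt_def] at h'
  rw [← h', hg] at h
  by_contra hc
  rw [code] at hc
  rw [if_neg hc] at h
  exact absurd h (by decide)

/-- The permutation `g` maps every set of the family `o` to a set of this family, a set being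
given by the bits of a number. -/
def Preserves (g : Perm (Fin n)) (o : List ℕ) : Prop :=
  ∀ S ∈ o, ∃ T ∈ o, ∀ i : Fin n, T.testBit (g i) = S.testBit i

theorem matchRec_ofFn (f : Fin n → ℕ) (T S : ℕ) :
    matchRec (List.ofFn f) T S = true ↔ ∀ i, T.testBit (f i) = S.testBit i := by
  induction n generalizing S with
  | zero => simp [matchRec]
  | succ n ih =>
    rw [Fin.forall_fin_succ, List.ofFn_succ, matchRec_cons, Bool.and_eq_true, beq_iff_eq, ih]
    simp only [Nat.testBit_shiftRight, Fin.val_succ, Nat.add_comm, Fin.val_zero]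

theorem preservesRec_code {g : Perm (Fin n)} {o : List ℕ} :
    preservesRec o (code g) = true ↔ Preserves g o := by
  simp only [preservesRec, allRec_iff, anyRec_iff, code, matchRec_ofFn, Preserves]

theorem preserves_one (o : List ℕ) : Preserves (1 : Perm (Fin n)) o := fun S hS =>
  ⟨S, hS, fun _ => rfl⟩

theorem Preserves.mul {g h : Perm (Fin n)} {o : List ℕ} (hg : Preserves g o)
    (hh : Preserves h o) : Preserves (g * h) o := by
  intro S hS
  obtain ⟨T, hT, e⟩ := hh S hS
  obtain ⟨U, hU, e'⟩ := hg T hT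
  exact ⟨U, hU, fun i => (e' (h i)).trans (e i)⟩

/-- The inverse of a permutation of finite order is one of its powers. -/
theorem Preserves.inv {g : Perm (Fin n)} {o : List ℕ} (hg : Preserves g o) :
    Preserves g⁻¹ o := by
  have hpow : ∀ k : ℕ, Preserves (g ^ k) o := by
    intro k
    induction k with
    | zero => exact preserves_one o
    | succ k ih =>
      rw [pow_succ]
      exact ih.mul hg
  have : g⁻¹ = g ^ (orderOf g - 1) := by
    refine inv_eq_of_mul_eq_one_left ?_
    rw [pow_sub_one_mul (orderOf_pos g).ne', pow_orderOf_eq_one]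
  rw [this]
  exact hpow _

theorem Preserves.of_closure_eq_top {s : Set (alternatingGroup (Fin n))}
    (h : Subgroup.closure s = ⊤) {o : List ℕ} (hs : ∀ g ∈ s, Preserves (g : Perm (Fin n)) o)
    {g : Perm (Fin n)} (hg : sign g = 1) : Preserves g o := by
  have hmem : (⟨g, hg⟩ : alternatingGroup (Fin n)) ∈ Subgroup.closure s :=
    h ▸ Subgroup.mem_top _
  have key : ∀ x ∈ Subgroup.closure s, Preserves (x : Perm (Fin n)) o := by
    intro x hx
    induction hx using Subgroup.closure_induction with
    | mem x hx => exact hs x hx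
    | one => exact preserves_one o
    | mul x y _ _ hx hy => exact hx.mul hy
    | inv x _ hx => exact hx.inv
  exact key _ hmem

end Codes

end EdgeTransitive

namespace EdgeTransitive

open Equiv Equiv.Perm

/-! ### Exhaustive searches for invariant families -/

section Searches

/-- The values of the even involutions, and of the identity. -/
def evenInvolutions (n : ℕ) : List (List ℕ) :=
  (collect (List.range n) okInvolution n []).filter evenRec

/-- The set of the families in the list `O` preserved by the permutation with the values `l`. -/
def preservedRec (O : List (List ℕ)) (l : List ℕ) : ℕ :=
  List.rec 0 (fun o _ ih => Nat.bit (preservesRec o l) ih) O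

/-- For all even involutions `r₁` and `r₂`, the second one commuting with `r₀`, there is a family in
the list `O` preserved by both. -/
def checkTriples (n : ℕ) (O : List (List ℕ)) (l₀ : List ℕ) : Bool :=
  allRec (fun l₂ => Bool.rec true (allRec (fun l₁ =>
    !Nat.beq (Nat.land (preservedRec O l₁) (preservedRec O l₂)) 0) (evenInvolutions n))
      (compRec l₀ l₂ == compRec l₂ l₀)) (evenInvolutions n)

/-- Every even permutation preserves one of the families in the list `O` or is inverted by
one of the involutions with values in the list `C`. -/
def checkInverted (n : ℕ) (O C : List (List ℕ)) : Bool :=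
  allRec (fun l => Bool.rec true (Bool.rec (anyRec (fun c => compRec l (compRec c l) == c) C) true
    (anyRec (fun o => preservesRec o l) O)) (evenRec l)) (collect (List.range n) okInjective n [])

variable {n : ℕ}

theorem code_injective : Function.Injective (code : Perm (Fin n) → List ℕ) := fun _ _ h =>
  Equiv.ext fun i => Fin.ext (congrFun (List.ofFn_injective h) i)

theorem code_mem_evenInvolutions {g : Perm (Fin n)} (hg : g * g = 1) (hs : sign g = 1) :
    code g ∈ evenInvolutions n :=
  List.mem_filter.2 ⟨code_mem_collect_okInvolution hg, evenRec_code hs⟩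

/-- Each family of `O` owns one binary digit, so a common digit of the two masks is a family
preserved by both permutations. -/
theorem exists_preserves_of_land_ne_zero {g h : Perm (Fin n)} {O : List (List ℕ)}
    (H : Nat.land (preservedRec O (code g)) (preservedRec O (code h)) ≠ 0) :
    ∃ o ∈ O, Preserves g o ∧ Preserves h o := by
  change (preservedRec O (code g)) &&& (preservedRec O (code h)) ≠ 0 at H
  induction O with
  | nil =>
    change 0 &&& 0 ≠ 0 at H
    exact absurd H (by decide)
  | cons o O ih =>
    change Nat.bit (preservesRec o (code g)) (preservedRec O (code g)) &&&
      Nat.bit (preservesRec o (code h)) (preservedRec O (code h)) ≠ 0 at H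
    rw [Nat.land_bit] at H
    by_cases ho : Preserves g o ∧ Preserves h o
    · exact ⟨o, List.mem_cons_self, ho⟩
    · have : (preservesRec o (code g) && preservesRec o (code h)) = false := by
        rw [← Bool.not_eq_true, Bool.and_eq_true, preservesRec_code, preservesRec_code]
        exact ho
      rw [this] at H
      obtain ⟨o', ho', h'⟩ := ih fun h0 => H (by rw [h0]; rfl)
      exact ⟨o', List.mem_cons_of_mem o ho', h'⟩

theorem exists_preserves_of_checkTriples {O : List (List ℕ)} {r₀ r₁ r₂ : Perm (Fin n)}
    (h : checkTriples n (O.filter fun o => preservesRec o (code r₀)) (code r₀) = true)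
    (h₁ : r₁ * r₁ = 1) (h₂ : r₂ * r₂ = 1) (h₀₂ : r₀ * r₂ = r₂ * r₀) (s₁ : sign r₁ = 1)
    (s₂ : sign r₂ = 1) : ∃ o ∈ O, Preserves r₀ o ∧ Preserves r₁ o ∧ Preserves r₂ o := by
  have := allRec_iff.1 h _ (code_mem_evenInvolutions h₂ s₂)
  have e : (compRec (code r₀) (code r₂) == compRec (code r₂) (code r₀)) = true := by
    rw [compRec_code, compRec_code, h₀₂, beq_self_eq_true]
  rw [e] at this
  have := allRec_iff.1 this _ (code_mem_evenInvolutions h₁ s₁)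
  rw [Bool.not_eq_true', ← Bool.not_eq_true, Nat.beq_eq] at this
  obtain ⟨o, ho, h'⟩ := exists_preserves_of_land_ne_zero this
  rw [List.mem_filter, preservesRec_code] at ho
  exact ⟨o, ho.1, ho.2, h'⟩

theorem exists_preserves_or_inverted {O : List (List ℕ)} {C : List (Perm (Fin n))}
    (h : checkInverted n O (C.map code) = true) {g : Perm (Fin n)} (hg : sign g = 1) :
    (∃ o ∈ O, Preserves g o) ∨ ∃ c ∈ C, g * (c * g) = c := by
  have := allRec_iff.1 h _ (code_mem_collect_okInjective g)
  rw [evenRec_code hg] at this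
  change (Bool.rec _ true (anyRec _ O) : Bool) = true at this
  rcases hb : anyRec (fun o => preservesRec o (code g)) O with _ | _
  · rw [hb] at this
    obtain ⟨l, hl, e⟩ := anyRec_iff.1 this
    obtain ⟨c, hc, rfl⟩ := List.mem_map.1 hl
    rw [compRec_code, compRec_code, beq_iff_eq] at e
    exact Or.inr ⟨c, hc, code_injective e⟩
  · obtain ⟨o, ho, h⟩ := anyRec_iff.1 hb
    exact Or.inl ⟨o, ho, preservesRec_code.1 h⟩

/-- The partitions of a set of `n` elements into two parts. -/
def bipartitions (n : ℕ) : List (List ℕ) :=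
  -- The odd code is the part containing the point `0`; the upper bound omits the whole set.
  -- Invariance covers both intransitive groups and those with two blocks.
  (List.range (2 ^ (n - 1) - 1)).map fun i => [2 * i + 1, 2 ^ n - 2 - 2 * i]

/-- Some three-cycle does not preserve the family `o`. -/
def IsProper (n : ℕ) [NeZero n] (o : List ℕ) : Prop :=
  ∃ k : Fin n, k ≠ 0 ∧ k ≠ 1 ∧ preservesRec o (code (swap 0 1 * swap 1 k)) = false

instance (n : ℕ) [NeZero n] (o : List ℕ) : Decidable (IsProper n o) :=
  inferInstanceAs (Decidable (∃ k : Fin n, k ≠ 0 ∧ k ≠ 1 ∧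
    preservesRec o (code (swap 0 1 * swap 1 k)) = false))

theorem IsProper.not_preserves [NeZero n] {o : List ℕ} (ho : IsProper n o) (h1 : (0 : Fin n) ≠ 1) :
    ∃ g : Perm (Fin n), sign g = 1 ∧ ¬ Preserves g o := by
  obtain ⟨k, -, hk, hp⟩ := ho
  refine ⟨swap 0 1 * swap 1 k, ?_, ?_⟩
  · rw [Perm.sign_mul, sign_swap h1, sign_swap hk.symm]
    decide
  · rw [← preservesRec_code, hp]
    exact Bool.false_ne_true

/-- Families on six points: partitions into two or three parts, and the two designs, formed by
halves of the bisections, which are of interest. -/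
def familiesSix : List (List ℕ) :=
  bipartitions 6 ++ [[3, 12, 48], [5, 10, 48], [9, 6, 48],
    [7, 11, 21, 26, 28, 38, 41, 44, 49, 50], [7, 11, 22, 25, 28, 37, 42, 44, 49, 50]]

/-- Families on seven points: partitions into two parts, and six projective planes of order two. -/
def familiesSeven : List (List ℕ) :=
  bipartitions 7 ++ [[19, 28, 37, 42, 70, 73, 112], [19, 28, 38, 41, 69, 74, 112],
    [21, 26, 35, 44, 70, 73, 112], [21, 26, 38, 41, 67, 76, 112], [22, 25, 35, 44, 69, 74, 112],
    [22, 25, 37, 42, 67, 76, 112]]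

set_option maxRecDepth 10000

theorem isProper_familiesSix : ∀ o ∈ familiesSix, IsProper 6 o := by decide +kernel

theorem isProper_familiesSeven : ∀ o ∈ familiesSeven, IsProper 7 o := by decide +kernel

theorem isProper_bipartitions_eight : ∀ o ∈ bipartitions 8, IsProper 8 o := by decide +kernel

theorem checkTriples_six : checkTriples 6
    (familiesSix.filter fun o => preservesRec o [1, 0, 3, 2, 4, 5]) [1, 0, 3, 2, 4, 5] = true := by
  decide +kernel

theorem checkTriples_seven : checkTriples 7 ((bipartitions 7).filter fun o =>
    preservesRec o [1, 0, 3, 2, 4, 5, 6]) [1, 0, 3, 2, 4, 5, 6] = true := by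
  decide +kernel

theorem checkTriples_eight : checkTriples 8 ((bipartitions 8).filter fun o =>
      preservesRec o [1, 0, 3, 2, 4, 5, 6, 7]) [1, 0, 3, 2, 4, 5, 6, 7] = true ∧
    checkTriples 8 ((bipartitions 8).filter fun o =>
      preservesRec o [1, 0, 3, 2, 5, 4, 7, 6]) [1, 0, 3, 2, 5, 4, 7, 6] = true := by
  decide +kernel

/-- Involutions on seven points which commute with `(0 1)(2 3)`. -/
def invertersSeven : List (Perm (Fin 7)) :=
  [swap 0 3 * swap 1 2 * swap 4 6, swap 0 3 * swap 1 2 * swap 4 5, swap 0 3 * swap 1 2 * swap 5 6,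
    swap 0 2 * swap 1 3 * swap 4 6, swap 0 2 * swap 1 3 * swap 4 5, swap 0 2 * swap 1 3 * swap 5 6,
    swap 4 6, swap 4 5, swap 5 6, swap 0 1 * swap 2 3 * swap 4 6, swap 0 1 * swap 2 3 * swap 4 5,
    swap 0 1 * swap 2 3 * swap 5 6]

/-- The values of these involutions. -/
def inverterValuesSeven : List (List ℕ) :=
  [[3, 2, 1, 0, 6, 5, 4], [3, 2, 1, 0, 5, 4, 6], [3, 2, 1, 0, 4, 6, 5],
    [2, 3, 0, 1, 6, 5, 4], [2, 3, 0, 1, 5, 4, 6], [2, 3, 0, 1, 4, 6, 5],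
    [0, 1, 2, 3, 6, 5, 4], [0, 1, 2, 3, 5, 4, 6], [0, 1, 2, 3, 4, 6, 5],
    [1, 0, 3, 2, 6, 5, 4], [1, 0, 3, 2, 5, 4, 6], [1, 0, 3, 2, 4, 6, 5]]

theorem map_code_invertersSeven : invertersSeven.map code = inverterValuesSeven := by
  decide +kernel

theorem code_swap_seven :
    code (swap 0 1 * swap 2 3 : Perm (Fin 7)) = [1, 0, 3, 2, 4, 5, 6] := by
  decide +kernel

theorem compRec_inverterValuesSeven : ∀ l ∈ inverterValuesSeven,
    compRec l [1, 0, 3, 2, 4, 5, 6] = compRec [1, 0, 3, 2, 4, 5, 6] l := by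
  decide +kernel

theorem commute_invertersSeven {c : Perm (Fin 7)} (hc : c ∈ invertersSeven) :
    c * (swap 0 1 * swap 2 3) = swap 0 1 * swap 2 3 * c := by
  apply code_injective
  refine (compRec_code _ _).symm.trans (Eq.trans ?_ (compRec_code _ _))
  rw [code_swap_seven]
  refine compRec_inverterValuesSeven _ ?_
  rw [← map_code_invertersSeven]
  exact List.mem_map_of_mem hc

theorem code_swap_six :
    code (swap 0 1 * swap 2 3 : Perm (Fin 6)) = [1, 0, 3, 2, 4, 5] := by
  decide +kernel

theorem code_swap_eight :
    code (swap 0 1 * swap 2 3 : Perm (Fin 8)) = [1, 0, 3, 2, 4, 5, 6, 7] := by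
  decide +kernel

theorem code_swap_swap_eight :
    code (swap 0 1 * swap 2 3 * swap 4 5 * swap 6 7 : Perm (Fin 8)) =
      [1, 0, 3, 2, 5, 4, 7, 6] := by
  decide +kernel

/-- Every even `z` either shares an invariant family with `s = (0 1)(2 3)` or is inverted by a
listed involution centralising `s`. The listed involutions are odd, so they act on `A₇` by
conjugation within `S₇`. -/
theorem checkInverted_seven : checkInverted 7 (familiesSeven.filter fun o =>
    preservesRec o [1, 0, 3, 2, 4, 5, 6]) inverterValuesSeven = true := by
  decide +kernel

end Searches

end EdgeTransitive

namespace EdgeTransitive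

open Equiv Equiv.Perm

/-! ### Normalisation up to conjugacy and the excluded degrees -/

section Conjugacy

variable {n : ℕ}

theorem cycleType_of_involution {g : Perm (Fin n)} (hg : g * g = 1) :
    g.cycleType = Multiset.replicate g.cycleType.card 2 :=
  have : Fact (Nat.Prime 2) := ⟨Nat.prime_two⟩
  cycleType_of_pow_prime_eq_one (by rw [sq, hg])

theorem isConj_of_involutions {g h : Perm (Fin n)} (hg : g * g = 1) (hh : h * h = 1)
    (H : g.cycleType.card = h.cycleType.card) : IsConj g h := by
  rw [isConj_iff_cycleType_eq, cycleType_of_involution hg, cycleType_of_involution hh, H]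

theorem card_cycleType_of_involution {g : Perm (Fin n)} (hg : g * g = 1) :
    2 * g.cycleType.card = g.support.card := by
  rw [← sum_cycleType, cycleType_of_involution hg]
  simp [mul_comm]

/-- An even involution has an even number of transpositions. This leaves one conjugacy class in
degrees `6` and `7`, and two in degree `8`. -/
theorem card_cycleType_even_involution {g : Perm (Fin n)} (hg : g * g = 1) (hs : sign g = 1)
    (h1 : g ≠ 1) : 2 ∣ g.cycleType.card ∧ 0 < g.cycleType.card ∧ 2 * g.cycleType.card ≤ n := by
  refine ⟨?_, ?_, ?_⟩
  · have h := sign_of_cycleType g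
    rw [hs, cycleType_of_involution hg, Multiset.sum_replicate, Multiset.card_replicate,
      smul_eq_mul] at h
    by_contra hodd
    rw [Odd.neg_one_pow (by
      rw [← even_iff_two_dvd, Nat.not_even_iff_odd] at hodd
      exact (Even.mul_left even_two _).add_odd hodd)] at h
    exact absurd h (by decide)
  · exact Multiset.card_pos.2 fun h => h1 (cycleType_eq_zero.1 h)
  · rw [card_cycleType_of_involution hg]
    exact (Finset.card_le_univ _).trans_eq (Fintype.card_fin n)

theorem closure_map_eq_top {G : Type*} [Group G] (φ : G ≃* G) {s : Set G}
    (h : Subgroup.closure s = ⊤) : Subgroup.closure (φ '' s) = ⊤ := by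
  have := MonoidHom.map_closure φ.toMonoidHom s
  rw [h, Subgroup.map_top_of_surjective _ φ.surjective] at this
  exact this.symm

/-- A triple of even involutions generating the alternating group, two of them commuting, may be
chosen so that the first one is one of given representatives of the conjugacy classes. -/
theorem exists_normalized_triple (hn : 5 ≤ n) (R : List (Perm (Fin n)))
    (hR : ∀ g : Perm (Fin n), g * g = 1 → sign g = 1 → g ≠ 1 → ∃ r ∈ R, IsConj g r)
    {a₀ a₁ a₂ : alternatingGroup (Fin n)} (h₀ : a₀ * a₀ = 1) (h₁ : a₁ * a₁ = 1)
    (h₂ : a₂ * a₂ = 1) (h₀₂ : a₀ * a₂ = a₂ * a₀) (h : Subgroup.closure {a₀, a₁, a₂} = ⊤) :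
    ∃ b₀ b₁ b₂ : alternatingGroup (Fin n), (b₀ : Perm (Fin n)) ∈ R ∧ b₁ * b₁ = 1 ∧ b₂ * b₂ = 1 ∧
      b₀ * b₂ = b₂ * b₀ ∧ Subgroup.closure {b₀, b₁, b₂} = ⊤ := by
  obtain ⟨a₀, a₁, a₂, h₀, h₁, h₂, h₀₂, h, h1⟩ : ∃ a₀ a₁ a₂ : alternatingGroup (Fin n),
      a₀ * a₀ = 1 ∧ a₁ * a₁ = 1 ∧ a₂ * a₂ = 1 ∧ a₀ * a₂ = a₂ * a₀ ∧
      Subgroup.closure {a₀, a₁, a₂} = ⊤ ∧ a₀ ≠ 1 := by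
    -- If `a₀` is trivial, it may be replaced by `a₂`, or by `a₁` when `a₂` is trivial too, without
    -- changing the group generated.
    by_cases e₀ : a₀ = 1
    · by_cases e₂ : a₂ = 1
      · refine ⟨a₁, a₁, a₁, h₁, h₁, h₁, rfl, ?_, ?_⟩
        · rw [← h, e₀, e₂]
          simp [Subgroup.closure_insert_one, Set.pair_comm a₁ 1]
        · rintro rfl
          rw [e₀, e₂, Set.pair_eq_singleton, Set.pair_eq_singleton,
            Subgroup.closure_singleton_one] at h
          have : Nontrivial (alternatingGroup (Fin n)) :=
            alternatingGroup.nontrivial_of_three_le_card (by rw [Nat.card_fin]; omega)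
          exact bot_ne_top h
      · refine ⟨a₂, a₁, a₂, h₂, h₁, h₂, rfl, ?_, e₂⟩
        rw [← h, e₀, Subgroup.closure_insert_one, Set.pair_comm a₁ a₂, Set.insert_eq_of_mem]
        simp
    · exact ⟨a₀, a₁, a₂, h₀, h₁, h₂, h₀₂, h, e₀⟩
  obtain ⟨r, hr, hc⟩ := hR a₀ (congrArg Subtype.val h₀) a₀.2 fun e => h1 (Subtype.ext e)
  obtain ⟨c, hc⟩ := isConj_iff.1 hc
  let φ : alternatingGroup (Fin n) ≃* alternatingGroup (Fin n) := MulAut.conjNormal c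
  refine ⟨φ a₀, φ a₁, φ a₂, ?_, by rw [← map_mul, h₁, map_one], by rw [← map_mul, h₂, map_one],
    by rw [← map_mul, h₀₂, map_mul], ?_⟩
  · have : (φ a₀ : Perm (Fin n)) = r := (MulAut.conjNormal_apply c a₀).trans hc
    rwa [this]
  · have := closure_map_eq_top φ h
    rwa [Set.image_insert_eq, Set.image_pair] at this

/-- The alternating group is not generated by three involutions, two of them commuting, if each such
triple preserves a proper family of sets. -/
theorem not_isRealised_one_of_check [NeZero n] (hn : 5 ≤ n) (R : List (Perm (Fin n)))
    (hR : ∀ g : Perm (Fin n), g * g = 1 → sign g = 1 → g ≠ 1 → ∃ r ∈ R, IsConj g r)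
    (O : List (List ℕ)) (hO : ∀ o ∈ O, IsProper n o)
    (hcheck : ∀ r ∈ R,
      checkTriples n (O.filter fun o => preservesRec o (code r)) (code r) = true) :
    ¬ IsRealised .one (alternatingGroup (Fin n)) := by
  intro h
  obtain ⟨a₀, a₁, a₂, h₀, h₁, h₂, h₀₂, hgen⟩ := h.one_generators
  obtain ⟨b₀, b₁, b₂, hb, h₁, h₂, h₀₂, hgen⟩ :=
    exists_normalized_triple hn R hR h₀ h₁ h₂ h₀₂ hgen
  obtain ⟨o, ho, p₀, p₁, p₂⟩ := exists_preserves_of_checkTriples (hcheck _ hb)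
    (congrArg Subtype.val h₁) (congrArg Subtype.val h₂) (congrArg Subtype.val h₀₂) b₁.2 b₂.2
  obtain ⟨g, hg, hgo⟩ := (hO o ho).not_preserves (by
    obtain ⟨m, rfl⟩ := Nat.exists_eq_add_of_le' (Nat.le_of_succ_le hn)
    simp)
  refine hgo (Preserves.of_closure_eq_top hgen ?_ hg)
  rintro _ (rfl | rfl | rfl) <;> assumption

theorem not_isRealised_one_six : ¬ IsRealised .one (alternatingGroup (Fin 6)) := by
  refine not_isRealised_one_of_check (by norm_num) [swap 0 1 * swap 2 3] ?_ familiesSix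
    isProper_familiesSix ?_
  · intro g hg hs h1
    obtain ⟨h₁, h₂, h₃⟩ := card_cycleType_even_involution hg hs h1
    refine ⟨_, List.mem_singleton_self _, isConj_of_involutions hg (by decide +kernel) ?_⟩
    have := card_cycleType_of_involution (g := (swap 0 1 * swap 2 3 : Perm (Fin 6)))
      (by decide +kernel)
    rw [show (swap 0 1 * swap 2 3 : Perm (Fin 6)).support.card = 4 by decide +kernel] at this
    omega
  · intro r hr
    rw [List.mem_singleton.1 hr, code_swap_six]
    exact checkTriples_six

theorem isConj_swap_mul_swap_seven {g : Perm (Fin 7)} (hg : g * g = 1) (hs : sign g = 1)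
    (h1 : g ≠ 1) : IsConj g (swap 0 1 * swap 2 3) := by
  obtain ⟨h₁, h₂, h₃⟩ := card_cycleType_even_involution hg hs h1
  refine isConj_of_involutions hg (by decide +kernel) ?_
  have := card_cycleType_of_involution (g := (swap 0 1 * swap 2 3 : Perm (Fin 7)))
    (by decide +kernel)
  rw [show (swap 0 1 * swap 2 3 : Perm (Fin 7)).support.card = 4 by decide +kernel] at this
  omega

theorem not_isRealised_one_seven : ¬ IsRealised .one (alternatingGroup (Fin 7)) := by
  refine not_isRealised_one_of_check (by norm_num) [swap 0 1 * swap 2 3] ?_ (bipartitions 7)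
    (fun o ho => isProper_familiesSeven o (List.mem_append_left _ ho)) ?_
  · exact fun g hg hs h1 => ⟨_, List.mem_singleton_self _, isConj_swap_mul_swap_seven hg hs h1⟩
  · intro r hr
    rw [List.mem_singleton.1 hr, code_swap_seven]
    exact checkTriples_seven

theorem not_isRealised_one_eight : ¬ IsRealised .one (alternatingGroup (Fin 8)) := by
  refine not_isRealised_one_of_check (by norm_num) [swap 0 1 * swap 2 3,
    swap 0 1 * swap 2 3 * swap 4 5 * swap 6 7] ?_ (bipartitions 8) isProper_bipartitions_eight ?_
  · intro g hg hs h1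
    obtain ⟨h₁, h₂, h₃⟩ := card_cycleType_even_involution hg hs h1
    have h₄ : g.cycleType.card = 2 ∨ g.cycleType.card = 4 := by omega
    rcases h₄ with h | h
    · refine ⟨_, List.mem_cons_self, isConj_of_involutions hg (by decide +kernel) ?_⟩
      have := card_cycleType_of_involution (g := (swap 0 1 * swap 2 3 : Perm (Fin 8)))
        (by decide +kernel)
      rw [show (swap 0 1 * swap 2 3 : Perm (Fin 8)).support.card = 4 by decide +kernel] at this
      omega
    · refine ⟨_, List.mem_cons_of_mem _ (List.mem_singleton_self _),
        isConj_of_involutions hg (by decide +kernel) ?_⟩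
      have := card_cycleType_of_involution
        (g := (swap 0 1 * swap 2 3 * swap 4 5 * swap 6 7 : Perm (Fin 8))) (by decide +kernel)
      rw [show (swap 0 1 * swap 2 3 * swap 4 5 * swap 6 7 : Perm (Fin 8)).support.card = 8 by
        decide +kernel] at this
      omega
  · intro r hr
    rcases List.mem_cons.1 hr with rfl | hr
    · rw [code_swap_eight]
      exact checkTriples_eight.1
    · rw [List.mem_singleton.1 hr, code_swap_swap_eight]
      exact checkTriples_eight.2

/-- Two generators of the alternating group of degree seven, one of them an involution, are inverted
by an automorphism. -/
theorem alternatingGroup_seven_exists_mulEquiv_inv {s z : alternatingGroup (Fin 7)}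
    (hs : s * s = 1) (h : Subgroup.closure {s, z} = ⊤) :
    ∃ α : alternatingGroup (Fin 7) ≃* alternatingGroup (Fin 7), α s = s⁻¹ ∧ α z = z⁻¹ := by
  by_cases h1 : s = 1
  -- A trivial `s` would make the group cyclic.
  · exfalso
    rw [h1, Subgroup.closure_insert_one] at h
    have hcomm (a b : alternatingGroup (Fin 7)) : a * b = b * a := by
      have hz (a : alternatingGroup (Fin 7)) : a ∈ Subgroup.zpowers z := by
        rw [Subgroup.zpowers_eq_closure, h]
        exact Subgroup.mem_top a
      obtain ⟨i, rfl⟩ := hz a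
      obtain ⟨j, rfl⟩ := hz b
      exact ((Commute.refl z).zpow_zpow i j).eq
    have : ((swap 0 1 * swap 1 2) * (swap 0 1 * swap 1 3) : Perm (Fin 7)) 0 =
        ((swap 0 1 * swap 1 3) * (swap 0 1 * swap 1 2) : Perm (Fin 7)) 0 :=
      DFunLike.congr_fun (congrArg Subtype.val (hcomm
        ⟨swap 0 1 * swap 1 2, by simp [Perm.mem_alternatingGroup, Perm.sign_mul, sign_swap']⟩
        ⟨swap 0 1 * swap 1 3, by simp [Perm.mem_alternatingGroup, Perm.sign_mul, sign_swap']⟩)) 0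
    revert this
    decide +kernel
  obtain ⟨c, hc⟩ := isConj_iff.1 (isConj_swap_mul_swap_seven (congrArg Subtype.val hs) s.2
    fun e => h1 (Subtype.ext e))
  let φ : alternatingGroup (Fin 7) ≃* alternatingGroup (Fin 7) := MulAut.conjNormal c
  have hφ : ∀ x, (φ x : Perm (Fin 7)) = c * x * c⁻¹ := MulAut.conjNormal_apply c
  have hgen := closure_map_eq_top φ h
  rw [Set.image_pair] at hgen
  have hφs : (φ s : Perm (Fin 7)) = swap 0 1 * swap 2 3 := (hφ s).trans hc
  suffices H : ∃ α : alternatingGroup (Fin 7) ≃* alternatingGroup (Fin 7),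
      α (φ s) = (φ s)⁻¹ ∧ α (φ z) = (φ z)⁻¹ by
    obtain ⟨α, hα, hα'⟩ := H
    refine ⟨(φ.trans α).trans φ.symm, ?_, ?_⟩
    · simp [hα]
    · simp [hα']
  have hss : φ s * φ s = 1 := by rw [← map_mul, hs, map_one]
  generalize φ s = t at hgen hφs hss
  generalize φ z = w at hgen
  -- After conjugation `s` is `(0 1)(2 3)`. A common invariant family contradicts generation; an
  -- inverting involution `d` commutes with `s = s⁻¹`, so conjugation by it inverts both generators.
  rcases exists_preserves_or_inverted (O := familiesSeven.filter fun o =>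
    preservesRec o [1, 0, 3, 2, 4, 5, 6]) (C := invertersSeven)
    (map_code_invertersSeven ▸ checkInverted_seven) w.2 with ⟨o, ho, hw⟩ | ⟨d, hd, hw⟩
  · exfalso
    rw [List.mem_filter, ← code_swap_seven, preservesRec_code] at ho
    obtain ⟨g, hg, hgo⟩ := (isProper_familiesSeven o ho.1).not_preserves (by decide)
    refine hgo (Preserves.of_closure_eq_top hgen ?_ hg)
    rintro _ (rfl | rfl)
    · rw [hφs]
      exact ho.2
    · exact hw
  · refine ⟨MulAut.conjNormal d, ?_, ?_⟩
    · rw [inv_eq_of_mul_eq_one_left hss]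
      refine Subtype.ext ((MulAut.conjNormal_apply d t).trans ?_)
      rw [hφs, commute_invertersSeven hd, mul_inv_cancel_right]
    · refine Subtype.ext ((MulAut.conjNormal_apply d w).trans ?_)
      rw [Subgroup.coe_inv, mul_inv_eq_iff_eq_mul, eq_inv_mul_iff_mul_eq]
      exact hw

end Conjugacy

/-! ### Assembling the classification -/

section Main

theorem edgeClass_of_isRealised_alternatingGroup {n : ℕ} (hn : 5 ≤ n) {T : EdgeClass}
    (h : IsRealised T (alternatingGroup (Fin n))) :
    (T = .one ∧ (n = 5 ∨ 9 ≤ n)) ∨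
      ((∃ σ, T = .two σ) ∨ T = .three ∨ (∃ σ, T = .four σ)) ∨
      ((∃ σ, T = .twoEx σ) ∧ 8 ≤ n) ∨ ((∃ σ, T = .five σ) ∧ 7 ≤ n) := by
  cases T with
  | one =>
    refine Or.inl ⟨rfl, ?_⟩
    by_contra hc
    have : n = 6 ∨ n = 7 ∨ n = 8 := by omega
    rcases this with rfl | rfl | rfl
    exacts [not_isRealised_one_six h, not_isRealised_one_seven h, not_isRealised_one_eight h]
  | two σ => exact Or.inr (Or.inl (Or.inl ⟨σ, rfl⟩))
  | twoEx σ =>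
    refine Or.inr (Or.inr (Or.inl ⟨⟨σ, rfl⟩, ?_⟩))
    by_contra hc
    obtain ⟨s, z, hs, hgen, hno⟩ := h.twoEx_generators
    have : n = 5 ∨ n = 6 ∨ n = 7 := by omega
    rcases this with rfl | rfl | rfl
    exacts [hno (alternatingGroup_five_exists_mulEquiv_inv hgen),
      hno (alternatingGroup_six_exists_mulEquiv_inv hgen),
      hno (alternatingGroup_seven_exists_mulEquiv_inv hs hgen)]
  | three => exact Or.inr (Or.inl (Or.inr (Or.inl rfl)))
  | four σ => exact Or.inr (Or.inl (Or.inr (Or.inr ⟨σ, rfl⟩)))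
  | five σ =>
    refine Or.inr (Or.inr (Or.inr ⟨⟨σ, rfl⟩, ?_⟩))
    by_contra hc
    obtain ⟨x, y, hgen, hno⟩ := h.five_generators
    have : n = 5 ∨ n = 6 := by omega
    rcases this with rfl | rfl
    exacts [hno (alternatingGroup_five_exists_mulEquiv_inv hgen),
      hno (alternatingGroup_six_exists_mulEquiv_inv hgen)]

end Main

end EdgeTransitive

theorem theorem4p2 (n : ℕ) (hn : 5 ≤ n) (T : EdgeTransitive.EdgeClass) :
    EdgeTransitive.IsRealised T (alternatingGroup (Fin n)) ↔
      (T = .one ∧ (n = 5 ∨ 9 ≤ n)) ∨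
      ((∃ σ, T = .two σ) ∨ T = .three ∨ (∃ σ, T = .four σ)) ∨
      ((∃ σ, T = .twoEx σ) ∧ 8 ≤ n) ∨
      ((∃ σ, T = .five σ) ∧ 7 ≤ n) :=
  ⟨EdgeTransitive.edgeClass_of_isRealised_alternatingGroup hn,
    EdgeTransitive.isRealised_alternatingGroup hn⟩
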